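/- Let $n$ be a positive integer, let $N_n=\{0,1,\dots,n-2,\infty\}$, and let $K$ be the complete graph of order $2n+1$ on the vertex set $\{a_i : i\in N_n\}\cup\{b_i : i\in N_n\}\cup\{c\}$. Let $G$ be a finite simple $(2n+1)$-regular graph, let $F$ be a $1$-factor of $G$, and let $\{\overrightarrow F_i : i\in N_n\}$ be a directed $2$-factorisation of $G-F$; that is, $\{F_i : i\in N_n\}$ is a $2$-factorisation of $G-F$, and each $\overrightarrow F_i$ is obtained from $F_i$ by orienting its edges so that every component becomes a directed cycle. For each vertex $v$ of $G$ let $\sigma_v$ be the bijection from $V(K)$ to the set of edges of $G$ incident with $v$ (regarded as vertices of the line graph $L(G)$) such that $\sigma_v(a_i)$ is the edge directed into $v$ in $\overrightarrow F_i$, $\sigma_v(b_i)$ is the edge directed out of $v$ in $\overrightarrow F_i$, and $\sigma_v(c)$ is the edge of $F$ incident with $v$. For a subgraph $H$ of $K$, let $\bigcup_{v\in V(G)}\sigma_v(H)$ be the spanning subgraph of $L(G)$ whose edges are the pairs $\sigma_v(x)\sigma_v(y)$ with $v\in V(G)$ and $xy\in E(H)$. Call a subgraph $H$ of $K$ a Hamilton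 fragment if, for every finite simple $(2n+1)$-regular graph $G$, every $1$-factor $F$ of $G$ and every directed $2$-factorisation $\{\overrightarrow F_i : i\in N_n\}$ of $G-F$ in which $\overrightarrow F_\infty$ is a Hamilton cycle, the edge set of $\bigcup_{v\in V(G)}\sigma_v(H)$ can be partitioned into the edge sets of Hamilton cycles of $L(G)$. Then for every positive integer $n$ the complete graph $K$ has a decomposition into Hamilton fragments: there is a set of subgraphs of $K$, each of which is a Hamilton fragment, whose edge sets partition the edge set of $K$. -/

import Mathlib

universe u

namespace HamiltonFragments

/-- A decomposition of a graph `G`: a set of subgraphs of `G`, each with at least one edge, whose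
edge sets partition the edge set of `G`. (All graphs are taken on the whole vertex set.) -/
structure IsDecomposition {W : Type*} (G : SimpleGraph W) (𝒟 : Set (SimpleGraph W)) : Prop where
  le : ∀ H ∈ 𝒟, H ≤ G
  ne_bot : ∀ H ∈ 𝒟, H ≠ ⊥
  existsUnique : ∀ e ∈ G.edgeSet, ∃! H, H ∈ 𝒟 ∧ e ∈ H.edgeSet

/-- The graph `C` is a Hamilton cycle on its vertex set: it consists of the edges of a closed walk
that is a cycle through all the vertices. -/
def IsHamiltonCycle {W : Type*} [DecidableEq W] (C : SimpleGraph W) : Prop :=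
  ∃ (w : W) (p : C.Walk w w), p.IsHamiltonianCycle ∧ ∀ e ∈ C.edgeSet, e ∈ p.edges

/-- `G` is Hamilton decomposable: it has a decomposition into Hamilton cycles. -/
def IsHamiltonDecomposable {W : Type*} [DecidableEq W] (G : SimpleGraph W) : Prop :=
  ∃ 𝒟 : Set (SimpleGraph W), IsDecomposition G 𝒟 ∧ ∀ C ∈ 𝒟, IsHamiltonCycle C

/-- A directed `2`-factorisation of `G`, with factors indexed by `ι`. A spanning directed graph all
of whose components are directed cycles is the same thing as a permutation of the vertices: the
arcs of the factor `i` are the pairs `(u, next i u)`, so that `s(v, next i v)` is the edge directed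
out of `v` and `s((next i).symm v, v)` is the edge directed into `v`. Every such pair is an edge of
`G`, and every edge of `G` is used by exactly one arc of exactly one factor (in particular no
factor has a directed cycle of length one or two). -/
structure DirectedTwoFactorisation {V : Type*} (G : SimpleGraph V) (ι : Type*) where
  next : ι → Equiv.Perm V
  bijOn : Set.BijOn (fun p : ι × V => s(p.2, next p.1 p.2)) Set.univ G.edgeSet

/-- The factor with index `i` is a (directed) Hamilton cycle: it has just one cycle, and this cycle
contains all the vertices. -/
def DirectedTwoFactorisation.IsHamiltonFactor {V : Type*} {G : SimpleGraph V} {ι : Type*}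
    (D : DirectedTwoFactorisation G ι) (i : ι) : Prop :=
  (D.next i).IsCycleOn Set.univ

/-- The set `{0, 1, …, n - 2, ∞}` of subscripts, for positive `n`; `∞` is `⊤`. -/
abbrev Subscript (n : ℕ) : Type := WithTop (Fin (n - 1))

/-- The `2 n + 1` vertices `a_i`, `b_i` (`i` a subscript) and `c`. -/
inductive FragmentVertex (n : ℕ) : Type
  | a (i : Subscript n) : FragmentVertex n
  | b (i : Subscript n) : FragmentVertex n
  | c : FragmentVertex n
  deriving DecidableEq, Fintype

section LineGraph

variable {V : Type*} {G : SimpleGraph V} {F : G.Subgraph} {n : ℕ}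

theorem DirectedTwoFactorisation.adj_next {ι : Type*} {G : SimpleGraph V}
    (D : DirectedTwoFactorisation G ι) (i : ι) (v : V) : G.Adj v (D.next i v) :=
  D.bijOn.mapsTo (Set.mem_univ (i, v))

theorem DirectedTwoFactorisation.adj_prev {ι : Type*} {G : SimpleGraph V}
    (D : DirectedTwoFactorisation G ι) (i : ι) (v : V) : G.Adj ((D.next i).symm v) v := by
  simpa using D.adj_next i ((D.next i).symm v)

/-- The bijection from `{a_i, b_i, c}` to the vertices of the line graph of `G` that are edges of
`G` at `v`: `a_i` goes to the edge directed into `v` in the `i`-th factor, `b_i` to the edge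
directed out of `v` in the `i`-th factor, and `c` to the edge at `v` of the `1`-factor `F`. -/
noncomputable def sigma (hF : F.IsPerfectMatching)
    (D : DirectedTwoFactorisation (G.deleteEdges F.edgeSet) (Subscript n)) (v : V) :
    FragmentVertex n → G.edgeSet
  | .a i => ⟨s((D.next i).symm v, v), G.deleteEdges_le _ (D.adj_prev i v)⟩
  | .b i => ⟨s(v, D.next i v), G.deleteEdges_le _ (D.adj_next i v)⟩
  | .c => ⟨hF.1.toEdge ⟨v, hF.2 v⟩, F.edgeSet_subset (hF.1.toEdge ⟨v, hF.2 v⟩).2⟩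

theorem sigma_injective (hF : F.IsPerfectMatching)
    (D : DirectedTwoFactorisation (G.deleteEdges F.edgeSet) (Subscript n)) (v : V) :
    Function.Injective (sigma hF D v) := by
  have key : ∀ i j : Subscript n, ∀ u w : V, s(u, D.next i u) = s(w, D.next j w) →
      i = j ∧ u = w := fun i j u w h => by
    have := D.bijOn.injOn (Set.mem_univ (i, u)) (Set.mem_univ (j, w)) h
    simpa using this
  have hab : ∀ i j : Subscript n, s((D.next i).symm v, v) ≠ s(v, D.next j v) := fun i j h => by
    have h1 := key i j ((D.next i).symm v) v (by simpa using h)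
    exact (D.adj_prev i v).ne h1.2
  have hc : ∀ e ∈ (G.deleteEdges F.edgeSet).edgeSet,
      e ≠ (hF.1.toEdge ⟨v, hF.2 v⟩ : Sym2 V) := fun e he h => by
    rw [SimpleGraph.edgeSet_deleteEdges, h] at he
    exact he.2 (hF.1.toEdge ⟨v, hF.2 v⟩).2
  intro x y h
  have h' : (sigma hF D v x : Sym2 V) = sigma hF D v y := congrArg Subtype.val h
  rcases x with i | i | _ <;> rcases y with j | j | _ <;> simp only [sigma] at h'
  · rw [(key i j ((D.next i).symm v) ((D.next j).symm v) (by simpa using h')).1]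
  · exact (hab i j h').elim
  · exact (hc _ (D.adj_prev i v) h').elim
  · exact (hab j i h'.symm).elim
  · rw [(key i j v v h').1]
  · exact (hc _ (D.adj_next i v) h').elim
  · exact (hc _ (D.adj_prev j v) h'.symm).elim
  · exact (hc _ (D.adj_next j v) h'.symm).elim
  · rfl

/-- The union over all vertices `v` of `G` of the copies `σ_v(H)` of `H`, a spanning subgraph of
the line graph of `G`. -/
def fragmentUnion (hF : F.IsPerfectMatching)
    (D : DirectedTwoFactorisation (G.deleteEdges F.edgeSet) (Subscript n))
    (H : SimpleGraph (FragmentVertex n)) : SimpleGraph G.edgeSet where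
  Adj e f := ∃ v x y, H.Adj x y ∧ sigma hF D v x = e ∧ sigma hF D v y = f
  symm := ⟨fun _ _ ⟨v, x, y, h, hx, hy⟩ => ⟨v, y, x, h.symm, hy, hx⟩⟩
  loopless := ⟨fun _ ⟨v, _, _, h, hx, hy⟩ => h.ne (sigma_injective hF D v (hx.trans hy.symm))⟩

end LineGraph

/-- A subgraph `H` of the complete graph on the `2 n + 1` vertices `a_i`, `b_i`, `c` is a Hamilton
fragment if, for every finite `(2 n + 1)`-regular graph `G`, every `1`-factor `F` of `G` and every
directed `2`-factorisation of `G - F` with index set `{0, …, n - 2, ∞}` in which the factor with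
index `∞` is a Hamilton cycle, the subgraph `⋃ v, σ_v(H)` of the line graph of `G` is Hamilton
decomposable. -/
def IsHamiltonFragment {n : ℕ} (H : SimpleGraph (FragmentVertex n)) : Prop :=
  ∀ (V : Type u) [Fintype V] [DecidableEq V] (G : SimpleGraph V) [DecidableRel G.Adj],
    G.IsRegularOfDegree (2 * n + 1) →
    ∀ (F : G.Subgraph) (hF : F.IsPerfectMatching)
      (D : DirectedTwoFactorisation (G.deleteEdges F.edgeSet) (Subscript n)),
      D.IsHamiltonFactor ⊤ → IsHamiltonDecomposable (fragmentUnion hF D H)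

end HamiltonFragments

/-!
The complete graph `K` is itself a Hamilton fragment, so that it has the decomposition `{K}`. As
`⋃ σ_v(K)` is the whole line graph `L(G)`, this means that `L(G)` has a decomposition into Hamilton
cycles whenever `G - F` has a directed `2`-factorisation one of whose factors is a Hamilton cycle.

The decomposition is built locally. Every edge of `L(G)` is a pair of edges of `G` at a common
vertex, so that a decomposition of `L(G)` into `2n` graphs, called colours here, amounts to a
decomposition of the complete graph at every vertex into `2n` parts. In a *local design*
(`LocalDesign`) every part consists of two paths, called *strands*. A colour has its own index `k`;
the four edges `a_∞, b_∞, a_k, b_k` are the ends of its two strands, and for every other index it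
always passes through just one of `a_i` and `b_i`. The edge `c` is in just one of two colours with
the same own index, and this alternates along the `1`-factor. Then every colour has degree at most
two at each vertex of `L(G)`. As all pairs at all vertices are covered and `L(G)` has degree `4n`,
the colours are disjoint and `2`-regular (`ArcSystem.isHamiltonDecomposable`).

It remains to make the colours connected. At a vertex the two strands match the four ends in one of
three patterns. A local design leaves a choice between two patterns at some vertices, the *active*
ones, and matches `a_∞` with `b_∞` and `a_k` with `b_k` at the others. Choose the patterns such that
as many pairs of arcs of the factors `∞` and `k` as possible are connected. If the four ends at an
active vertex were not all connected, then a parity argument shows that the rest of the colour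
already connects them in the current pattern, so that changing the pattern would connect all of
them: a contradiction. Hence the arcs of the Hamilton cycle `∞` are all connected with each other
and, at active vertices, with the arcs of the factor `k`; here every cycle of the factor `k` must
contain an active vertex (`exists_connecting_choice`). This is arranged by a two-colouring of the
union of two matchings (`exists_twoColouring`), the `1`-factor and one that has an edge on each cycle
of the factor `k`.

The rest is the construction of local designs on `h = n - 1` indices other than infinity. In the two
infinite families there is a group of two colours for every index, and one further group, whose two
colours consist of an *arc* and a strand from `a_∞` to `b_∞`; the one of them that has `c` can also
be opened and *linked* through one of the other groups, and this is its second pattern.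

* For odd `h = 2H + 1 ≥ 3`, the groups are the translates of one group, whose paths are zigzags
  (`OddOrder.design`).
* For even `h = 2w + 10`, zigzags through all the indices are the same for opposite indices, and the
  two groups with the same zigzag use the two alternating and the two constant choices of kinds. What
  is left over are a path through all the `a_i`, and for the `b_i` a path and a cycle. Turning five
  short segments of the constant colours changes these into the two arcs (`EvenOrder.frame`).
* For `h = 2, 4, 6, 8` the designs are given by tables, and for `h = 0, 1` directly; there some
  colours have no index of their own and only one strand, from `a_∞` to `b_∞`.
-/

namespace HamiltonFragments

/-! ### The trivial decomposition, and common two-colourings of two matchings -/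

/-- The trivial decomposition: a graph with at least one edge is decomposed into itself. -/
theorem isDecomposition_singleton {W : Type*} {G : SimpleGraph W} (hG : G ≠ ⊥) :
    IsDecomposition G {G} where
  le := by rintro H rfl; exact le_rfl
  ne_bot := by rintro H rfl; exact hG
  existsUnique := fun e he => ⟨G, ⟨rfl, he⟩, fun H hH => hH.1⟩

theorem fragmentVertex_top_ne_bot (n : ℕ) :
    (⊤ : SimpleGraph (FragmentVertex n)) ≠ ⊥ := by
  intro h
  have h1 : (⊤ : SimpleGraph (FragmentVertex n)).Adj (.a ⊤) .c := by simp
  rw [h] at h1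
  exact h1

/-- Two involutions `φ` and `μ` of a finite set, the first without fixed points, admit a common
two-colouring: the union of two matchings is bipartite. The colouring alternates along `φ` and
along every pair that `μ` really moves. -/
theorem exists_twoColouring {V : Type*} [Finite V] (φ μ : V → V)
    (hφ : Function.Involutive φ) (hμ : Function.Involutive μ) (hfix : ∀ v, φ v ≠ v) :
    ∃ s : V → Bool, (∀ v, s (φ v) = !s v) ∧ ∀ v, μ v ≠ v → s (μ v) = !s v := by
  classical
  cases nonempty_fintype V
  -- Induct on the number of points moved by `μ`, shortcutting one pair of `μ` at a time.
  suffices H : ∀ (k : ℕ) (S : Finset V) (φ : V → V), S.card = k →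
      (∀ v ∈ S, φ v ∈ S) → (∀ v ∈ S, φ (φ v) = v) → (∀ v ∈ S, φ v ≠ v) →
      ∃ s : V → Bool, (∀ v ∈ S, s (φ v) = !s v) ∧
        ∀ v ∈ S, μ v ∈ S → μ v ≠ v → s (μ v) = !s v by
    obtain ⟨s, h1, h2⟩ := H _ Finset.univ φ rfl (by simp) (fun v _ => hφ v) (fun v _ => hfix v)
    exact ⟨s, fun v => h1 v (by simp), fun v => h2 v (by simp) (by simp)⟩
  intro k
  induction k using Nat.strong_induction_on with
  | _ k ih =>
  intro S φ hk hm hi hf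
  by_cases hex : ∃ x ∈ S, μ x ∈ S ∧ μ x ≠ x
  · obtain ⟨x, hx, hy, hne⟩ := hex
    set y := μ x with hy_def
    have hμy : μ y = x := hμ x
    by_cases hxy : φ x = y
    · have hyx : φ y = x := by rw [← hxy]; exact hi x hx
      obtain ⟨s, h1, h2⟩ := ih ((S.erase x).erase y).card
        (by rw [← hk]; exact Finset.card_lt_card
              ((Finset.erase_subset _ _).trans_ssubset (Finset.erase_ssubset hx)))
        ((S.erase x).erase y) φ rfl
        (by
          intro v hv
          simp only [Finset.mem_erase] at hv ⊢
          refine ⟨fun h => hv.2.1 ?_, fun h => hv.1 ?_, hm v hv.2.2⟩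
          · rw [← hi v hv.2.2, h, hyx]
          · rw [← hi v hv.2.2, h, hxy])
        (fun v hv => hi v (by simp only [Finset.mem_erase] at hv; exact hv.2.2))
        (fun v hv => hf v (by simp only [Finset.mem_erase] at hv; exact hv.2.2))
      have hs : ∀ v, v ≠ x → v ≠ y →
          (Function.update (Function.update s x true) y false) v = s v := fun v a b => by
        rw [Function.update_of_ne b, Function.update_of_ne a]
      have hsx : (Function.update (Function.update s x true) y false) x = true := by
        rw [Function.update_of_ne (Ne.symm hne), Function.update_self]
      have hsy : (Function.update (Function.update s x true) y false) y = false := by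
        rw [Function.update_self]
      refine ⟨Function.update (Function.update s x true) y false, ?_, ?_⟩
      · intro v hv
        by_cases a : v = x
        · rw [a, hxy, hsx, hsy]; rfl
        by_cases b : v = y
        · rw [b, hyx, hsx, hsy]; rfl
        rw [hs v a b, hs (φ v) (fun h => b (by rw [← hi v hv, h, hxy]))
          (fun h => a (by rw [← hi v hv, h, hyx]))]
        exact h1 v (by simp [a, b, hv])
      · intro v hv hv' hn
        by_cases a : v = x
        · rw [a, ← hy_def, hsx, hsy]; rfl
        by_cases b : v = y
        · rw [b, hμy, hsx, hsy]; rfl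
        have a' : μ v ≠ x := fun h => b (by rw [← hμ v, h])
        have b' : μ v ≠ y := fun h => a (by rw [← hμ v, h, hμy])
        rw [hs v a b, hs (μ v) a' b']
        exact h2 v (by simp [a, b, hv]) (by simp [a', b', hv']) hn
    · -- Join the `φ`-partners of `x` and `y`, and drop `x` and `y`.
      set p := φ x with hp
      set q := φ y with hq
      have hpS : p ∈ S := hm x hx
      have hqS : q ∈ S := hm y hy
      have hφp : φ p = x := hi x hx
      have hφq : φ q = y := hi y hy
      have hpq : p ≠ q := fun h => hne (by rw [← hφq, ← h, hφp])
      have hpx : p ≠ x := hf x hx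
      have hqy : q ≠ y := hf y hy
      have hqx : q ≠ x := fun h => hxy (by rw [hp, ← h, hφq])
      set ψ : V → V := fun v => if v = p then q else if v = q then p else φ v with hψ
      have ψp : ψ p = q := by simp [hψ]
      have ψq : ψ q = p := by simp [hψ, hpq.symm]
      have ψo : ∀ v, v ≠ p → v ≠ q → ψ v = φ v := fun v a b => by simp [hψ, a, b]
      have key : ∀ v ∈ S, v ≠ x → v ≠ y → v ≠ p → v ≠ q →
          φ v ≠ x ∧ φ v ≠ y ∧ φ v ≠ p ∧ φ v ≠ q := fun v hv a b c d =>
        ⟨fun h => c (by rw [← hi v hv, h]), fun h => d (by rw [← hi v hv, h]),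
          fun h => a (by rw [← hi v hv, h, hφp]), fun h => b (by rw [← hi v hv, h, hφq])⟩
      obtain ⟨s, h1, h2⟩ := ih ((S.erase x).erase y).card
        (by rw [← hk]; exact Finset.card_lt_card
              ((Finset.erase_subset _ _).trans_ssubset (Finset.erase_ssubset hx)))
        ((S.erase x).erase y) ψ rfl
        (by
          intro v hv
          simp only [Finset.mem_erase] at hv ⊢
          by_cases c : v = p
          · rw [c, ψp]; exact ⟨hqy, hqx, hqS⟩
          by_cases d : v = q
          · rw [d, ψq]; exact ⟨hxy, hpx, hpS⟩
          rw [ψo v c d]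
          obtain ⟨k1, k2, -, -⟩ := key v hv.2.2 hv.2.1 hv.1 c d
          exact ⟨k2, k1, hm v hv.2.2⟩)
        (by
          intro v hv
          simp only [Finset.mem_erase] at hv
          by_cases c : v = p
          · rw [c, ψp, ψq]
          by_cases d : v = q
          · rw [d, ψq, ψp]
          obtain ⟨-, -, k3, k4⟩ := key v hv.2.2 hv.2.1 hv.1 c d
          rw [ψo v c d, ψo _ k3 k4, hi v hv.2.2])
        (by
          intro v hv
          simp only [Finset.mem_erase] at hv
          by_cases c : v = p
          · rw [c, ψp]; exact hpq.symm
          by_cases d : v = q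
          · rw [d, ψq]; exact hpq
          rw [ψo v c d]; exact hf v hv.2.2)
      have hmem : ∀ v ∈ S, v ≠ x → v ≠ y → v ∈ (S.erase x).erase y := fun v hv a b => by
        simp [a, b, hv]
      have hsp : s q = !s p := by
        have := h1 p (hmem p hpS hpx hxy); rwa [ψp] at this
      set t := Function.update (Function.update s x (!s p)) y (!s q) with ht
      have tO : ∀ v, v ≠ x → v ≠ y → t v = s v := fun v a b => by
        rw [ht, Function.update_of_ne b, Function.update_of_ne a]
      have tx : t x = !s p := by
        rw [ht, Function.update_of_ne (Ne.symm hne), Function.update_self]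
      have ty : t y = !s q := by rw [ht, Function.update_self]
      have tp : t p = s p := tO p hpx hxy
      have tq : t q = s q := tO q hqx hqy
      refine ⟨t, ?_, ?_⟩
      · intro v hv
        by_cases a : v = x
        · rw [a, ← hp, tx, tp, Bool.not_not]
        by_cases b : v = y
        · rw [b, ← hq, ty, tq, Bool.not_not]
        by_cases c : v = p
        · rw [c, hφp, tx, tp]
        by_cases d : v = q
        · rw [d, hφq, ty, tq]
        obtain ⟨k1, k2, -, -⟩ := key v hv a b c d
        rw [tO v a b, tO _ k1 k2]
        have := h1 v (hmem v hv a b)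
        rwa [ψo v c d] at this
      · intro v hv hv' hn
        by_cases a : v = x
        · rw [a, ← hy_def, tx, ty, hsp]
        by_cases b : v = y
        · rw [b, hμy, tx, ty, hsp, Bool.not_not]
        have a' : μ v ≠ x := fun h => b (by rw [← hμ v, h])
        have b' : μ v ≠ y := fun h => a (by rw [← hμ v, h, hμy])
        rw [tO v a b, tO _ a' b']
        exact h2 v (hmem v hv a b) (hmem _ hv' a' b') hn
  · push Not at hex
    -- No pair of `μ` is left: pick one point from each orbit of `φ`.
    rcases S.eq_empty_or_nonempty with rfl | ⟨x, hx⟩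
    · exact ⟨fun _ => true, by simp, by simp⟩
    have hne := hf x hx
    obtain ⟨s, h1, -⟩ := ih ((S.erase x).erase (φ x)).card
      (by rw [← hk]; exact Finset.card_lt_card
            ((Finset.erase_subset _ _).trans_ssubset (Finset.erase_ssubset hx)))
      ((S.erase x).erase (φ x)) φ rfl
      (by
        intro v hv
        simp only [Finset.mem_erase] at hv ⊢
        refine ⟨fun h => hv.2.1 ?_, fun h => hv.1 ?_, hm v hv.2.2⟩
        · rw [← hi v hv.2.2, h, hi x hx]
        · rw [← hi v hv.2.2, h])
      (fun v hv => hi v (by simp only [Finset.mem_erase] at hv; exact hv.2.2))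
      (fun v hv => hf v (by simp only [Finset.mem_erase] at hv; exact hv.2.2))
    refine ⟨Function.update (Function.update s x true) (φ x) false, ?_, ?_⟩
    · intro v hv
      by_cases a : v = x
      · rw [a, Function.update_self, Function.update_of_ne hne.symm, Function.update_self]; rfl
      by_cases b : v = φ x
      · rw [b, hi x hx, Function.update_self, Function.update_of_ne hne.symm,
          Function.update_self]; rfl
      have a' : φ v ≠ x := fun h => b (by rw [← hi v hv, h])
      have b' : φ v ≠ φ x := fun h => a (by rw [← hi v hv, h, hi x hx])
      rw [Function.update_of_ne b', Function.update_of_ne a', Function.update_of_ne b,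
        Function.update_of_ne a]
      exact h1 v (by simp [a, b, hv])
    · intro v hv hv' hn
      exact (hn (hex v hv hv')).elim

/-! ### Connecting the arcs of two directed `2`-factors -/

/-- The three ways to match the four ends `a_∞, b_∞, a_k, b_k` in pairs: `straight` is
`a_∞ b_∞ | a_k b_k`, `cross` is `a_∞ b_k | a_k b_∞` and `turn` is `a_∞ a_k | b_∞ b_k`. -/
inductive Pattern
  | straight | cross | turn
  deriving DecidableEq

/-- The pairs of a pattern on the ends `ai = a_∞`, `bi = b_∞`, `ak = a_k`, `bk = b_k` are related
by `r`. -/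
def Pattern.Joins {α : Type*} (r : Setoid α) (ai bi ak bk : α) : Pattern → Prop
  | .straight => r ai bi ∧ r ak bk
  | .cross => r ai bk ∧ r ak bi
  | .turn => r ai ak ∧ r bi bk

theorem Pattern.Joins.mono {α : Type*} {r r' : Setoid α} (h : r ≤ r') {ai bi ak bk : α}
    {p : Pattern} (hp : p.Joins r ai bi ak bk) : p.Joins r' ai bi ak bk := by
  cases p <;> exact ⟨h hp.1, h hp.2⟩

/-- Two different patterns together join all four ends. -/
theorem Pattern.Joins.all {α : Type*} {r : Setoid α} {ai bi ak bk : α} {p q : Pattern}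
    (hpq : p ≠ q) (hp : p.Joins r ai bi ak bk) (hq : q.Joins r ai bi ak bk) :
    r ai bi ∧ r ai ak ∧ r ai bk := by
  have t := fun x y z => @Setoid.trans' _ r x y z
  have s := fun x y => @Setoid.symm' _ r x y
  cases p <;> cases q <;> first | exact absurd rfl hpq | skip
  all_goals
    obtain ⟨h1, h2⟩ := hp
    obtain ⟨h3, h4⟩ := hq
    refine ⟨?_, ?_, ?_⟩ <;>
      first
      | assumption
      | exact t _ _ _ h1 (s _ _ h4)
      | exact t _ _ _ h1 h4

/-- Parity forces the pairing: if every class of `r` contains an even number of the four ends, and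
if `r` does not already contain a pattern `p`, then adding `p` to `r` joins all four ends. -/
theorem Pattern.all_of_not_joins {α : Type*} {r r' : Setoid α} (hle : r ≤ r') {ai bi ak bk : α}
    (hpar : ∀ χ : α → ZMod 2, (∀ x y, r x y → χ x = χ y) → χ ai + χ bi + χ ak + χ bk = 0)
    {p : Pattern} (hp : p.Joins r' ai bi ak bk) (hn : ¬ p.Joins r ai bi ak bk) :
    r' ai bi ∧ r' ai ak ∧ r' ai bk := by
  classical
  have t := fun x y z => @Setoid.trans' _ r x y z
  have s := fun x y => @Setoid.symm' _ r x y
  have key : ∀ z, (if r z ai then (1 : ZMod 2) else 0) + (if r z bi then 1 else 0)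
      + (if r z ak then 1 else 0) + (if r z bk then 1 else 0) = 0 := fun z =>
    hpar (fun x => if r z x then 1 else 0) fun x y hxy => by
      have : r z x ↔ r z y := ⟨fun h => t _ _ _ h hxy, fun h => t _ _ _ h (s _ _ hxy)⟩
      simp only [this]
  have rf : ∀ z, r z z := fun z => r.refl' z
  have d2 : (1 + 1 : ZMod 2) = 0 := by decide
  -- Each end is related to one or three of the others.
  have h1 := key ai
  have h2 := key bi
  have h3 := key ak
  have h4 := key bk
  have hq : Pattern.straight.Joins r ai bi ak bk ∨ Pattern.cross.Joins r ai bi ak bk ∨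
      Pattern.turn.Joins r ai bi ak bk := by
    by_cases e1 : r ai bi
    · left
      refine ⟨e1, ?_⟩
      by_contra e2
      have e2' : ¬ r bk ak := fun h => e2 (s _ _ h)
      simp only [rf, e2, if_true, if_false] at h3
      by_cases e3 : r ak ai
      · have e4 : r ak bi := t _ _ _ e3 e1
        simp only [e3, e4, if_true] at h3
        revert h3; decide
      · have e4 : ¬ r ak bi := fun h => e3 (t _ _ _ h (s _ _ e1))
        simp only [e3, e4, if_false] at h3
        revert h3; decide
    · right
      have e1' : ¬ r bi ai := fun h => e1 (s _ _ h)
      by_cases e2 : r ai ak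
      · right
        refine ⟨e2, ?_⟩
        have e3 : ¬ r bi ak := fun h => e1 (t _ _ _ e2 (s _ _ h))
        by_contra e4
        simp only [rf, e1', e3, e4, if_true, if_false] at h2
        revert h2; decide
      · left
        by_cases e3 : r ai bk
        · refine ⟨e3, ?_⟩
          have e4 : ¬ r bi bk := fun h => e1 (t _ _ _ e3 (s _ _ h))
          by_contra e5
          have e5' : ¬ r bi ak := fun h => e5 (s _ _ h)
          simp only [rf, e1', e4, e5', if_true, if_false] at h2
          revert h2; decide
        · simp only [rf, e1, e2, e3, if_true, if_false] at h1
          exact absurd h1 (by decide)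
  rcases hq with hq | hq | hq
  · exact Pattern.Joins.all (fun h => hn (by rw [h]; exact hq)) hp (hq.mono hle)
  · exact Pattern.Joins.all (fun h => hn (by rw [h]; exact hq)) hp (hq.mono hle)
  · exact Pattern.Joins.all (fun h => hn (by rw [h]; exact hq)) hp (hq.mono hle)

/-- Consecutive members being related, all the members of a cycle are related. -/
theorem _root_.Setoid.rel_of_sameCycle {V β : Type*} (r : Setoid β) (p : Equiv.Perm V) (ι : V → β)
    (hp : ∀ v, r (ι (p.symm v)) (ι v)) {v w : V} (h : p.SameCycle v w) : r (ι v) (ι w) := by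
  obtain ⟨m, rfl⟩ := h
  have step : ∀ v, r (ι v) (ι (p v)) := fun v => by simpa using hp (p v)
  induction m using Int.induction_on with
  | zero => exact r.refl' _
  | succ n ih =>
    have : (p ^ ((n : ℤ) + 1)) v = p ((p ^ (n : ℤ)) v) := by
      rw [add_comm, zpow_add, zpow_one, Equiv.Perm.mul_apply]
    rw [this]
    exact r.trans' ih (step _)
  | pred n ih =>
    have : (p ^ (-(n : ℤ))) v = p ((p ^ (-(n : ℤ) - 1)) v) := by
      rw [← Equiv.Perm.mul_apply, ← zpow_one_add]; congr 2; ring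
    rw [this] at ih
    exact r.trans' ih (r.symm' (step _))

section Choice

variable {V : Type*}

/-- At the vertex `v`, the relation `r` on the arcs of two directed `2`-factors `f` (left summand)
and `g` (right summand) contains the pairs of the pattern `p`. The left copy of `u` stands for the
arc of `f` that leaves `u`, the right copy for the arc of `g` that leaves `u`. -/
def JoinsAt (f g : Equiv.Perm V) (p : Pattern) (v : V) (r : Setoid (V ⊕ V)) : Prop :=
  p.Joins r (.inl (f.symm v)) (.inl v) (.inr (g.symm v)) (.inr v)

/-- If at every vertex other than `v` the arcs are joined in pairs, then every class of arcs has
an even number of ends at `v`. -/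
theorem sum_eq_zero_of_joinsAt [Finite V] (f g : Equiv.Perm V) (pat : V → Pattern) (v : V)
    (χ : V ⊕ V → ZMod 2)
    (hχ : ∀ r : Setoid (V ⊕ V), r = Setoid.ker χ → ∀ w ≠ v, JoinsAt f g (pat w) w r) :
    χ (.inl (f.symm v)) + χ (.inl v) + χ (.inr (g.symm v)) + χ (.inr v) = 0 := by
  classical
  cases nonempty_fintype V
  have d : ∀ x : ZMod 2, x + x = 0 := by decide
  have htot : ∑ w, (χ (.inl (f.symm w)) + χ (.inl w) + χ (.inr (g.symm w)) + χ (.inr w)) = 0 := by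
    simp only [Finset.sum_add_distrib]
    rw [Equiv.sum_comp f.symm (fun w => χ (.inl w)), Equiv.sum_comp g.symm (fun w => χ (.inr w)),
      d, zero_add, d]
  rw [Finset.sum_eq_single v] at htot
  · exact htot
  · intro w _ hw
    have := hχ _ rfl w hw
    unfold JoinsAt at this
    cases hp : pat w <;> rw [hp] at this <;> obtain ⟨h1, h2⟩ := this <;>
      replace h1 : χ _ = χ _ := h1 <;> replace h2 : χ _ = χ _ := h2
    · rw [h1, d, zero_add, h2, d]
    · rw [h1, h2]
      calc χ (Sum.inr w) + χ (Sum.inl w) + χ (Sum.inl w) + χ (Sum.inr w)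
          = (χ (Sum.inr w) + χ (Sum.inr w)) + (χ (Sum.inl w) + χ (Sum.inl w)) := by ring
        _ = 0 := by rw [d, d, zero_add]
    · rw [h1, h2]
      calc χ (Sum.inr (g.symm w)) + χ (Sum.inr w) + χ (Sum.inr (g.symm w)) + χ (Sum.inr w)
          = (χ (Sum.inr w) + χ (Sum.inr w)) + (χ (Sum.inr (g.symm w)) + χ
            (Sum.inr (g.symm w))) := by
            ring
        _ = 0 := by rw [d, d, zero_add]
  · simp

/-- Suppose that at some vertices two different patterns are available, that at all others the
pattern is straight, and that every cycle of `g` contains a vertex of the first kind, whereas `f`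
is a single cycle. Then the patterns can be chosen so that all the arcs are connected. An optimal
choice, one that relates as many pairs of arcs as possible, works: by parity, the pattern
at a vertex where it did not join all four arcs could be changed with profit. -/
theorem exists_connecting_choice [Finite V] (f g : Equiv.Perm V) (hf : f.IsCycleOn Set.univ)
    (act : V → Prop) (hact : ∀ v, ∃ w, g.SameCycle v w ∧ act w)
    (pat : V → Bool → Pattern) (hpat : ∀ v, act v → pat v true ≠ pat v false)
    (hstr : ∀ v, ¬ act v → ∀ b, pat v b = .straight) :
    ∃ π : V → Bool, ∀ r : Setoid (V ⊕ V), (∀ v, JoinsAt f g (pat v (π v)) v r) →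
      ∀ x y, r x y := by
  classical
  let gen : (V → Bool) → Set V → Setoid (V ⊕ V) := fun π X =>
    sInf {r | ∀ v ∈ X, JoinsAt f g (pat v (π v)) v r}
  have gen_joins : ∀ π X, ∀ v ∈ X, JoinsAt f g (pat v (π v)) v (gen π X) := by
    intro π X v hv
    have hr : ∀ x y, (∀ r : Setoid (V ⊕ V), (∀ v ∈ X, JoinsAt f g (pat v (π v)) v r) → r x y) →
        gen π X x y := fun x y h r hr => h r hr
    unfold JoinsAt
    cases hp : pat v (π v) <;>
      exact ⟨hr _ _ fun r h => by have := h v hv; rw [hp] at this; exact this.1,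
        hr _ _ fun r h => by have := h v hv; rw [hp] at this; exact this.2⟩
  have gen_le : ∀ π X (r : Setoid (V ⊕ V)), (∀ v ∈ X, JoinsAt f g (pat v (π v)) v r) →
      gen π X ≤ r := fun π X r h => sInf_le h
  obtain ⟨π, hπ⟩ := Finite.exists_max
    fun π : V → Bool => {p : (V ⊕ V) × (V ⊕ V) | gen π Set.univ p.1 p.2}.ncard
  -- At every active vertex the optimal choice joins all four ends.
  have hall : ∀ v, act v →
      gen π Set.univ (.inl (f.symm v)) (.inl v) ∧
      gen π Set.univ (.inl (f.symm v)) (.inr (g.symm v)) ∧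
      gen π Set.univ (.inl (f.symm v)) (.inr v) := by
    intro v hv
    by_contra hcon
    set R := gen π {v}ᶜ with hR
    have hle : R ≤ gen π Set.univ :=
      gen_le _ _ _ fun w _ => gen_joins π Set.univ w (Set.mem_univ w)
    have hpar : ∀ χ : V ⊕ V → ZMod 2, (∀ x y, R x y → χ x = χ y) →
        χ (.inl (f.symm v)) + χ (.inl v) + χ (.inr (g.symm v)) + χ (.inr v) = 0 := by
      intro χ hχ
      refine sum_eq_zero_of_joinsAt f g (fun w => pat w (π w)) v χ ?_
      rintro r rfl w hw
      exact Pattern.Joins.mono (r := R) (r' := Setoid.ker χ) (fun {x y} h => hχ x y h)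
        (gen_joins π {v}ᶜ w hw)
    have hj : JoinsAt f g (pat v (π v)) v R := by
      by_contra hn
      exact hcon (Pattern.all_of_not_joins hle hpar (gen_joins π Set.univ v (Set.mem_univ v)) hn)
    have hSR : gen π Set.univ ≤ R := gen_le _ _ _ fun w _ => by
      by_cases hw : w = v
      · rw [hw]; exact hj
      · exact gen_joins π {v}ᶜ w hw
    set π' := Function.update π v (!π v) with hπ'
    have hRS' : R ≤ gen π' Set.univ := gen_le _ _ _ fun w hw => by
      have := gen_joins π' Set.univ w (Set.mem_univ w)
      rwa [hπ', Function.update_of_ne hw] at this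
    have hS' : JoinsAt f g (pat v (!π v)) v (gen π' Set.univ) := by
      have := gen_joins π' Set.univ v (Set.mem_univ v)
      rwa [hπ', Function.update_self] at this
    have hne : pat v (π v) ≠ pat v (!π v) := by
      have := hpat v hv
      cases h : π v <;> simp only [Bool.not_false, Bool.not_true]
      · exact this.symm
      · exact this
    have hlt : {p : (V ⊕ V) × (V ⊕ V) | gen π Set.univ p.1 p.2} ⊂
        {p | gen π' Set.univ p.1 p.2} := by
      refine ⟨fun p hp => hRS' (hSR hp), fun hsub => hcon ?_⟩
      have hback : gen π' Set.univ ≤ gen π Set.univ := fun {x y} h => hsub (a := (x, y)) h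
      exact Pattern.Joins.all hne (gen_joins π Set.univ v (Set.mem_univ v)) (hS'.mono hback)
    exact absurd (hπ π') (not_le.mpr (Set.ncard_lt_ncard hlt (Set.toFinite _)))
  refine ⟨π, fun r hr => ?_⟩
  have hle : gen π Set.univ ≤ r := gen_le _ _ _ fun v _ => hr v
  have hfst : ∀ v, r (.inl (f.symm v)) (.inl v) ∧ r (.inr (g.symm v)) (.inr v) := by
    intro v
    by_cases hv : act v
    · obtain ⟨h1, h2, h3⟩ := hall v hv
      exact ⟨hle h1, r.trans' (r.symm' (hle h2)) (hle h3)⟩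
    · have := hr v
      rwa [hstr v hv] at this
  have hl : ∀ v w, r (.inl v) (.inl w) := fun v w =>
    r.rel_of_sameCycle f _ (fun v => (hfst v).1) (hf.2 (Set.mem_univ v) (Set.mem_univ w))
  have hlr : ∀ v w, r (.inl v) (.inr w) := by
    intro v w
    obtain ⟨u, hu, hau⟩ := hact w
    have h1 := r.rel_of_sameCycle g _ (fun v => (hfst v).2) hu
    obtain ⟨-, -, h3⟩ := hall u hau
    exact r.trans' (hl v _) (r.trans' (hle h3) (r.symm' h1))
  rintro (v | v) (w | w)
  · exact hl v w
  · exact hlr v w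
  · exact r.symm' (hlr w v)
  · exact r.trans' (r.symm' (hlr v v)) (hlr v w)

end Choice

/-! ### Hamilton cycles and pairs of consecutive members of a list -/

/-- A connected `2`-regular finite graph is a Hamilton cycle. -/
theorem isHamiltonCycle_of_connected {W : Type*} [Finite W] [DecidableEq W] {C : SimpleGraph W}
    (hc : C.Connected) (h2 : ∀ v, (C.neighborSet v).ncard = 2) : IsHamiltonCycle C := by
  obtain ⟨v⟩ := hc.nonempty
  have hcyc : C.IsCycles := fun v _ => h2 v
  have hne : ∀ v, (C.neighborSet v).Nonempty := fun v =>
    Set.nonempty_of_ncard_ne_zero (by rw [h2]; decide)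
  obtain ⟨p, hp, hverts⟩ := hcyc.exists_cycle_toSubgraph_verts_eq_connectedComponentSupp
    (c := C.connectedComponentMk v) (SimpleGraph.ConnectedComponent.mem_supp_iff _ _ |>.2 rfl)
    (hne v)
  have hmem : ∀ w, w ∈ p.support := fun w => by
    rw [← SimpleGraph.Walk.mem_verts_toSubgraph, hverts,
      SimpleGraph.ConnectedComponent.mem_supp_iff, SimpleGraph.ConnectedComponent.eq]
    exact hc.preconnected w v
  refine ⟨v, p, ⟨hp, ?_⟩, ?_⟩
  · refine SimpleGraph.Walk.IsPath.isHamiltonian_of_mem hp.isPath_tail fun w => ?_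
    rw [SimpleGraph.Walk.support_tail_of_not_nil _ hp.not_nil]
    have := hmem w
    rw [← SimpleGraph.Walk.cons_tail_support, List.mem_cons] at this
    rcases this with rfl | h
    · exact SimpleGraph.Walk.end_mem_tail_support hp.not_nil
    · exact h
  · intro e he
    induction e with
    | _ x y =>
      have h1 := hp.ncard_neighborSet_toSubgraph_eq_two (hmem x)
      have h3 : p.toSubgraph.neighborSet x = C.neighborSet x :=
        Set.eq_of_subset_of_ncard_le (p.toSubgraph.neighborSet_subset x) (by rw [h1, h2])
          (Set.toFinite _)
      have h4 : y ∈ p.toSubgraph.neighborSet x := by rw [h3]; exact he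
      exact SimpleGraph.Walk.adj_toSubgraph_iff_mem_edges.mp h4

section Lists

variable {α : Type*}

theorem infix_pair_mem {l : List α} {x y : α} (h : [x, y] <:+: l) : x ∈ l ∧ y ∈ l :=
  ⟨h.subset (by simp), h.subset (by simp)⟩

theorem infix_pair_ne {l : List α} (hl : l.Nodup) {x y : α} (h : [x, y] <:+: l) : x ≠ y := by
  have := h.sublist.nodup hl
  simpa using this

theorem infix_pair_cons {l : List α} {x y u : α} :
    [x, y] <:+: u :: l ↔ (x = u ∧ l.head? = some y) ∨ [x, y] <:+: l := by
  rw [List.infix_cons_iff, List.cons_prefix_cons]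
  cases l with
  | nil => simp
  | cons w l => rw [List.cons_prefix_cons, List.head?_cons, Option.some.injEq,
    eq_comm (a := w)]; simp

theorem infix_pair_unique_right {l : List α} (hl : l.Nodup) {x y z : α} (hy : [x, y] <:+: l)
    (hz : [x, z] <:+: l) : y = z := by
  induction l with
  | nil => simp at hy
  | cons u l ih =>
    rw [List.nodup_cons] at hl
    rw [infix_pair_cons] at hy hz
    rcases hy with ⟨rfl, hy⟩ | hy <;> rcases hz with ⟨hu, hz⟩ | hz
    · rw [hy] at hz; exact Option.some.inj hz
    · exact absurd (infix_pair_mem hz).1 hl.1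
    · exact absurd (hu ▸ (infix_pair_mem hy).1) hl.1
    · exact ih hl.2 hy hz

theorem infix_pair_reverse {l : List α} {x y : α} : [x, y] <:+: l.reverse ↔ [y, x] <:+: l := by
  rw [← List.reverse_infix]; simp

theorem infix_pair_unique_left {l : List α} (hl : l.Nodup) {x y z : α} (hy : [y, x] <:+: l)
    (hz : [z, x] <:+: l) : y = z :=
  infix_pair_unique_right (List.nodup_reverse.2 hl) (infix_pair_reverse.2 hy)
    (infix_pair_reverse.2 hz)

theorem not_infix_pair_of_head {l : List α} (hl : l.Nodup) {x y : α} (hx : l.head? = some x) :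
    ¬ [y, x] <:+: l := by
  cases l with
  | nil => simp at hx
  | cons u l =>
    rw [List.head?_cons, Option.some.injEq] at hx
    subst hx
    rw [List.nodup_cons] at hl
    rw [infix_pair_cons]
    rintro (⟨rfl, h⟩ | h)
    · exact hl.1 (List.mem_of_mem_head? h)
    · exact hl.1 (infix_pair_mem h).2

theorem not_infix_pair_of_getLast {l : List α} (hl : l.Nodup) {x y : α}
    (hx : l.getLast? = some x) : ¬ [x, y] <:+: l := fun h =>
  not_infix_pair_of_head (List.nodup_reverse.2 hl) (by rw [List.head?_reverse]; exact hx)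
    (infix_pair_reverse.2 h)

/-- Consecutive entries being related, all entries of a list are related. -/
theorem _root_.Setoid.rel_of_infix_pair {β : Type*} (r : Setoid β) (f : α → β) {l : List α}
    (h : ∀ x y, [x, y] <:+: l → r (f x) (f y)) : ∀ x ∈ l, ∀ y ∈ l, r (f x) (f y) := by
  induction l with
  | nil => simp
  | cons u l ih =>
    have ih' := ih fun x y hxy => h x y (infix_pair_cons.2 (Or.inr hxy))
    have key : ∀ y ∈ l, r (f u) (f y) := by
      intro y hy
      cases l with
      | nil => simp at hy
      | cons w l =>
        exact r.trans' (h u w (infix_pair_cons.2 (Or.inl ⟨rfl, rfl⟩))) (ih' w (by simp) y hy)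
    intro x hx y hy
    rcases List.mem_cons.1 hx with hxu | hxl <;> rcases List.mem_cons.1 hy with hyu | hyl
    · rw [hxu, hyu]
    · rw [hxu]; exact key y hyl
    · rw [hyu]; exact r.symm' (key x hxl)
    · exact ih' x hxl y hyl

/-- The two entries are the two ends of the list. -/
def EndPair (l : List α) (x y : α) : Prop :=
  (l.head? = some x ∧ l.getLast? = some y) ∨ (l.head? = some y ∧ l.getLast? = some x)

theorem EndPair.symm {l : List α} {x y : α} (h : EndPair l x y) : EndPair l y x := Or.symm h

theorem EndPair.mem {l : List α} {x y : α} (h : EndPair l x y) : x ∈ l ∧ y ∈ l := by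
  rcases h with ⟨h1, h2⟩ | ⟨h1, h2⟩
  · exact ⟨List.mem_of_mem_head? h1, List.mem_of_mem_getLast? h2⟩
  · exact ⟨List.mem_of_mem_getLast? h2, List.mem_of_mem_head? h1⟩

/-- `y` follows `x` in one of the two lists. -/
def Follows (p : List α × List α) (x y : α) : Prop := [x, y] <:+: p.1 ∨ [x, y] <:+: p.2

/-- `x` and `y` are consecutive, in either order, in one of the two lists. -/
def Linked (p : List α × List α) (x y : α) : Prop := Follows p x y ∨ Follows p y x

theorem Linked.symm {p : List α × List α} {x y : α} (h : Linked p x y) : Linked p y x := Or.symm h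

theorem Follows.infix {p : List α × List α} {x y : α} (h : Follows p x y) :
    [x, y] <:+: p.1 ++ p.2 :=
  h.elim (fun h => h.trans (List.prefix_append _ _).isInfix)
    (fun h => h.trans (List.suffix_append _ _).isInfix)

theorem Linked.mem {p : List α × List α} {x y : α} (h : Linked p x y) :
    x ∈ p.1 ++ p.2 ∧ y ∈ p.1 ++ p.2 :=
  h.elim (fun h => infix_pair_mem h.infix) (fun h => (infix_pair_mem h.infix).symm)

theorem Linked.ne {p : List α × List α} (hp : (p.1 ++ p.2).Nodup) {x y : α} (h : Linked p x y) :
    x ≠ y :=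
  h.elim (fun h => infix_pair_ne hp h.infix) (fun h => (infix_pair_ne hp h.infix).symm)

theorem encard_follows_le_one {p : List α × List α} (hp : (p.1 ++ p.2).Nodup) (x : α) :
    {y | Follows p x y}.encard ≤ 1 ∧ {y | Follows p y x}.encard ≤ 1 := by
  constructor <;> rw [Set.encard_le_one_iff]
  · exact fun a b ha hb => infix_pair_unique_right hp ha.infix hb.infix
  · exact fun a b ha hb => infix_pair_unique_left hp ha.infix hb.infix

theorem encard_linked_le_two {p : List α × List α} (hp : (p.1 ++ p.2).Nodup) (x : α) :
    {y | Linked p x y}.encard ≤ 2 := by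
  obtain ⟨h1, h2⟩ := encard_follows_le_one hp x
  calc {y | Linked p x y}.encard = ({y | Follows p x y} ∪ {y | Follows p y x}).encard := rfl
    _ ≤ _ := Set.encard_union_le _ _
    _ ≤ 1 + 1 := add_le_add h1 h2
    _ = 2 := by norm_num

theorem encard_linked_eq_zero {p : List α × List α} {x : α} (hx : x ∉ p.1 ++ p.2) :
    {y | Linked p x y}.encard = 0 := by
  rw [Set.encard_eq_zero, Set.eq_empty_iff_forall_notMem]
  exact fun y hy => hx (Linked.mem hy).1

/-- An end of a strand has at most one neighbour in the strands. -/
theorem encard_linked_le_one {p : List α × List α} (hp : (p.1 ++ p.2).Nodup) {x y : α}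
    (hx : EndPair p.1 x y ∨ EndPair p.2 x y) : {y | Linked p x y}.encard ≤ 1 := by
  obtain ⟨h1, h2⟩ := encard_follows_le_one hp x
  have hd := List.nodup_append.1 hp
  have hdis : ∀ z, z ∈ p.1 → z ∈ p.2 → False := fun z h h' => hd.2.2 z h z h' rfl
  have key : (∀ z, ¬ Follows p x z) ∨ ∀ z, ¬ Follows p z x := by
    rcases hx with h | h
    · have hn : ∀ z, ¬ [x, z] <:+: p.2 ∧ ¬ [z, x] <:+: p.2 := fun z =>
        ⟨fun h' => hdis x h.mem.1 (infix_pair_mem h').1,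
          fun h' => hdis x h.mem.1 (infix_pair_mem h').2⟩
      rcases h with h | h
      · exact Or.inr fun z hz => hz.elim (not_infix_pair_of_head hd.1 h.1) (hn z).2
      · exact Or.inl fun z hz => hz.elim (not_infix_pair_of_getLast hd.1 h.2) (hn z).1
    · have hn : ∀ z, ¬ [x, z] <:+: p.1 ∧ ¬ [z, x] <:+: p.1 := fun z =>
        ⟨fun h' => hdis x (infix_pair_mem h').1 h.mem.1,
          fun h' => hdis x (infix_pair_mem h').2 h.mem.1⟩
      rcases h with h | h
      · exact Or.inr fun z hz => hz.elim (hn z).2 (not_infix_pair_of_head hd.2.1 h.1)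
      · exact Or.inl fun z hz => hz.elim (hn z).1 (not_infix_pair_of_getLast hd.2.1 h.2)
  rcases key with h | h
  · refine le_trans (Set.encard_le_encard ?_) h2
    exact fun z hz => hz.resolve_left (h z)
  · refine le_trans (Set.encard_le_encard ?_) h1
    exact fun z hz => hz.resolve_right (h z)

end Lists

/-! ### Local designs and arc systems -/

/-- The edges at a vertex: `a i` enters the vertex and `b i` leaves it in the `i`-th directed
`2`-factor, and `c` belongs to the `1`-factor. The index `none` plays the role of `∞`. -/
inductive Arm (I : Type*)
  | a (i : Option I) : Arm I
  | b (i : Option I) : Arm I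
  | c : Arm I
  deriving DecidableEq

/-- The two lists are strands whose ends `a_∞, b_∞, a_k, b_k` are matched by the pattern. -/
def Pattern.Ends {I : Type*} (k : Option I) (p : List (Arm I) × List (Arm I)) : Pattern → Prop
  | .straight => EndPair p.1 (.a none) (.b none) ∧ EndPair p.2 (.a k) (.b k)
  | .cross => EndPair p.1 (.a none) (.b k) ∧ EndPair p.2 (.b none) (.a k)
  | .turn => EndPair p.1 (.a none) (.a k) ∧ EndPair p.2 (.b none) (.b k)

/-- A recipe for a Hamilton decomposition of the line graph. There are two colours `(g, ε)` for
every `g : Option I`. At each vertex, in dependence on the roles `s` and the choices `π` made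
there, each colour takes two strands, that is, paths on the edges at the vertex. A colour of the
group `g` has its ends at the indices `∞` and `own g`; at every other index it passes through
either the incoming or the outgoing edge, always the same one. Of the two colours of a group one
has `c`, as decided by the role `s (key g)`, and one is *active*. The inactive colour joins
`a_∞` to `b_∞`; on the pattern of the active colour the choice `π g` has an influence.

If `own g` is `none`, a colour of the group `g` consists of the single strand from `a_∞` to `b_∞`
and has no choice to make. By `pat_congr` the patterns of a group other than `none` depend on the
choice of this group only, so that the group `none` can make its choices last. -/
structure LocalDesign (I : Type*) [DecidableEq I] where
  own : Option I → Option I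
  key : Option I → Option I
  key_eq : ∀ g, own g ≠ none → key g = own g
  activeHasC : Option I → Bool
  typ : Option I → Bool → I → Bool
  strands : (Option I → Bool) → (Option I → Bool) → Option I → Bool →
    List (Arm I) × List (Arm I)
  pat : (Option I → Bool) → (Option I → Bool) → Option I → Pattern
  nodup : ∀ s π g ε, ((strands s π g ε).1 ++ (strands s π g ε).2).Nodup
  ends_pure : ∀ s π g ε, own g = none →
    EndPair (strands s π g ε).1 (.a none) (.b none) ∧ (strands s π g ε).2 = []
  ends_own : ∀ s π g ε, own g ≠ none →
    (if (ε = s (key g)) ↔ activeHasC g = true then pat s π g else .straight).Ends (own g)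
      (strands s π g ε)
  mem_a : ∀ s π g ε i, own g ≠ some i →
    (Arm.a (some i) ∈ (strands s π g ε).1 ++ (strands s π g ε).2 ↔ typ g ε i = true)
  mem_b : ∀ s π g ε i, own g ≠ some i →
    (Arm.b (some i) ∈ (strands s π g ε).1 ++ (strands s π g ε).2 ↔ typ g ε i = false)
  mem_c : ∀ s π g ε,
    (Arm.c ∈ (strands s π g ε).1 ++ (strands s π g ε).2 ↔ ε = s (key g))
  cover : ∀ s π x y, x ≠ y → ∃ g ε, Linked (strands s π g ε) x y
  pat_congr : ∀ s π π' i, π (some i) = π' (some i) → pat s π (some i) = pat s π' (some i)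
  pat_ne : ∀ s π g, own g ≠ none →
    pat s (Function.update π g true) g ≠ pat s (Function.update π g false) g

/-- The incidences of the edges `El` of a regular graph with the vertices `V`, the graph being
factorised into directed `2`-factors `next i` and a `1`-factor that matches `v` with `mate v`. -/
structure ArcSystem (V El I : Type*) where
  next : Option I → Equiv.Perm V
  mate : V → V
  σ : V → Arm I → El
  σ_injective : ∀ v, Function.Injective (σ v)
  σ_a : ∀ v i, σ v (.a i) = σ ((next i).symm v) (.b i)
  σ_c : ∀ v, σ (mate v) .c = σ v .c
  mate_mate : ∀ v, mate (mate v) = v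
  mate_ne : ∀ v, mate v ≠ v
  next_ne : ∀ i v, next i v ≠ v
  surj : ∀ e, ∃ v x, σ v x = e
  eq_or : ∀ v x u y, σ v x = σ u y → (u = v ∧ y = x) ∨
    (∃ i, x = .a i ∧ y = .b i ∧ u = (next i).symm v) ∨
    (∃ i, x = .b i ∧ y = .a i ∧ u = next i v) ∨ (x = .c ∧ y = .c ∧ u = mate v)
  simple : ∀ v u x y x' y', x ≠ y → σ v x = σ u x' → σ v y = σ u y' → u = v

namespace ArcSystem

variable {V El I : Type*} (S : ArcSystem V El I)

/-- The other end of the edge `σ v x`. -/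
def other (v : V) : Arm I → V
  | .a i => (S.next i).symm v
  | .b i => S.next i v
  | .c => S.mate v

/-- The name of the edge `σ v x` at its other end. -/
def flip : Arm I → Arm I
  | .a i => .b i
  | .b i => .a i
  | .c => .c

theorem σ_other (v : V) (x : Arm I) : S.σ (S.other v x) (flip x) = S.σ v x := by
  cases x with
  | a i => exact (S.σ_a v i).symm
  | b i =>
    show S.σ (S.next i v) (.a i) = _
    rw [S.σ_a, Equiv.symm_apply_apply]
  | c => exact S.σ_c v

theorem other_ne (v : V) (x : Arm I) : S.other v x ≠ v := by
  cases x with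
  | a i =>
    intro h
    apply S.next_ne i v
    have h' : (S.next i).symm v = v := h
    rw [← h', Equiv.apply_symm_apply]
    exact h'.symm
  | b i => exact S.next_ne i v
  | c => exact S.mate_ne v

theorem eq_or_eq {v u : V} {x y : Arm I} (h : S.σ v x = S.σ u y) :
    (u = v ∧ y = x) ∨ (u = S.other v x ∧ y = flip x) := by
  rcases S.eq_or v x u y h with h | ⟨i, rfl, rfl, rfl⟩ | ⟨i, rfl, rfl, rfl⟩ | ⟨rfl, rfl, rfl⟩
  · exact Or.inl h
  · exact Or.inr ⟨rfl, rfl⟩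
  · exact Or.inr ⟨rfl, rfl⟩
  · exact Or.inr ⟨rfl, rfl⟩

/-- The line graph. -/
def lineGraph : SimpleGraph El where
  Adj e f := ∃ v x y, x ≠ y ∧ S.σ v x = e ∧ S.σ v y = f
  symm := ⟨fun _ _ ⟨v, x, y, h, hx, hy⟩ => ⟨v, y, x, h.symm, hy, hx⟩⟩
  loopless := ⟨fun _ ⟨v, _, _, h, hx, hy⟩ => h (S.σ_injective v (hx.trans hy.symm))⟩

theorem neighborSet_lineGraph_superset (v : V) (x : Arm I) :
    (S.σ v '' {x}ᶜ) ∪ (S.σ (S.other v x) '' {flip x}ᶜ) ⊆ S.lineGraph.neighborSet (S.σ v x) := by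
  rintro _ (⟨y, hy, rfl⟩ | ⟨y, hy, rfl⟩)
  · exact ⟨v, x, y, fun h => hy h.symm, rfl, rfl⟩
  · exact ⟨_, flip x, y, fun h => hy h.symm, S.σ_other v x, rfl⟩

/-- Every edge is adjacent to at least `4 n` others, if `2 n + 1` edges meet in each vertex. -/
theorem le_encard_neighborSet [Fintype (Arm I)] (e : El) :
    2 * ((Fintype.card (Arm I) - 1 : ℕ) : ℕ∞) ≤ (S.lineGraph.neighborSet e).encard := by
  classical
  obtain ⟨v, x, rfl⟩ := S.surj e
  refine le_trans ?_ (Set.encard_le_encard (S.neighborSet_lineGraph_superset v x))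
  have hc : ∀ u (y : Arm I), (S.σ u '' {y}ᶜ).encard = ((Fintype.card (Arm I) - 1 : ℕ) : ℕ∞) := by
    intro u y
    rw [(S.σ_injective u).encard_image, ← Set.coe_toFinset {y}ᶜ, Set.encard_coe_eq_coe_finsetCard,
      Set.toFinset_compl, Set.toFinset_singleton, Finset.card_compl, Finset.card_singleton]
  rw [Set.encard_union_eq, hc, hc, two_mul]
  rw [Set.disjoint_left]
  rintro _ ⟨y, hy, rfl⟩ ⟨z, hz, h⟩
  exact S.other_ne v x
    (S.simple v _ x y (flip x) z (fun h => hy h.symm) (S.σ_other v x).symm h.symm)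

end ArcSystem

/-! ### The colours given by a local design -/

/-- A pair of consecutive members on every cycle of a permutation without fixed points. -/
theorem exists_pairing {V : Type*} (p : Equiv.Perm V) (hp : ∀ v, p v ≠ v) :
    ∃ μ : V → V, Function.Involutive μ ∧
      ∀ v, ∃ w, p.SameCycle v w ∧ μ w ≠ w ∧ p.SameCycle w (μ w) := by
  classical
  let st := Equiv.Perm.SameCycle.setoid p
  let rep : V → V := fun v => (Quotient.mk st v).out
  have hrep : ∀ v, p.SameCycle (rep v) v := fun v =>
    Quotient.exact (s := st) (Quotient.out_eq (Quotient.mk st v))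
  have hcongr : ∀ v w, p.SameCycle v w → rep v = rep w := fun v w h => by
    show (Quotient.mk st v).out = (Quotient.mk st w).out
    rw [Quotient.sound (s := st) h]
  have hnext : ∀ v, rep (p v) = rep v := fun v =>
    hcongr _ _ (by simpa using Equiv.Perm.SameCycle.refl p v)
  have hrr : ∀ v, rep (rep v) = rep v := fun v => hcongr _ _ (hrep v)
  let μ : V → V := fun v => if v = rep v then p v else if v = p (rep v) then rep v else v
  have h1 : ∀ v, v = rep v → μ v = p v := fun v h => if_pos h
  have h2 : ∀ v, v = p (rep v) → μ v = rep v := fun v h => by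
    have : v ≠ rep v := fun h' => hp (rep v) (h.symm.trans h')
    show ite _ _ _ = _
    rw [if_neg this, if_pos h]
  refine ⟨μ, fun v => ?_, fun v => ⟨rep v, (hrep v).symm, ?_, ?_⟩⟩
  · by_cases ha : v = rep v
    · rw [h1 v ha]
      have e : rep (p v) = v := (hnext v).trans ha.symm
      rw [h2 (p v) (by rw [e]), e]
    · by_cases hb : v = p (rep v)
      · rw [h2 v hb, h1 _ (hrr v).symm]; exact hb.symm
      · have e : μ v = v := by
          show ite _ _ _ = _
          rw [if_neg ha, if_neg hb]
        rw [e, e]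
  · rw [h1 _ (hrr v).symm]; exact hp _
  · rw [h1 _ (hrr v).symm]; simpa using Equiv.Perm.SameCycle.refl p (rep v)

namespace LocalDesign

variable {I : Type*} [DecidableEq I] (D : LocalDesign I)

/-- The pattern of the colour `(g, ε)`. -/
def colourPat (s π : Option I → Bool) (g : Option I) (ε : Bool) : Pattern :=
  if (ε = s (D.key g)) ↔ D.activeHasC g = true then D.pat s π g else .straight

/-- At the indices `∞` and `own g` both edges are ends of strands. -/
theorem endPair_of_own {s π : Option I → Bool} {g : Option I} (hg : D.own g ≠ none) (ε : Bool)
    (i : Option I) (hi : i = none ∨ i = D.own g) (x : Arm I) (hx : x = .a i ∨ x = .b i) :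
    ∃ y, EndPair (D.strands s π g ε).1 x y ∨ EndPair (D.strands s π g ε).2 x y := by
  have h := D.ends_own s π g ε hg
  generalize (if (ε = s (D.key g)) ↔ D.activeHasC g = true then D.pat s π g else .straight) = p
    at h
  cases p <;> obtain ⟨h1, h2⟩ := h <;> rcases hi with rfl | rfl <;> rcases hx with rfl | rfl <;>
    first
    | exact ⟨_, Or.inl h1⟩
    | exact ⟨_, Or.inr h2⟩
    | exact ⟨_, Or.inl h1.symm⟩
    | exact ⟨_, Or.inr h2.symm⟩

theorem endPair_of_end {s π : Option I → Bool} {g : Option I} (ε : Bool)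
    (i : Option I) (hi : i = none ∨ i = D.own g) (x : Arm I) (hx : x = .a i ∨ x = .b i) :
    ∃ y, EndPair (D.strands s π g ε).1 x y ∨ EndPair (D.strands s π g ε).2 x y := by
  by_cases hg : D.own g = none
  · rw [hg, or_self] at hi
    obtain ⟨h, -⟩ := D.ends_pure s π g ε hg
    rcases hx with rfl | rfl
    · exact ⟨_, Or.inl (hi ▸ h)⟩
    · exact ⟨_, Or.inl (hi ▸ h.symm)⟩
  · exact D.endPair_of_own hg ε i hi x hx

end LocalDesign

namespace ArcSystem

variable {V El I : Type*} [DecidableEq I] (S : ArcSystem V El I) (D : LocalDesign I)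

/-- The edges of the line graph that receive the colour `(g, ε)`. -/
def colourGraph (s π : V → Option I → Bool) (g : Option I) (ε : Bool) : SimpleGraph El where
  Adj e f := ∃ v x y, Linked (D.strands (s v) (π v) g ε) x y ∧ S.σ v x = e ∧ S.σ v y = f
  symm := ⟨fun _ _ ⟨v, x, y, h, hx, hy⟩ => ⟨v, y, x, h.symm, hy, hx⟩⟩
  loopless := ⟨fun _ ⟨v, _, _, h, hx, hy⟩ =>
    h.ne (D.nodup _ _ _ _) (S.σ_injective v (hx.trans hy.symm))⟩

/-- Every edge has at most two neighbours in each colour. Since a colour always passes through the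
same one of the edges `a i` and `b i`, an edge of the `i`-th factor lies inside a strand at just one
of its two ends; and since the roles differ at the two ends of an edge of the `1`-factor, this edge
is in a strand at just one of them. -/
theorem encard_neighborSet_colourGraph_le {s π : V → Option I → Bool}
    (hs : ∀ v k, s (S.mate v) k = !s v k) (g : Option I) (ε : Bool) (e : El) :
    ((S.colourGraph D s π g ε).neighborSet e).encard ≤ 2 := by
  obtain ⟨v, x, rfl⟩ := S.surj e
  let N : V → Arm I → Set (Arm I) := fun v x => {y | Linked (D.strands (s v) (π v) g ε) x y}
  have hsub : (S.colourGraph D s π g ε).neighborSet (S.σ v x) ⊆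
      S.σ v '' N v x ∪ S.σ (S.other v x) '' N (S.other v x) (flip x) := by
    rintro _ ⟨u, x', y, h, hx, rfl⟩
    rcases S.eq_or_eq hx.symm with ⟨rfl, rfl⟩ | ⟨rfl, rfl⟩
    · exact Or.inl ⟨y, h, rfl⟩
    · exact Or.inr ⟨y, h, rfl⟩
  refine (Set.encard_le_encard hsub).trans ((Set.encard_union_le _ _).trans
    ((add_le_add (Set.encard_image_le _ _) (Set.encard_image_le _ _)).trans ?_))
  have hnd := fun v => D.nodup (s v) (π v) g ε
  have h2 : ∀ v x, (N v x).encard ≤ 2 := fun v x => encard_linked_le_two (hnd v) x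
  have h0 : ∀ v x, x ∉ (D.strands (s v) (π v) g ε).1 ++ (D.strands (s v) (π v) g ε).2 →
      (N v x).encard = 0 := fun v x h => encard_linked_eq_zero h
  have hend : ∀ i, (i = none ∨ i = D.own g) → ∀ v x, (x = .a i ∨ x = .b i) →
      (N v x).encard ≤ 1 := by
    intro i hi v x hx
    obtain ⟨y, hy⟩ := D.endPair_of_end (s := s v) (π := π v) ε i hi x hx
    exact encard_linked_le_one (hnd v) hy
  -- A vertex of the line graph is an end of strands at both its ends, or it lies inside a strand
  -- at just one of them.
  have hall : ∀ u w i, (N u (.a i)).encard + (N w (.b i)).encard ≤ 2 := by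
    intro u w i
    by_cases hi : i = none ∨ i = D.own g
    · refine (add_le_add (hend i hi u _ (Or.inl rfl)) (hend i hi w _ (Or.inr rfl))).trans ?_
      norm_num
    · rw [not_or] at hi
      obtain ⟨j, rfl⟩ := Option.ne_none_iff_exists'.1 hi.1
      have hne : D.own g ≠ some j := fun h => hi.2 h.symm
      cases ht : D.typ g ε j
      · rw [h0 u _ (by rw [D.mem_a _ _ _ _ _ hne, ht]; simp), zero_add]
        exact h2 _ _
      · rw [h0 w _ (by rw [D.mem_b _ _ _ _ _ hne, ht]; simp), add_zero]
        exact h2 _ _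
  cases x with
  | a i => exact hall _ _ i
  | b i => rw [add_comm]; exact hall _ _ i
  | c =>
    show (N v .c).encard + (N (S.mate v) .c).encard ≤ 2
    by_cases hc : ε = s v (D.key g)
    · have : (N (S.mate v) .c).encard = 0 := h0 _ _ (by rw [D.mem_c, hs, hc]; simp)
      rw [this, add_zero]
      exact h2 _ _
    · rw [h0 v _ (by rw [D.mem_c]; exact hc), zero_add]
      exact h2 _ _

theorem reachable_colourGraph_of_mem {s π : V → Option I → Bool} {g : Option I} {ε : Bool} {v : V}
    {x y : Arm I}
    (h : (x ∈ (D.strands (s v) (π v) g ε).1 ∧ y ∈ (D.strands (s v) (π v) g ε).1) ∨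
      (x ∈ (D.strands (s v) (π v) g ε).2 ∧ y ∈ (D.strands (s v) (π v) g ε).2)) :
    (S.colourGraph D s π g ε).Reachable (S.σ v x) (S.σ v y) := by
  rcases h with h | h
  · exact (S.colourGraph D s π g ε).reachableSetoid.rel_of_infix_pair (S.σ v)
      (fun x y hxy => SimpleGraph.Adj.reachable ⟨v, x, y, Or.inl (Or.inl hxy), rfl, rfl⟩)
      x h.1 y h.2
  · exact (S.colourGraph D s π g ε).reachableSetoid.rel_of_infix_pair (S.σ v)
      (fun x y hxy => SimpleGraph.Adj.reachable ⟨v, x, y, Or.inl (Or.inr hxy), rfl, rfl⟩)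
      x h.1 y h.2

theorem reachable_colourGraph_of_endPair {s π : V → Option I → Bool} {g : Option I} {ε : Bool}
    {v : V} {x y : Arm I}
    (h : EndPair (D.strands (s v) (π v) g ε).1 x y ∨ EndPair (D.strands (s v) (π v) g ε).2 x y) :
    (S.colourGraph D s π g ε).Reachable (S.σ v x) (S.σ v y) :=
  S.reachable_colourGraph_of_mem D (h.imp EndPair.mem EndPair.mem)

/-- The arcs of the factors `∞` and `k`. -/
def arc (k : Option I) : V ⊕ V → El
  | .inl v => S.σ v (.b none)
  | .inr v => S.σ v (.b k)

/-- Every edge is connected in every colour to some arc of one of the two factors in which the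
strands of this colour have their ends. -/
theorem exists_reachable_arc {s π : V → Option I → Bool}
    (hs : ∀ v k, s (S.mate v) k = !s v k) (g : Option I) (ε : Bool) (e : El) :
    (∃ u, (S.colourGraph D s π g ε).Reachable e (S.arc (D.own g) (.inl u))) ∨
    (D.own g ≠ none ∧ ∃ u, (S.colourGraph D s π g ε).Reachable e (S.arc (D.own g) u)) := by
  set H := S.colourGraph D s π g ε with hH
  have harc : ∀ v x, x ∈ (D.strands (s v) (π v) g ε).1 ++ (D.strands (s v) (π v) g ε).2 →
      (∃ u, H.Reachable (S.σ v x) (S.arc (D.own g) (.inl u))) ∨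
      (D.own g ≠ none ∧ ∃ u, H.Reachable (S.σ v x) (S.arc (D.own g) u)) := by
    intro v x hx
    by_cases hg : D.own g = none
    · obtain ⟨h1, h2⟩ := D.ends_pure (s v) (π v) g ε hg
      rw [h2, List.append_nil] at hx
      exact Or.inl ⟨v, S.reachable_colourGraph_of_mem D (Or.inl ⟨hx, h1.mem.2⟩)⟩
    · right
      refine ⟨hg, ?_⟩
      have h := D.ends_own (s v) (π v) g ε hg
      have ha : ∀ i y, (i = none ∨ i = D.own g) → (y = .a i ∨ y = .b i) →
          ∃ u, S.arc (D.own g) u = S.σ v y := by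
        rintro i y (rfl | rfl) (rfl | rfl)
        · exact ⟨.inl ((S.next none).symm v), (S.σ_a v none).symm⟩
        · exact ⟨.inl v, rfl⟩
        · exact ⟨.inr ((S.next (D.own g)).symm v), (S.σ_a v _).symm⟩
        · exact ⟨.inr v, rfl⟩
      have key : ∃ i y, (i = none ∨ i = D.own g) ∧ (y = .a i ∨ y = .b i) ∧
          ((x ∈ (D.strands (s v) (π v) g ε).1 ∧ y ∈ (D.strands (s v) (π v) g ε).1) ∨
          (x ∈ (D.strands (s v) (π v) g ε).2 ∧ y ∈ (D.strands (s v) (π v) g ε).2)) := by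
        generalize (if (ε = s v (D.key g)) ↔ D.activeHasC g = true then D.pat (s v) (π v) g
          else .straight) = p at h
        rcases List.mem_append.1 hx with hx | hx
        · cases p
          · exact ⟨_, _, Or.inl rfl, Or.inl rfl, Or.inl ⟨hx, h.1.mem.1⟩⟩
          · exact ⟨_, _, Or.inl rfl, Or.inl rfl, Or.inl ⟨hx, h.1.mem.1⟩⟩
          · exact ⟨_, _, Or.inl rfl, Or.inl rfl, Or.inl ⟨hx, h.1.mem.1⟩⟩
        · cases p
          · exact ⟨_, _, Or.inr rfl, Or.inl rfl, Or.inr ⟨hx, h.2.mem.1⟩⟩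
          · exact ⟨_, _, Or.inl rfl, Or.inr rfl, Or.inr ⟨hx, h.2.mem.1⟩⟩
          · exact ⟨_, _, Or.inl rfl, Or.inr rfl, Or.inr ⟨hx, h.2.mem.1⟩⟩
      obtain ⟨i, y, hi, hy, hxy⟩ := key
      obtain ⟨u, hu⟩ := ha i y hi hy
      exact ⟨u, by rw [hu]; exact S.reachable_colourGraph_of_mem D hxy⟩
  -- The edge `e` occurs in a strand at one of its two ends.
  obtain ⟨v, x, rfl⟩ := S.surj e
  by_cases hx : x ∈ (D.strands (s v) (π v) g ε).1 ++ (D.strands (s v) (π v) g ε).2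
  · exact harc v x hx
  · rw [← S.σ_other v x]
    refine harc _ _ ?_
    have hends : ∀ i u y, (i = none ∨ i = D.own g) → (y = .a i ∨ y = .b i) →
        y ∈ (D.strands (s u) (π u) g ε).1 ++ (D.strands (s u) (π u) g ε).2 := by
      intro i u y hi hy
      obtain ⟨z, hz⟩ := D.endPair_of_end (s := s u) (π := π u) ε i hi y hy
      exact List.mem_append.2 (hz.imp (fun h => h.mem.1) (fun h => h.mem.1))
    cases x with
    | a i =>
      by_cases hi : i = none ∨ i = D.own g
      · exact hends i _ _ hi (Or.inr rfl)
      · rw [not_or] at hi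
        obtain ⟨j, rfl⟩ := Option.ne_none_iff_exists'.1 hi.1
        have hne : D.own g ≠ some j := fun h => hi.2 h.symm
        rw [D.mem_a _ _ _ _ _ hne, Bool.not_eq_true] at hx
        exact (D.mem_b _ _ _ _ _ hne).2 hx
    | b i =>
      by_cases hi : i = none ∨ i = D.own g
      · exact hends i _ _ hi (Or.inl rfl)
      · rw [not_or] at hi
        obtain ⟨j, rfl⟩ := Option.ne_none_iff_exists'.1 hi.1
        have hne : D.own g ≠ some j := fun h => hi.2 h.symm
        rw [D.mem_b _ _ _ _ _ hne, Bool.not_eq_false] at hx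
        exact (D.mem_a _ _ _ _ _ hne).2 hx
    | c =>
      rw [D.mem_c] at hx
      refine (D.mem_c _ _ _ _).2 ?_
      show ε = s (S.mate v) (D.key g)
      rw [hs]
      revert hx
      cases ε <;> cases s v (D.key g) <;> simp

end ArcSystem

/-! ### From local designs to Hamilton decompositions -/

namespace ArcSystem

variable {V El I : Type*} (S : ArcSystem V El I)

/-- Roles that alternate along the `1`-factor and do not agree on all the vertices of any cycle. -/
theorem exists_roles [Finite V] : ∃ s : V → Option I → Bool,
    (∀ v k, s (S.mate v) k = !s v k) ∧
    ∀ k v ε, ∃ w, (S.next k).SameCycle v w ∧ s w k = ε := by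
  have h : ∀ k, ∃ s : V → Bool, (∀ v, s (S.mate v) = !s v) ∧
      ∀ v ε, ∃ w, (S.next k).SameCycle v w ∧ s w = ε := by
    intro k
    obtain ⟨μ, hμ, hcyc⟩ := exists_pairing (S.next k) (S.next_ne k)
    obtain ⟨s, h1, h2⟩ := exists_twoColouring S.mate μ S.mate_mate hμ S.mate_ne
    refine ⟨s, h1, fun v ε => ?_⟩
    obtain ⟨w, hw, hne, hw'⟩ := hcyc v
    by_cases hs : s w = ε
    · exact ⟨w, hw, hs⟩
    · refine ⟨μ w, hw.trans hw', ?_⟩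
      rw [h2 w hne]
      revert hs
      cases s w <;> cases ε <;> simp
  choose s h1 h2 using h
  exact ⟨fun v k => s k v, fun v k => h1 k v, fun k v ε => h2 k v ε⟩

variable [DecidableEq I] (D : LocalDesign I)

/-- The choices of one group can be made so that each of its two colours connects all the arcs of
the factors `∞` and `own g`. -/
theorem exists_choice [Finite V] (hham : (S.next none).IsCycleOn Set.univ)
    {s : V → Option I → Bool} (hs : ∀ k v ε, ∃ w, (S.next k).SameCycle v w ∧ s w k = ε)
    {g : Option I} (hg : D.own g ≠ none) (π : V → Option I → Bool) :
    ∃ q : V → Bool, ∀ ε, ∀ r : Setoid (V ⊕ V),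
      (∀ v, JoinsAt (S.next none) (S.next (D.own g))
        (D.colourPat (s v) (Function.update (π v) g (q v)) g ε) v r) → ∀ x y, r x y := by
  have hkey := D.key_eq g hg
  have h : ∀ ε, ∃ q : V → Bool, ∀ r : Setoid (V ⊕ V),
      (∀ v, JoinsAt (S.next none) (S.next (D.own g))
        (D.colourPat (s v) (Function.update (π v) g (q v)) g ε) v r) → ∀ x y, r x y := by
    intro ε
    refine exists_connecting_choice (S.next none) (S.next (D.own g)) hham
      (fun v => (ε = s v (D.key g)) ↔ D.activeHasC g = true) ?_
      (fun v b => D.colourPat (s v) (Function.update (π v) g b) g ε) ?_ ?_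
    · intro v
      obtain ⟨w, hw, hw'⟩ := hs (D.own g) v (if D.activeHasC g = true then ε else !ε)
      refine ⟨w, hw, ?_⟩
      rw [hkey, hw']
      cases D.activeHasC g <;> cases ε <;> simp
    · intro v hv
      simp only [LocalDesign.colourPat, if_pos hv]
      exact D.pat_ne _ _ _ hg
    · intro v hv b
      simp only [LocalDesign.colourPat, if_neg hv]
  choose q hq using h
  -- At every vertex just one of the two colours is active, and this one makes the choice.
  refine ⟨fun v => q (if D.activeHasC g = true then s v (D.key g) else !s v (D.key g)) v,
    fun ε r hr => hq ε r fun v => ?_⟩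
  have hv := hr v
  by_cases hact : (ε = s v (D.key g)) ↔ D.activeHasC g = true
  · have : (if D.activeHasC g = true then s v (D.key g) else !s v (D.key g)) = ε := by
      revert hact
      cases D.activeHasC g <;> cases ε <;> cases s v (D.key g) <;> simp
    simp only [this] at hv
    exact hv
  · simp only [LocalDesign.colourPat, if_neg hact] at hv ⊢
    exact hv

/-- With suitable choices every colour is connected. -/
theorem exists_connected [Finite V] [Nonempty V] (hham : (S.next none).IsCycleOn Set.univ) :
    ∃ s π : V → Option I → Bool, (∀ v k, s (S.mate v) k = !s v k) ∧
      ∀ g ε, (S.colourGraph D s π g ε).Connected := by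
  obtain ⟨s, hs1, hs2⟩ := S.exists_roles
  have hq : ∀ (π : V → Option I → Bool) (g : Option I), ∃ q : V → Bool, D.own g ≠ none →
      ∀ ε, ∀ r : Setoid (V ⊕ V),
      (∀ v, JoinsAt (S.next none) (S.next (D.own g))
        (D.colourPat (s v) (Function.update (π v) g (q v)) g ε) v r) → ∀ x y, r x y := by
    intro π g
    by_cases hg : D.own g = none
    · exact ⟨fun _ => true, fun h => absurd hg h⟩
    · obtain ⟨q, hq⟩ := S.exists_choice D hham hs2 hg π
      exact ⟨q, fun _ => hq⟩
  choose q hq using hq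
  -- The group `none` chooses last, since its patterns may depend on the other choices.
  let π₀ : V → Option I → Bool := fun v g => q (fun _ _ => true) g v
  let π : V → Option I → Bool := fun v => Function.update (π₀ v) none (q π₀ none v)
  refine ⟨s, π, hs1, fun g ε => ?_⟩
  have hpat : D.own g ≠ none → ∀ r : Setoid (V ⊕ V),
      (∀ v, JoinsAt (S.next none) (S.next (D.own g)) (D.colourPat (s v) (π v) g ε) v r) →
      ∀ x y, r x y := by
    intro hg r hr
    cases g with
    | none => exact hq π₀ none hg ε r hr
    | some i =>
      refine hq (fun _ _ => true) (some i) hg ε r fun v => ?_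
      have := hr v
      unfold LocalDesign.colourPat at this ⊢
      rwa [D.pat_congr (s v) (π v) (Function.update (fun _ => true) (some i)
        (q (fun _ _ => true) (some i) v)) i (by simp [π, π₀])] at this
  set H := S.colourGraph D s π g ε with hH
  let r : Setoid (V ⊕ V) := Setoid.comap (S.arc (D.own g)) H.reachableSetoid
  have hends : ∀ v x y, (EndPair (D.strands (s v) (π v) g ε).1 x y ∨
      EndPair (D.strands (s v) (π v) g ε).2 x y) → H.Reachable (S.σ v x) (S.σ v y) :=
    fun v x y h => S.reachable_colourGraph_of_endPair D h
  have hall : D.own g ≠ none → ∀ x y, r x y := by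
    intro hg
    refine hpat hg r (fun v => ?_)
    have h := D.ends_own (s v) (π v) g ε hg
    unfold JoinsAt LocalDesign.colourPat
    generalize (if (ε = s v (D.key g)) ↔ D.activeHasC g = true then D.pat (s v) (π v) g
        else .straight) = p at h ⊢
    have e1 := S.σ_a v none
    have e2 := S.σ_a v (D.own g)
    have h1 := fun x y hxy => hends v x y (Or.inl hxy)
    have h2 := fun x y hxy => hends v x y (Or.inr hxy)
    cases p
    · have h3 := h1 _ _ h.1
      have h4 := h2 _ _ h.2
      rw [e1] at h3
      rw [e2] at h4
      exact ⟨h3, h4⟩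
    · have h3 := h1 _ _ h.1
      have h4 := h2 _ _ h.2.symm
      rw [e1] at h3
      rw [e2] at h4
      exact ⟨h3, h4⟩
    · have h3 := h1 _ _ h.1
      rw [e1, e2] at h3
      exact ⟨h3, h2 _ _ h.2⟩
  have hl : ∀ v w, r (.inl v) (.inl w) := by
    intro v w
    by_cases hg : D.own g = none
    · refine r.rel_of_sameCycle (S.next none) Sum.inl (fun v => ?_)
        (hham.2 (Set.mem_univ v) (Set.mem_univ w))
      have := hends v _ _ (Or.inl (D.ends_pure (s v) (π v) g ε hg).1)
      rwa [S.σ_a] at this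
    · exact hall hg _ _
  obtain ⟨v₀⟩ := ‹Nonempty V›
  have hto : ∀ e, H.Reachable e (S.arc (D.own g) (.inl v₀)) := by
    intro e
    rcases S.exists_reachable_arc D hs1 g ε e with ⟨u, hu⟩ | ⟨hg, u, hu⟩
    · exact hu.trans (hl u v₀)
    · exact hu.trans (hall hg u _)
  have : Nonempty El := ⟨S.arc (D.own g) (.inl v₀)⟩
  exact ⟨fun e f => (hto e).trans (hto f).symm⟩

/-- A local design on the indices of the `2`-factors gives a Hamilton decomposition of the line
graph. The colours cover all the edges, and they are connected graphs with all degrees at most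
two. As each of the `2 n` colours gives at most two neighbours to a vertex of degree at
least `4 n`, the colours are disjoint and `2`-regular. -/
theorem isHamiltonDecomposable [Finite V] [Finite El] [Fintype I] [DecidableEq El]
    (hham : (S.next none).IsCycleOn Set.univ) (D : LocalDesign I) :
    IsHamiltonDecomposable S.lineGraph := by
  classical
  rcases isEmpty_or_nonempty V with hV | hV
  · refine ⟨∅, ⟨by simp, by simp, ?_⟩, by simp⟩
    intro e
    induction e with
    | _ x y =>
      rintro ⟨v, -⟩
      exact hV.elim v
  obtain ⟨s, π, hs, hconn⟩ := S.exists_connected D hham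
  let H : Option I × Bool → SimpleGraph El := fun j => S.colourGraph D s π j.1 j.2
  have hle : ∀ j, H j ≤ S.lineGraph := by
    rintro j e f ⟨v, x, y, h, hx, hy⟩
    exact ⟨v, x, y, h.ne (D.nodup _ _ _ _), hx, hy⟩
  have hcov : ∀ e f, S.lineGraph.Adj e f → ∃ j, (H j).Adj e f := by
    rintro e f ⟨v, x, y, h, hx, hy⟩
    obtain ⟨g, ε, hl⟩ := D.cover (s v) (π v) x y h
    exact ⟨(g, ε), v, x, y, hl, hx, hy⟩
  have h2 : ∀ j e, (Set.toFinite ((H j).neighborSet e)).toFinset.card ≤ 2 := by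
    intro j e
    have := S.encard_neighborSet_colourGraph_le D (π := π) hs j.1 j.2 e
    rw [← (Set.toFinite ((H j).neighborSet e)).coe_toFinset,
      Set.encard_coe_eq_coe_finsetCard] at this
    exact_mod_cast this
  let _ : Fintype (Arm I) := Fintype.ofEquiv (Option I ⊕ Option I ⊕ Unit)
    { toFun := fun x => x.elim Arm.a (fun x => x.elim Arm.b fun _ => Arm.c)
      invFun := fun x => match x with
        | .a i => .inl i
        | .b i => .inr (.inl i)
        | .c => .inr (.inr ())
      left_inv := by rintro (x | x | x) <;> rfl
      right_inv := by rintro (x | x | x) <;> rfl }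
  have hcard : Fintype.card (Arm I) - 1 = Fintype.card (Option I × Bool) := by
    rw [Fintype.ofEquiv_card]
    simp only [Fintype.card_sum, Fintype.card_prod, Fintype.card_bool, Fintype.card_unit]
    omega
  let N : El → Option I × Bool → Finset El := fun e j =>
    (Set.toFinite ((H j).neighborSet e)).toFinset
  have hN : ∀ e j f, f ∈ N e j ↔ (H j).Adj e f := fun e j f => by
    simp only [N, Set.Finite.mem_toFinset, SimpleGraph.mem_neighborSet]
  have hbig : ∀ e, ∑ _j : Option I × Bool, 2 ≤ (Finset.univ.biUnion (N e)).card := by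
    intro e
    have h4 := S.le_encard_neighborSet e
    rw [← (Set.toFinite (S.lineGraph.neighborSet e)).coe_toFinset,
      Set.encard_coe_eq_coe_finsetCard, hcard] at h4
    have h5 : 2 * Fintype.card (Option I × Bool) ≤
        (Set.toFinite (S.lineGraph.neighborSet e)).toFinset.card := by exact_mod_cast h4
    rw [Finset.sum_const, Finset.card_univ, smul_eq_mul, mul_comm]
    refine h5.trans (Finset.card_le_card fun f hf => ?_)
    rw [Set.Finite.mem_toFinset, SimpleGraph.mem_neighborSet] at hf
    obtain ⟨j, hj⟩ := hcov e f hf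
    exact Finset.mem_biUnion.2 ⟨j, Finset.mem_univ j, (hN e j f).2 hj⟩
  have hsum : ∀ e, ∑ j, (N e j).card ≤ ∑ _j : Option I × Bool, 2 := fun e =>
    Finset.sum_le_sum fun j _ => h2 j e
  have hdeg : ∀ e j, (N e j).card = 2 := by
    intro e j
    refine (Finset.sum_eq_sum_iff_of_le (fun j _ => h2 j e)).1 ?_ j (Finset.mem_univ j)
    exact le_antisymm (hsum e) ((hbig e).trans Finset.card_biUnion_le)
  have hdisj : ∀ j j' e f, j ≠ j' → (H j).Adj e f → ¬ (H j').Adj e f := by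
    intro j j' e f hjj h h'
    have hlt : (Finset.univ.biUnion (N e)).card < ∑ j, (N e j).card := by
      have hsplit : Finset.univ.biUnion (N e) ⊆
          (Finset.univ.erase j).biUnion (N e) ∪ (N e j).erase f := by
        intro x hx
        obtain ⟨i, -, hi⟩ := Finset.mem_biUnion.1 hx
        by_cases hij : i = j
        · by_cases hxf : x = f
          · refine Finset.mem_union_left _ (Finset.mem_biUnion.2 ⟨j', ?_, ?_⟩)
            · simp [Ne.symm hjj]
            · rw [hxf]; exact (hN _ _ _).2 h'
          · exact Finset.mem_union_right _ (Finset.mem_erase.2 ⟨hxf, hij ▸ hi⟩)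
        · exact Finset.mem_union_left _ (Finset.mem_biUnion.2 ⟨i, by simp [hij], hi⟩)
      have h1 := (Finset.card_le_card hsplit).trans (Finset.card_union_le _ _)
      have h3 : ((Finset.univ.erase j).biUnion (N e)).card ≤
          ∑ i ∈ Finset.univ.erase j, (N e i).card := Finset.card_biUnion_le
      have h4 : ((N e j).erase f).card < (N e j).card :=
        Finset.card_erase_lt_of_mem ((hN _ _ _).2 h)
      have h5 := Finset.add_sum_erase Finset.univ (fun i => (N e i).card) (Finset.mem_univ j)
      omega
    exact absurd ((hbig e).trans_lt hlt) (not_lt.2 (hsum e))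
  have hnc : ∀ j e, ((H j).neighborSet e).ncard = 2 := fun j e => by
    rw [← hdeg e j, Set.ncard_eq_toFinset_card _ (Set.toFinite _)]
  refine ⟨Set.range H, ⟨?_, ?_, ?_⟩, ?_⟩
  · rintro _ ⟨j, rfl⟩
    exact hle j
  · rintro _ ⟨j, rfl⟩ hbot
    obtain ⟨e⟩ := (hconn j.1 j.2).nonempty
    have := hnc j e
    rw [hbot] at this
    simp at this
  · intro e
    induction e with
    | _ x y =>
      intro he
      obtain ⟨j, hj⟩ := hcov x y he
      refine ⟨H j, ⟨⟨j, rfl⟩, hj⟩, ?_⟩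
      rintro _ ⟨⟨j', rfl⟩, hj'⟩
      by_contra hne
      exact hdisj j j' x y (fun h => hne (h ▸ rfl)) hj hj'
  · rintro _ ⟨j, rfl⟩
    exact isHamiltonCycle_of_connected (hconn j.1 j.2) (hnc j)

end ArcSystem

/-! ### The arc system of a directed `2`-factorisation -/

section Bridge

variable {V : Type*} {G : SimpleGraph V} {F : G.Subgraph} {n : ℕ} {I : Type*}

/-- An enumeration of the indices, extended to `∞`. -/
def subscriptEquiv (e : I ≃ Fin (n - 1)) : Option I ≃ Subscript n := e.optionCongr

/-- Renaming of the edges at a vertex along an enumeration of the indices. -/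
def Arm.toFragmentVertex (e : I ≃ Fin (n - 1)) : Arm I → FragmentVertex n
  | .a i => .a (subscriptEquiv e i)
  | .b i => .b (subscriptEquiv e i)
  | .c => .c

theorem Arm.toFragmentVertex_bijective (e : I ≃ Fin (n - 1)) :
    Function.Bijective (Arm.toFragmentVertex e) := by
  constructor
  · rintro (i | i | _) (j | j | _) h <;> simp [Arm.toFragmentVertex] at h ⊢
    · exact h
    · exact h
  · rintro (i | i | _)
    · exact ⟨.a ((subscriptEquiv e).symm i), by simp [Arm.toFragmentVertex]⟩
    · exact ⟨.b ((subscriptEquiv e).symm i), by simp [Arm.toFragmentVertex]⟩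
    · exact ⟨.c, rfl⟩

theorem mem_sigma (hF : F.IsPerfectMatching)
    (D : DirectedTwoFactorisation (G.deleteEdges F.edgeSet) (Subscript n)) (v : V)
    (x : FragmentVertex n) : v ∈ (sigma hF D v x : Sym2 V) := by
  cases x with
  | a i => simp [sigma]
  | b i => simp [sigma]
  | c =>
    obtain ⟨w, hw, -⟩ := hF.1 (hF.2 v)
    simp only [sigma]
    rw [hF.1.toEdge_eq_of_adj hw]
    simp

/-- The incidences of a graph with a `1`-factor and a directed `2`-factorisation of the rest. -/
noncomputable def arcSystem (hF : F.IsPerfectMatching)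
    (D : DirectedTwoFactorisation (G.deleteEdges F.edgeSet) (Subscript n))
    (e : I ≃ Fin (n - 1)) : ArcSystem V G.edgeSet I :=
  have hadj : ∀ v, F.Adj v (hF.1 (hF.2 v)).choose := fun v => (hF.1 (hF.2 v)).choose_spec.1
  have huniq : ∀ v w, F.Adj v w → w = (hF.1 (hF.2 v)).choose := fun v w h =>
    (hF.1 (hF.2 v)).choose_spec.2 w h
  have hinj : ∀ v, Function.Injective fun x : Arm I => sigma hF D v (x.toFragmentVertex e) :=
    fun v => (sigma_injective hF D v).comp (Arm.toFragmentVertex_bijective e).1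
  have ha : ∀ v i, sigma hF D v (.a i) = sigma hF D ((D.next i).symm v) (.b i) := fun v i => by
    simp [sigma]
  have hc : ∀ v, sigma hF D (hF.1 (hF.2 v)).choose .c = sigma hF D v .c := fun v => by
    refine Subtype.ext ?_
    simp only [sigma]
    rw [hF.1.toEdge_eq_of_adj (hadj v), hF.1.toEdge_eq_of_adj (F.adj_symm (hadj v))]
    exact Sym2.eq_swap
  have hcv : ∀ v, (sigma hF D v .c : Sym2 V) = s(v, (hF.1 (hF.2 v)).choose) := fun v => by
    simp only [sigma]
    rw [hF.1.toEdge_eq_of_adj (hadj v)]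
  { next := fun i => D.next (subscriptEquiv e i)
    mate := fun v => (hF.1 (hF.2 v)).choose
    σ := fun v x => sigma hF D v (x.toFragmentVertex e)
    σ_injective := hinj
    σ_a := fun v i => ha v _
    σ_c := fun v => hc v
    mate_mate := fun v => (huniq _ _ (F.adj_symm (hadj v))).symm
    mate_ne := fun v => (F.adj_sub (hadj v)).ne'
    next_ne := fun i v => (D.adj_next _ v).ne'
    surj := by
      rintro ⟨f, hf⟩
      by_cases hfF : f ∈ F.edgeSet
      · induction f with
        | _ v w =>
          refine ⟨v, .c, Subtype.ext ?_⟩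
          show (sigma hF D v .c : Sym2 V) = _
          rw [hcv, ← huniq v w hfF]
      · have hf' : f ∈ (G.deleteEdges F.edgeSet).edgeSet := by
          rw [SimpleGraph.edgeSet_deleteEdges]
          exact ⟨hf, hfF⟩
        obtain ⟨⟨i, v⟩, -, hiv⟩ := D.bijOn.surjOn hf'
        obtain ⟨x, hx⟩ := (Arm.toFragmentVertex_bijective e).2 (.b i)
        exact ⟨v, x, Subtype.ext (by rw [hx]; exact hiv)⟩
    eq_or := by
      intro v x u y h
      by_cases huv : u = v
      · subst huv
        exact Or.inl ⟨rfl, (hinj u h).symm⟩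
      · have hu : u ∈ (sigma hF D v (x.toFragmentVertex e) : Sym2 V) := by
          have h' : sigma hF D v (x.toFragmentVertex e) = sigma hF D u (y.toFragmentVertex e) := h
          rw [h']
          exact mem_sigma hF D u _
        cases x with
        | a i =>
          have hu' : u = (D.next (subscriptEquiv e i)).symm v := by
            simp only [Arm.toFragmentVertex, sigma, Sym2.mem_iff] at hu
            exact hu.resolve_right huv
          refine Or.inr (Or.inl ⟨i, rfl, hinj u (h.symm.trans ?_), hu'⟩)
          rw [hu']
          exact ha v _
        | b i =>
          have hu' : u = D.next (subscriptEquiv e i) v := by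
            simp only [Arm.toFragmentVertex, sigma, Sym2.mem_iff] at hu
            exact hu.resolve_left huv
          refine Or.inr (Or.inr (Or.inl ⟨i, rfl, hinj u (h.symm.trans ?_), hu'⟩))
          rw [hu']
          exact ((ha _ _).trans (by simp [Arm.toFragmentVertex])).symm
        | c =>
          have hu' : u = (hF.1 (hF.2 v)).choose := by
            have h2 : u ∈ (sigma hF D v .c : Sym2 V) := hu
            rw [hcv, Sym2.mem_iff] at h2
            exact h2.resolve_left huv
          refine Or.inr (Or.inr (Or.inr ⟨rfl, hinj u (h.symm.trans ?_), hu'⟩))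
          rw [hu']
          exact (hc v).symm
    simple := by
      intro v u x y x' y' hxy hx hy
      by_contra huv
      have key : ∀ z z', sigma hF D v (Arm.toFragmentVertex e z) =
          sigma hF D u (Arm.toFragmentVertex e z') →
          (sigma hF D v (Arm.toFragmentVertex e z) : Sym2 V) = s(v, u) := by
        intro z z' h
        have h1 := mem_sigma hF D v (Arm.toFragmentVertex e z)
        have h2 := mem_sigma hF D u (Arm.toFragmentVertex e z')
        rw [← h] at h2
        exact (Sym2.mem_and_mem_iff (Ne.symm huv)).1 ⟨h1, h2⟩
      exact hxy (hinj v (Subtype.ext ((key x x' hx).trans (key y y' hy).symm))) }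

/-- For the whole complete graph the spanning subgraph of the line graph is the line graph itself.
-/
theorem fragmentUnion_top (hF : F.IsPerfectMatching)
    (D : DirectedTwoFactorisation (G.deleteEdges F.edgeSet) (Subscript n))
    (e : I ≃ Fin (n - 1)) : fragmentUnion hF D ⊤ = (arcSystem hF D e).lineGraph := by
  ext x y
  constructor
  · rintro ⟨v, z, w, hzw, hz, hw⟩
    obtain ⟨z, rfl⟩ := (Arm.toFragmentVertex_bijective e).2 z
    obtain ⟨w, rfl⟩ := (Arm.toFragmentVertex_bijective e).2 w
    exact ⟨v, z, w, fun h => hzw (h ▸ rfl), hz, hw⟩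
  · rintro ⟨v, z, w, hzw, hz, hw⟩
    exact ⟨v, _, _, fun h => hzw ((Arm.toFragmentVertex_bijective e).1 h), hz, hw⟩

end Bridge

/-- A local design on `n - 1` indices makes the whole complete graph a Hamilton fragment. -/
theorem isHamiltonFragment_top_of_localDesign {n : ℕ} {I : Type*} [Fintype I] [DecidableEq I]
    (hI : Fintype.card I = n - 1) (D : LocalDesign I) :
    IsHamiltonFragment.{u} (⊤ : SimpleGraph (FragmentVertex n)) := by
  intro V _ _ G _ _ F hF T hT
  rw [fragmentUnion_top hF T (Fintype.equivFinOfCardEq hI)]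
  exact (arcSystem hF T (Fintype.equivFinOfCardEq hI)).isHamiltonDecomposable hT D

/-! ### Lists that contain the prescribed edges -/

section Strands

variable {I : Type*}

/-- The edge with index `i` through which a colour with the types `t` passes. -/
def letter (t : I → Bool) (i : I) : Arm I := if t i = true then .a (some i) else .b (some i)

theorem letter_injective (t : I → Bool) : Function.Injective (letter t) := by
  intro i j h
  unfold letter at h
  split at h <;> split at h <;> simp at h <;> exact h

theorem a_eq_letter {t : I → Bool} {i j : I} : Arm.a (some i) = letter t j ↔ i = j ∧ t j =
    true := by
  unfold letter; split <;> simp_all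

theorem b_eq_letter {t : I → Bool} {i j : I} : Arm.b (some i) = letter t j ↔ i = j ∧ t j =
    false := by
  unfold letter; split <;> simp_all

/-- The two indices at infinity in one of the two orders. -/
def AtInfinity (J₀ J₁ : Arm I) : Prop :=
  (J₀ = .a none ∧ J₁ = .b none) ∨ (J₀ = .b none ∧ J₁ = .a none)

/-- The edges `a_∞` and `b_∞`, numbered by the truth values. -/
def jay (τ : Bool) : Arm I := if τ = true then .b none else .a none

theorem atInfinity_jay (τ : Bool) : AtInfinity (jay τ : Arm I) (jay !τ) := by
  cases τ <;> simp [AtInfinity, jay]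

theorem AtInfinity.endPair {J₀ J₁ : Arm I} (hJ : AtInfinity J₀ J₁) {l : List (Arm I)}
    (h : EndPair l J₀ J₁) : EndPair l (.a none) (.b none) := by
  rcases hJ with ⟨rfl, rfl⟩ | ⟨rfl, rfl⟩
  · exact h
  · exact h.symm

variable [DecidableEq I] [Fintype I]

/-- The conditions on the edges that a colour meets at a vertex, if `k` is its own index. -/
structure GoodList (k : I) (t : I → Bool) (hasC : Prop) (l : List (Arm I)) : Prop where
  nodup : l.Nodup
  mem_a : ∀ i, i ≠ k → (.a (some i) ∈ l ↔ t i = true)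
  mem_b : ∀ i, i ≠ k → (.b (some i) ∈ l ↔ t i = false)
  mem_c : .c ∈ l ↔ hasC

/-- A list has the prescribed edges if it is an arrangement of the edges at infinity, the edges with
the index `k`, one edge for every other index and possibly `c`. -/
theorem GoodList.of_perm {k : I} {t : I → Bool} {J₀ J₁ : Arm I} (hJ : AtInfinity J₀ J₁)
    {js : List I} (hjs : js.Nodup) (hk : k ∉ js) (hlen : js.length + 1 = Fintype.card I)
    {hasC : Prop} {C l : List (Arm I)} (hC : (C = [.c] ∧ hasC) ∨ (C = [] ∧ ¬ hasC))
    (hl : l.Perm (J₀ :: J₁ :: .a (some k) :: .b (some k) :: (C ++ js.map (letter t)))) :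
    GoodList k t hasC l := by
  have hmem : ∀ i, i ≠ k → i ∈ js := by
    intro i hi
    have h1 : (k :: js).Nodup := List.nodup_cons.2 ⟨hk, hjs⟩
    have h2 : (k :: js).toFinset = Finset.univ := by
      rw [← Finset.card_eq_iff_eq_univ, List.toFinset_card_of_nodup h1, List.length_cons, hlen]
    have h3 : i ∈ (k :: js).toFinset := by rw [h2]; exact Finset.mem_univ i
    simpa [hi] using h3
  have hJ₀ : ∀ i, J₀ ≠ .a (some i) ∧ J₀ ≠ .b (some i) ∧ J₀ ≠ .c := by
    rcases hJ with ⟨rfl, rfl⟩ | ⟨rfl, rfl⟩ <;> simp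
  have hJ₁ : ∀ i, J₁ ≠ .a (some i) ∧ J₁ ≠ .b (some i) ∧ J₁ ≠ .c := by
    rcases hJ with ⟨rfl, rfl⟩ | ⟨rfl, rfl⟩ <;> simp
  have hcl : ∀ j, letter t j ≠ .c := fun j => by unfold letter; split <;> simp
  have hCmem : ∀ x ∈ C, x = .c := by
    rcases hC with ⟨rfl, -⟩ | ⟨rfl, -⟩ <;> simp
  have hJ₀l : ∀ j, J₀ ≠ letter t j := fun j h => by
    unfold letter at h; split at h
    · exact (hJ₀ j).1 h
    · exact (hJ₀ j).2.1 h
  have hJ₁l : ∀ j, J₁ ≠ letter t j := fun j h => by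
    unfold letter at h; split at h
    · exact (hJ₁ j).1 h
    · exact (hJ₁ j).2.1 h
  have hJJ : J₀ ≠ J₁ := by rcases hJ with ⟨rfl, rfl⟩ | ⟨rfl, rfl⟩ <;> simp
  refine ⟨?_, ?_, ?_, ?_⟩
  · rw [hl.nodup_iff]
    have hnl : (C ++ js.map (letter t)).Nodup := by
      rw [List.nodup_append]
      refine ⟨by rcases hC with ⟨rfl, -⟩ | ⟨rfl, -⟩ <;> simp, hjs.map (letter_injective t), ?_⟩
      rintro x hx y hy rfl
      obtain ⟨j, -, hj⟩ := List.mem_map.1 hy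
      exact hcl j (hj.trans (hCmem x hx))
    have hno : ∀ x, x ≠ .c → (∀ j ∈ js, x ≠ letter t j) → x ∉ C ++ js.map (letter t) := by
      intro x hx hx' hmem
      rcases List.mem_append.1 hmem with h | h
      · exact hx (hCmem x h)
      · obtain ⟨j, hj, hj'⟩ := List.mem_map.1 h
        exact hx' j hj hj'.symm
    refine List.nodup_cons.2 ⟨?_, List.nodup_cons.2 ⟨?_, List.nodup_cons.2 ⟨?_,
      List.nodup_cons.2 ⟨?_, hnl⟩⟩⟩⟩
    · simp only [List.mem_cons, not_or]
      exact ⟨hJJ, (hJ₀ k).1, (hJ₀ k).2.1, hno _ (hJ₀ k).2.2 fun j _ => hJ₀l j⟩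
    · simp only [List.mem_cons, not_or]
      exact ⟨(hJ₁ k).1, (hJ₁ k).2.1, hno _ (hJ₁ k).2.2 fun j _ => hJ₁l j⟩
    · simp only [List.mem_cons, not_or]
      exact ⟨by simp, hno _ (by simp) fun j hj h => hk (by rw [(a_eq_letter.1 h).1]; exact hj)⟩
    · exact hno _ (by simp) fun j hj h => hk (by rw [(b_eq_letter.1 h).1]; exact hj)
  · intro i hi
    rw [hl.mem_iff]
    have : Arm.a (some i) ∉ C := fun h => by simpa using hCmem _ h
    simp only [List.mem_cons, (hJ₀ i).1.symm, (hJ₁ i).1.symm, List.mem_append, this, List.mem_map,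
      Arm.a.injEq, Option.some.injEq, hi, reduceCtorEq, false_or]
    constructor
    · rintro ⟨j, -, hj⟩
      obtain ⟨rfl, h⟩ := a_eq_letter.1 hj.symm
      exact h
    · exact fun h => ⟨i, hmem i hi, (a_eq_letter.2 ⟨rfl, h⟩).symm⟩
  · intro i hi
    rw [hl.mem_iff]
    have : Arm.b (some i) ∉ C := fun h => by simpa using hCmem _ h
    simp only [List.mem_cons, (hJ₀ i).2.1.symm, (hJ₁ i).2.1.symm, List.mem_append, this,
      List.mem_map, Arm.b.injEq, Option.some.injEq, hi, reduceCtorEq, false_or]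
    constructor
    · rintro ⟨j, -, hj⟩
      obtain ⟨rfl, h⟩ := b_eq_letter.1 hj.symm
      exact h
    · exact fun h => ⟨i, hmem i hi, (b_eq_letter.2 ⟨rfl, h⟩).symm⟩
  · rw [hl.mem_iff]
    simp only [List.mem_cons, (hJ₀ k).2.2.symm, (hJ₁ k).2.2.symm, List.mem_append, List.mem_map,
      hcl, reduceCtorEq, false_or, and_false, exists_false, or_false]
    rcases hC with ⟨rfl, h⟩ | ⟨rfl, h⟩ <;> simp [h]

omit [DecidableEq I] [Fintype I] in
theorem GoodList.perm {k : I} {t : I → Bool} {hasC : Prop} {l l' : List (Arm I)}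
    (h : GoodList k t hasC l) (hl : l'.Perm l) : GoodList k t hasC l' where
  nodup := hl.nodup_iff.2 h.nodup
  mem_a i hi := hl.mem_iff.trans (h.mem_a i hi)
  mem_b i hi := hl.mem_iff.trans (h.mem_b i hi)
  mem_c := hl.mem_iff.trans h.mem_c

theorem infix_pair_append {α : Type*} {l₁ l₂ : List α} {x y : α} :
    [x, y] <:+: l₁ ++ l₂ ↔
      [x, y] <:+: l₁ ∨ (l₁.getLast? = some x ∧ l₂.head? = some y) ∨ [x, y] <:+: l₂ := by
  induction l₁ with
  | nil => simp
  | cons u l ih =>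
    rw [List.cons_append, infix_pair_cons, ih, infix_pair_cons]
    cases l with
    | nil => simp [eq_comm (a := x)]
    | cons v l =>
      rw [List.cons_append, List.head?_cons, List.head?_cons, List.getLast?_cons_cons, or_assoc]

theorem infix_map_range' {α : Type*} (f : ℕ → α) {a m t : ℕ} (ha : a ≤ t) (h : t + 1 < a + m) :
    [f t, f (t + 1)] <:+: (List.range' a m).map f := by
  have h1 : List.range' a m =
      List.range' a (t - a) ++ ([t, t + 1] ++ List.range' (t + 2) (a + m - (t + 2))) := by
    rw [show [t, t + 1] = List.range' t 2 from rfl, List.range'_append_1]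
    conv_rhs => rw [show List.range' t (2 + (a + m - (t + 2))) =
      List.range' (a + (t - a)) (2 + (a + m - (t + 2))) by congr 1; omega]
    rw [List.range'_append_1]
    congr 1; omega
  rw [h1, List.map_append, List.map_append]
  exact ⟨_, _, List.append_assoc _ _ _⟩

theorem infix_map_range {α : Type*} (f : ℕ → α) {m t : ℕ} (h : t + 1 < m) :
    [f t, f (t + 1)] <:+: (List.range m).map f := by
  rw [List.range_eq_range']
  exact infix_map_range' f (Nat.zero_le t) (by omega)

/-- The two strands, exchanged if the condition holds. -/
def swapIf {α : Type*} (τ : Bool) (p : α × α) : α × α := if τ = true then p.swap else p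

theorem linked_swapIf {α : Type*} {τ : Bool} {p : List α × List α} {x y : α} :
    Linked (swapIf τ p) x y ↔ Linked p x y := by
  unfold swapIf Linked Follows
  split
  · simp only [Prod.fst_swap, Prod.snd_swap]; tauto
  · rfl

theorem swapIf_perm {α : Type*} (τ : Bool) (p : List α × List α) :
    ((swapIf τ p).1 ++ (swapIf τ p).2).Perm (p.1 ++ p.2) := by
  unfold swapIf
  split
  · exact List.perm_append_comm
  · exact List.Perm.refl _

theorem Linked.of_infix_left {α : Type*} {p : List α × List α} {x y : α} (h : [x, y] <:+: p.1) :
    Linked p x y := Or.inl (Or.inl h)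

theorem Linked.of_infix_right {α : Type*} {p : List α × List α} {x y : α} (h : [x, y] <:+: p.2) :
    Linked p x y := Or.inl (Or.inr h)

end Strands

/-! ### An odd number of indices: the strands -/

/-- To check a symmetric relation for all pairs of distinct edges at a vertex it suffices to check
it for the kinds of pairs. -/
theorem Arm.rel_of_ne {I : Type*} {R : Arm I → Arm I → Prop} (hR : ∀ x y, R x y → R y x)
    {J₀ J₁ : Arm I} (hJ : AtInfinity J₀ J₁) (h01 : R J₀ J₁) (hc0 : R .c J₀) (hc1 : R .c J₁)
    (ha0 : ∀ i, R (.a (some i)) J₀) (ha1 : ∀ i, R (.a (some i)) J₁)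
    (hb0 : ∀ i, R (.b (some i)) J₀) (hb1 : ∀ i, R (.b (some i)) J₁)
    (hac : ∀ i, R (.a (some i)) .c) (hbc : ∀ i, R (.b (some i)) .c)
    (haa : ∀ i j, i ≠ j → R (.a (some i)) (.a (some j)))
    (hbb : ∀ i j, i ≠ j → R (.b (some i)) (.b (some j)))
    (hab : ∀ i j, R (.a (some i)) (.b (some j))) (x y : Arm I) (hxy : x ≠ y) : R x y := by
  have key : ∀ {A B : Arm I}, A = .a none → B = .b none → R A B → R .c A → R .c B →
      (∀ i, R (.a (some i)) A) → (∀ i, R (.a (some i)) B) →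
      (∀ i, R (.b (some i)) A) → (∀ i, R (.b (some i)) B) → R x y := by
    rintro _ _ rfl rfl h01 hc0 hc1 ha0 ha1 hb0 hb1
    rcases x with (_ | i) | (_ | i) | _ <;> rcases y with (_ | j) | (_ | j) | _ <;>
      first
      | exact absurd rfl hxy
      | exact h01
      | exact hc0
      | exact hc1
      | exact ha0 _
      | exact ha1 _
      | exact hb0 _
      | exact hb1 _
      | exact hac _
      | exact hbc _
      | exact hab _ _
      | exact hR _ _ (h01)
      | exact hR _ _ (hc0)
      | exact hR _ _ (hc1)
      | exact hR _ _ (ha0 _)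
      | exact hR _ _ (ha1 _)
      | exact hR _ _ (hb0 _)
      | exact hR _ _ (hb1 _)
      | exact hR _ _ (hac _)
      | exact hR _ _ (hbc _)
      | exact hR _ _ (hab _ _)
      | exact haa i j fun h => hxy (by rw [h])
      | exact hbb i j fun h => hxy (by rw [h])
  rcases hJ with ⟨rfl, rfl⟩ | ⟨rfl, rfl⟩
  · exact key rfl rfl h01 hc0 hc1 ha0 ha1 hb0 hb1
  · exact key rfl rfl (hR _ _ h01) hc1 hc0 ha1 ha0 hb1 hb0

theorem _root_.List.Nodup.map_natCast_add {h : ℕ} {l : List ℕ} (hl : l.Nodup) (hlt : ∀ m ∈ l, m < h)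
    (g : ZMod h) : (l.map fun m : ℕ => g + (m : ZMod h)).Nodup := by
  refine List.Nodup.map_on ?_ hl
  intro x hx y hy hxy
  have h1 : (x : ZMod h) = y := add_left_cancel hxy
  rw [ZMod.natCast_eq_natCast_iff'] at h1
  rwa [Nat.mod_eq_of_lt (hlt x hx), Nat.mod_eq_of_lt (hlt y hy)] at h1

namespace OddOrder

variable (H : ℕ)

/-- The edge at distance `m` from `g` in a colour of the group `g`. -/
def arm (g : ZMod (2 * H + 1)) (m : ℕ) : Arm (ZMod (2 * H + 1)) :=
  if m ≤ H then .a (some (g + m)) else .b (some (g + m))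

/-- The distances `1, 2H, 2, 2H - 1, …, H + 2, H`. -/
def zigzag : List ℕ :=
  (List.range (2 * H - 1)).map fun t => if t % 2 = 0 then t / 2 + 1 else 2 * H + 1 - (t + 1) / 2

/-- The `t`-th of the distances `H, 1, H - 1, 2, …`. -/
def inner (t : ℕ) : ℕ := if t % 2 = 0 then H - t / 2 else (t + 1) / 2

/-- The distances `H, 1, H - 1, 2, …` of the edges `a i`. -/
def innerA : List ℕ := (List.range H).map (inner H)

/-- The distances `H + 1, 2H, H + 2, 2H - 1, …` of the edges `b i`. -/
def innerB : List ℕ := (List.range H).map fun t => 2 * H + 1 - inner H t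

/-- The `t`-th edge of the arc of the colour `(none, ε)`: the index is `t`, and edges of the two
kinds alternate. The arc goes on to `t = 2H + 1`, so that both edges with the index `0` are its
ends. -/
def arcArm (ε : Bool) (t : ℕ) : Arm (ZMod (2 * H + 1)) :=
  if (decide (t % 2 = 0)) = ε then .a (some t) else .b (some t)

/-- The strands of the colour of the group `g` that has `c`. The path on the other edges is `zigzag`
if `o` holds, and it is composed of `innerA` and `innerB` if not. The order of the edges at infinity
is given by `τ`. If `l` holds, then `c` is moved to the end of the strand. -/
def withC (τ o l : Bool) (g : ZMod (2 * H + 1)) :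
    List (Arm (ZMod (2 * H + 1))) × List (Arm (ZMod (2 * H + 1))) :=
  (if o = true then
    [jay τ] ++ (zigzag H).map (arm H g) ++
      (if l = true then [arm H g (H + 1), .c, jay !τ] else [.c, arm H g (H + 1), jay !τ])
  else [jay !τ] ++ ((innerA H).map (arm H g)).reverse ++ [.c] ++ (innerB H).map (arm H g) ++
    [jay τ],
  [.a (some g), .b (some g)])

/-- The strands of the colour of the group `g` that has not `c`. It uses `innerA` and `innerB` when
the other colour of the group uses `zigzag`, and conversely. -/
def withoutC (τ o : Bool) (g : ZMod (2 * H + 1)) :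
    List (Arm (ZMod (2 * H + 1))) × List (Arm (ZMod (2 * H + 1))) :=
  if o = true then
    ([.b (some g)] ++ (innerB H).map (arm H g) ++ [jay τ],
      [.a (some g)] ++ (innerA H).map (arm H g) ++ [jay !τ])
  else ([jay τ] ++ (zigzag H).map (arm H g) ++ [.a (some g)],
    [.b (some g), arm H g (H + 1), jay !τ])

/-- The strands of the colour `(none, e)` if its arc is opened before the place `p` and the two
parts are attached to the edges at infinity, the first one by way of `c`. -/
def linkedArc (τ e : Bool) (p : ℕ) :
    List (Arm (ZMod (2 * H + 1))) × List (Arm (ZMod (2 * H + 1))) :=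
  ([jay τ, .c] ++ ((List.range p).map (arcArm H e)).reverse,
    [jay !τ] ++ (List.range' p (2 * H + 2 - p)).map (arcArm H e))

/-- The strands of the colour `(none, e)` if its arc is one of them; the other one goes from `a_∞`
to `b_∞`, with the list `C` between them. -/
def wholeArc (e : Bool) (C : List (Arm (ZMod (2 * H + 1)))) :
    List (Arm (ZMod (2 * H + 1))) × List (Arm (ZMod (2 * H + 1))) :=
  ([.a none] ++ C ++ [.b none], (List.range (2 * H + 2)).map (arcArm H e))

/-- The indices that a colour of the group `g` passes through edges `a i`. -/
def inHalf (g i : ZMod (2 * H + 1)) : Bool := decide (1 ≤ (i - g).val ∧ (i - g).val ≤ H)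

/-- The indices that the colour `(none, ε)` passes through edges `a i`. -/
def inArc (ε : Bool) (i : ZMod (2 * H + 1)) : Bool := decide (i.val % 2 = 0) == ε

variable {H}

theorem arm_eq_letter (g : ZMod (2 * H + 1)) {m : ℕ} (h1 : 1 ≤ m) (h2 : m ≤ 2 * H) :
    arm H g m = letter (inHalf H g) (g + m) := by
  unfold arm letter inHalf
  rw [add_sub_cancel_left, ZMod.val_natCast_of_lt (by omega)]
  by_cases h : m ≤ H <;> simp [h, h1]

theorem map_arm {g : ZMod (2 * H + 1)} {l : List ℕ} (hl : ∀ m ∈ l, 1 ≤ m ∧ m ≤ 2 * H) :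
    l.map (arm H g) = (l.map fun m : ℕ => g + (m : ZMod (2 * H + 1))).map
      (letter (inHalf H g)) := by
  rw [List.map_map]
  exact List.map_congr_left fun m hm => arm_eq_letter g (hl m hm).1 (hl m hm).2

theorem goodList_arm (τ : Bool) {g : ZMod (2 * H + 1)} {l : List ℕ} (hl : ∀ m ∈ l,
    1 ≤ m ∧ m ≤ 2 * H)
    (hn : l.Nodup) (hlen : l.length = 2 * H) {hasC : Prop} {C L : List (Arm (ZMod (2 * H + 1)))}
    (hC : (C = [.c] ∧ hasC) ∨ (C = [] ∧ ¬ hasC))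
    (hL : L.Perm (jay τ :: (jay !τ) :: .a (some g) :: .b (some g) :: (C ++ l.map (arm H g)))) :
    GoodList g (inHalf H g) hasC L := by
  refine GoodList.of_perm (atInfinity_jay τ)
    (List.Nodup.map_natCast_add hn (fun m hm => by have := hl m hm; omega) g) ?_ ?_ hC
    (by rwa [map_arm hl] at hL)
  · intro hmem
    obtain ⟨m, hm, h⟩ := List.mem_map.1 hmem
    have h1 : ((m : ℕ) : ZMod (2 * H + 1)) = 0 := by simpa using h
    rw [ZMod.natCast_eq_zero_iff] at h1
    have := Nat.le_of_dvd (by have := hl m hm; omega) h1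
    have := hl m hm
    omega
  · rw [List.length_map, hlen, ZMod.card]

theorem nodup_zigzag : (zigzag H).Nodup := by
  refine List.Nodup.map_on ?_ List.nodup_range
  intro x hx y hy h
  rw [List.mem_range] at hx hy
  split_ifs at h <;> omega

theorem mem_zigzag {m : ℕ} (h : m ∈ zigzag H) : 1 ≤ m ∧ m ≤ 2 * H ∧ m ≠ H + 1 := by
  obtain ⟨t, ht, rfl⟩ := List.mem_map.1 h
  rw [List.mem_range] at ht
  split_ifs <;> omega

theorem inner_mem {t : ℕ} (ht : t < H) : 1 ≤ inner H t ∧ inner H t ≤ H := by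
  unfold inner
  split_ifs <;> omega

theorem inner_inj {t u : ℕ} (ht : t < H) (hu : u < H) (h : inner H t = inner H u) : t = u := by
  unfold inner at h
  split_ifs at h <;> omega

theorem nodup_inner : (innerA H ++ innerB H).Nodup := by
  rw [List.nodup_append]
  refine ⟨List.Nodup.map_on ?_ List.nodup_range, List.Nodup.map_on ?_ List.nodup_range, ?_⟩
  · intro x hx y hy h
    rw [List.mem_range] at hx hy
    exact inner_inj hx hy h
  · intro x hx y hy h
    rw [List.mem_range] at hx hy
    have := inner_mem hx
    have := inner_mem hy
    exact inner_inj hx hy (by omega)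
  · rintro x hx y hy rfl
    obtain ⟨t, ht, rfl⟩ := List.mem_map.1 hx
    obtain ⟨t', ht', h⟩ := List.mem_map.1 hy
    have := inner_mem (List.mem_range.1 ht)
    have := inner_mem (List.mem_range.1 ht')
    omega

theorem mem_inner {m : ℕ} (h : m ∈ innerA H ++ innerB H) : 1 ≤ m ∧ m ≤ 2 * H := by
  rcases List.mem_append.1 h with h | h <;> obtain ⟨t, ht, rfl⟩ := List.mem_map.1 h <;>
    have := inner_mem (List.mem_range.1 ht)
  · omega
  · omega

theorem goodList_withC (hH : 1 ≤ H) (τ o l : Bool) (g : ZMod (2 * H + 1)) :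
    GoodList g (inHalf H g) True ((withC H τ o l g).1 ++ (withC H τ o l g).2) := by
  cases o
  · refine goodList_arm τ (l := innerA H ++ innerB H) (fun m => mem_inner) nodup_inner
      (by simp [innerA, innerB]; omega) (C := [.c]) (Or.inl ⟨rfl, trivial⟩) ?_
    rw [List.perm_iff_count]
    intro x
    simp only [withC, List.count_append, List.count_cons, List.count_nil, List.map_append,
      List.count_reverse, Bool.false_eq_true, if_false]
    ring
  · refine goodList_arm τ (l := zigzag H ++ [H + 1]) ?_ ?_
      (by simp [zigzag]; omega) (C := [.c]) (Or.inl ⟨rfl, trivial⟩) ?_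
    · intro m hm
      rcases List.mem_append.1 hm with h | h
      · exact ⟨(mem_zigzag h).1, (mem_zigzag h).2.1⟩
      · rw [List.mem_singleton] at h; omega
    · rw [List.nodup_append]
      refine ⟨nodup_zigzag, List.nodup_singleton _, ?_⟩
      rintro x hx y hy rfl
      exact (mem_zigzag hx).2.2 (List.mem_singleton.1 hy)
    rw [List.perm_iff_count]
    intro x
    cases l <;>
    simp only [withC, List.count_append, List.count_cons, List.count_nil, List.map_append,
      Bool.false_eq_true, if_false, if_true, List.map_cons, List.map_nil] <;>
    ring

theorem goodList_withoutC (hH : 1 ≤ H) (τ o : Bool) (g : ZMod (2 * H + 1)) :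
    GoodList g (inHalf H g) False ((withoutC H τ o g).1 ++ (withoutC H τ o g).2) := by
  cases o
  · refine goodList_arm τ (l := zigzag H ++ [H + 1]) ?_ ?_
      (by simp [zigzag]; omega) (C := []) (Or.inr ⟨rfl, id⟩) ?_
    · intro m hm
      rcases List.mem_append.1 hm with h | h
      · exact ⟨(mem_zigzag h).1, (mem_zigzag h).2.1⟩
      · rw [List.mem_singleton] at h; omega
    · rw [List.nodup_append]
      refine ⟨nodup_zigzag, List.nodup_singleton _, ?_⟩
      rintro x hx y hy rfl
      exact (mem_zigzag hx).2.2 (List.mem_singleton.1 hy)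
    rw [List.perm_iff_count]
    intro x
    simp only [withoutC, List.count_append, List.count_cons, List.count_nil, List.map_append,
      Bool.false_eq_true, if_false, List.map_cons, List.map_nil]
    ring
  · refine goodList_arm τ (l := innerA H ++ innerB H) (fun m => mem_inner) nodup_inner
      (by simp [innerA, innerB]; omega) (C := []) (Or.inr ⟨rfl, id⟩) ?_
    rw [List.perm_iff_count]
    intro x
    simp only [withoutC, List.count_append, List.count_cons, List.count_nil, List.map_append,
      if_true]
    ring

theorem arcArm_eq_letter (e : Bool) {t : ℕ} (ht : t < 2 * H + 1) :
    arcArm H e t = letter (inArc H e) (t : ZMod (2 * H + 1)) := by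
  unfold arcArm letter inArc
  rw [ZMod.val_natCast_of_lt ht]
  simp

theorem goodList_arc {e : Bool} {hasC : Prop} (τ : Bool) {C L : List (Arm (ZMod (2 * H + 1)))}
    (hC : (C = [.c] ∧ hasC) ∨ (C = [] ∧ ¬ hasC))
    (hL : L.Perm (jay τ :: (jay !τ) :: (C ++ (List.range (2 * H + 2)).map (arcArm H e)))) :
    GoodList 0 (inArc H e) hasC L := by
  have h1 : (List.range (2 * H + 2)).map (arcArm H e) =
      arcArm H e 0 :: ((List.range' 1 (2 * H)).map (arcArm H e) ++ [arcArm H e (2 * H + 1)]) := by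
    have h : List.range (2 * H + 2) = 0 :: (List.range' 1 (2 * H) ++ [2 * H + 1]) := by
      rw [List.range_eq_range', show 2 * H + 2 = (2 * H + 1) + 1 by rfl, List.range'_succ,
        List.range'_1_concat]
      simp [add_comm]
    rw [h, List.map_cons, List.map_append, List.map_singleton]
  have h2 : (List.range' 1 (2 * H)).map (arcArm H e) =
      ((List.range' 1 (2 * H)).map fun m : ℕ => (0 : ZMod (2 * H + 1)) + (m : ZMod (2 * H + 1))).map
        (letter (inArc H e)) := by
    rw [List.map_map]
    refine List.map_congr_left fun m hm => ?_
    rw [List.mem_range'_1] at hm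
    rw [arcArm_eq_letter e (by omega), Function.comp_apply, zero_add]
  have h0 : ∀ x, List.count x [arcArm H e 0] + List.count x [arcArm H e (2 * H + 1)] =
      List.count x [.a (some (0 : ZMod (2 * H + 1)))] + List.count x
        [.b (some (0 : ZMod (2 * H + 1)))] := by
    intro x
    have h3 : ((2 * H + 1 : ℕ) : ZMod (2 * H + 1)) = 0 := ZMod.natCast_self _
    unfold arcArm
    rw [h3, show (2 * H + 1) % 2 = 1 by omega]
    cases e <;> simp [add_comm]
  refine GoodList.of_perm (atInfinity_jay τ) (List.Nodup.map_natCast_add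
    (l := List.range' 1 (2 * H)) List.nodup_range' (fun m hm => ?_) 0) ?_ ?_ hC ?_
  · rw [List.mem_range'_1] at hm; omega
  · intro hmem
    obtain ⟨m, hm, h⟩ := List.mem_map.1 hmem
    rw [List.mem_range'_1] at hm
    rw [zero_add, ZMod.natCast_eq_zero_iff] at h
    have := Nat.le_of_dvd (by omega) h
    omega
  · rw [List.length_map, List.length_range', ZMod.card]
  · refine hL.trans ?_
    rw [h1, h2, List.perm_iff_count]
    intro x
    have := h0 x
    simp only [List.count_append, List.count_cons, List.count_nil] at this ⊢
    omega

end OddOrder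

/-! ### An odd number of indices: the pairs in the groups -/

namespace OddOrder

variable {H : ℕ}

theorem head?_zigzag (hH : 1 ≤ H) : (zigzag H).head? = some 1 := by
  obtain ⟨k, hk⟩ : ∃ k, 2 * H - 1 = k + 1 := ⟨2 * H - 2, by omega⟩
  simp [zigzag, hk, List.range_succ_eq_map]

theorem getLast?_zigzag (hH : 1 ≤ H) : (zigzag H).getLast? = some H := by
  obtain ⟨k, rfl⟩ : ∃ k, H = k + 1 := ⟨H - 1, by omega⟩
  simp [zigzag, show 2 * (k + 1) - 1 = 2 * k + 1 by omega, List.range_succ]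

theorem head?_innerA (hH : 1 ≤ H) : (innerA H).head? = some H := by
  obtain ⟨k, rfl⟩ : ∃ k, H = k + 1 := ⟨H - 1, by omega⟩
  simp [innerA, List.range_succ_eq_map, inner]

theorem getLast?_innerA (hH : 1 ≤ H) : (innerA H).getLast? = some (inner H (H - 1)) := by
  obtain ⟨k, rfl⟩ : ∃ k, H = k + 1 := ⟨H - 1, by omega⟩
  simp [innerA, List.range_succ]

theorem head?_innerB (hH : 1 ≤ H) : (innerB H).head? = some (H + 1) := by
  obtain ⟨k, rfl⟩ : ∃ k, H = k + 1 := ⟨H - 1, by omega⟩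
  simp [innerB, List.range_succ_eq_map, inner]
  omega

theorem getLast?_innerB (hH : 1 ≤ H) :
    (innerB H).getLast? = some (2 * H + 1 - inner H (H - 1)) := by
  obtain ⟨k, rfl⟩ : ∃ k, H = k + 1 := ⟨H - 1, by omega⟩
  simp [innerB, List.range_succ]

/-- The pair is consecutive in a colour of the group `g`. -/
def InGroup (τ o l : Bool) (g : ZMod (2 * H + 1)) (x y : Arm (ZMod (2 * H + 1))) : Prop :=
  Linked (withC H τ o l g) x y ∨ Linked (withoutC H τ o g) x y

theorem InGroup.symm {τ o l : Bool} {g : ZMod (2 * H + 1)} {x y : Arm (ZMod (2 * H + 1))}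
    (h : InGroup τ o l g x y) : InGroup τ o l g y x :=
  h.imp Linked.symm Linked.symm

variable {τ o l : Bool} {g : ZMod (2 * H + 1)} {x y : Arm (ZMod (2 * H + 1))}

theorem inGroup_zigzag (h : [x, y] <:+: (zigzag H).map (arm H g)) : InGroup τ o l g x y := by
  cases o <;> simp [InGroup, Linked, Follows, withC, withoutC, infix_pair_append,
    infix_pair_cons, h]

theorem inGroup_innerA (h : [x, y] <:+: (innerA H).map (arm H g)) : InGroup τ o l g x y := by
  cases o <;> simp [InGroup, Linked, Follows, withC, withoutC, infix_pair_append, infix_pair_cons,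
    infix_pair_reverse, h]

theorem inGroup_innerB (h : [x, y] <:+: (innerB H).map (arm H g)) : InGroup τ o l g x y := by
  cases o <;> simp [InGroup, Linked, Follows, withC, withoutC, infix_pair_append,
    infix_pair_cons, h]

/-- The pairs that the group `g` covers in every state, apart from those inside the three lists of
distances. -/
theorem inGroup_ends (hH : 1 ≤ H) :
    InGroup τ o l g (arm H g 1) (jay τ) ∧
    InGroup τ o l g (arm H g (2 * H + 1 - inner H (H - 1))) (jay τ) ∧
    InGroup τ o l g (arm H g (inner H (H - 1))) (jay !τ) ∧
    InGroup τ o l g (arm H g (H + 1)) .c ∧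
    InGroup τ o l g (.a (some g)) (arm H g H) ∧
    InGroup τ o l g (.b (some g)) (arm H g (H + 1)) ∧
    InGroup τ o l g (.a (some g)) (.b (some g)) := by
  cases o <;> cases l <;> simp [InGroup, Linked, Follows, withC, withoutC, infix_pair_append,
    infix_pair_cons,
    head?_zigzag hH, getLast?_zigzag hH, head?_innerA hH, head?_innerB hH, getLast?_innerA hH,
    getLast?_innerB hH]

theorem inGroup_unlinked (hH : 1 ≤ H) (hl : o = true → l = false) :
    InGroup τ o l g (arm H g H) .c ∧ InGroup τ o l g (arm H g (H + 1)) (jay !τ) := by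
  cases o <;> cases l <;> simp [InGroup, Linked, Follows, withC, withoutC, infix_pair_append,
    infix_pair_cons,
    head?_zigzag hH, getLast?_zigzag hH, head?_innerA hH, head?_innerB hH, getLast?_innerA hH,
    getLast?_innerB hH] at hl ⊢

/-- Linking takes the pairs of `inGroup_unlinked` away from the group `g`, which gets two others for
them. -/
theorem inGroup_linked (hH : 1 ≤ H) :
    InGroup τ true true g (arm H g H) (arm H g (H + 1)) ∧ InGroup τ true true g .c (jay !τ) := by
  simp [InGroup, Linked, Follows, withC, withoutC, infix_pair_append, infix_pair_cons,
    head?_zigzag hH, getLast?_zigzag hH, head?_innerA hH, head?_innerB hH, getLast?_innerA hH,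
    getLast?_innerB hH]

theorem natCast_compl {q : ℕ} (hq : q ≤ 2 * H + 1) :
    ((2 * H + 1 - q : ℕ) : ZMod (2 * H + 1)) = -(q : ZMod (2 * H + 1)) := by
  rw [Nat.cast_sub hq, ZMod.natCast_self, zero_sub]

theorem arm_low {m : ℕ} (h : m ≤ H) : arm H g m = .a (some (g + m)) := if_pos h

theorem arm_high {m : ℕ} (h : m ≤ H) : arm H g (2 * H + 1 - m) = .b (some (g - m)) := by
  rw [arm, if_neg (by omega), natCast_compl (by omega), sub_eq_add_neg]

/-- Every difference `d < H` occurs between consecutive terms of `inner`. -/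
theorem exists_inner {d : ℕ} (h1 : 1 ≤ d) (h2 : d < H) : ∃ t, t + 1 < H ∧
    (inner H t = inner H (t + 1) + d ∨ inner H (t + 1) = inner H t + d) := by
  refine ⟨H - 1 - d, by omega, ?_⟩
  unfold inner
  split_ifs <;> omega

/-- Every pair of edges `a i` is covered by a group: the differences of consecutive members of
`innerA` are `±1, …, ±(H - 1)`, and `a g` comes next to the edge `a i` at distance `H`. -/
theorem exists_inGroup_a (hH : 1 ≤ H) (O L : ZMod (2 * H + 1) → Bool) {d : ℕ} (h1 : 1 ≤ d)
    (h2 : d ≤ H) (i : ZMod (2 * H + 1)) :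
    ∃ g, InGroup τ (O g) (L g) g (.a (some i)) (.a (some (i + d))) := by
  rcases h2.eq_or_lt with rfl | h2
  · refine ⟨i, ?_⟩
    have := (inGroup_ends (τ := τ) (o := O i) (l := L i) (g := i) hH).2.2.2.2.1
    rwa [arm_low le_rfl] at this
  obtain ⟨t, ht, h⟩ := exists_inner h1 h2
  have h3 : ∀ g : ZMod (2 * H + 1), InGroup τ (O g) (L g) g (.a (some (g + inner H t)))
      (.a (some (g + inner H (t + 1)))) := by
    intro g
    rw [← arm_low (inner_mem (by omega)).2, ← arm_low (inner_mem ht).2]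
    apply inGroup_innerA
    rw [innerA, List.map_map]
    exact infix_map_range (arm H g ∘ inner H) ht
  rcases h with h | h
  · refine ⟨i - inner H (t + 1), ?_⟩
    have := (h3 (i - inner H (t + 1))).symm
    rw [h] at this
    convert this using 3 <;> push_cast <;> ring
  · refine ⟨i - inner H t, ?_⟩
    have := h3 (i - inner H t)
    rw [h] at this
    convert this using 3 <;> push_cast <;> ring

theorem exists_inGroup_b (hH : 1 ≤ H) (O L : ZMod (2 * H + 1) → Bool) {d : ℕ} (h1 : 1 ≤ d)
    (h2 : d ≤ H) (i : ZMod (2 * H + 1)) :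
    ∃ g, InGroup τ (O g) (L g) g (.b (some (i + d))) (.b (some i)) := by
  rcases h2.eq_or_lt with rfl | h2
  · refine ⟨i + (d : ZMod (2 * d + 1)), ?_⟩
    have := (inGroup_ends (τ := τ) (o := O (i + (d : ZMod (2 * d + 1))))
      (l := L (i + (d : ZMod (2 * d + 1)))) (g := i + (d : ZMod (2 * d + 1))) hH).2.2.2.2.2.1
    rwa [show d + 1 = 2 * d + 1 - d by omega, arm_high le_rfl, add_sub_cancel_right] at this
  obtain ⟨t, ht, h⟩ := exists_inner h1 h2
  have h3 : ∀ g : ZMod (2 * H + 1), InGroup τ (O g) (L g) g (.b (some (g - inner H t)))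
      (.b (some (g - inner H (t + 1)))) := by
    intro g
    rw [← arm_high (inner_mem (by omega)).2, ← arm_high (inner_mem ht).2]
    apply inGroup_innerB
    rw [innerB, List.map_map]
    exact infix_map_range (arm H g ∘ fun t => 2 * H + 1 - inner H t) ht
  rcases h with h | h
  · refine ⟨i + ((inner H (t + 1) + d : ℕ) : ZMod (2 * H + 1)), ?_⟩
    have := (h3 (i + inner H t)).symm
    rw [h] at this
    convert this using 3 <;> push_cast <;> ring
  · refine ⟨i + ((inner H t + d : ℕ) : ZMod (2 * H + 1)), ?_⟩
    have := h3 (i + inner H (t + 1))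
    rw [h] at this
    convert this using 3 <;> push_cast <;> ring

/-- The pairs of an edge `a i` and an edge `b j` for which `i - j` is not one of `0`, `1` and `-1`
are covered by the zigzags. -/
theorem exists_inGroup_ab (O L : ZMod (2 * H + 1) → Bool) {d : ℕ} (h1 : 2 ≤ d)
    (h2 : d + 1 ≤ 2 * H) (i : ZMod (2 * H + 1)) :
    ∃ g, InGroup τ (O g) (L g) g (.a (some (i + d))) (.b (some i)) := by
  have h3 := fun g => inGroup_zigzag (τ := τ) (o := O g) (l := L g) (g := g) (H := H) (by
    have h := infix_map_range (m := 2 * H - 1) (t := d - 2) (arm H g ∘ fun t => if t % 2 = 0 then t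
      / 2 + 1 else
      2 * H + 1 - (t + 1) / 2) (by omega)
    rwa [← List.map_map] at h)
  rcases Nat.even_or_odd' d with ⟨k, rfl | rfl⟩
  · refine ⟨i + k, ?_⟩
    have := h3 (i + k)
    simp only [Function.comp_apply, show (2 * k - 2) % 2 = 0 by omega, if_true,
      show ¬ (2 * k - 2 + 1) % 2 = 0 by omega, if_false] at this
    rw [arm_low (by omega), arm_high (by omega), show (2 * k - 2) / 2 + 1 = k by omega,
      show (2 * k - 2 + 1 + 1) / 2 = k by omega] at this
    convert this using 3 <;> push_cast <;> ring
  · refine ⟨i + k, ?_⟩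
    have := (h3 (i + k)).symm
    simp only [Function.comp_apply, show ¬ (2 * k + 1 - 2) % 2 = 0 by omega, if_true,
      show (2 * k + 1 - 2 + 1) % 2 = 0 by omega, if_false] at this
    rw [arm_low (by omega), arm_high (by omega), show (2 * k + 1 - 2 + 1) / 2 = k by omega] at this
    convert this using 3 <;> push_cast <;> ring

end OddOrder

/-! ### An odd number of indices: the patterns -/

namespace OddOrder

variable {H : ℕ}

/-- The place at which the arc of the colour `(none, e)` is opened when it is linked. In both arcs
it is chosen such that an edge `a i` comes before it and an edge `b i` after it. -/
def openAt (e : Bool) : ℕ := if e = true then 1 else 2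

/-- The group through which the colour `(none, e)` is linked. -/
def linkGroup (H : ℕ) (e : Bool) : ZMod (2 * H + 1) := (openAt e : ZMod (2 * H + 1)) - 1 - H

/-- Whether `a_∞` and `b_∞` are exchanged in all groups. This is decided by the group through which
the arc may be linked, so that this group can use `zigzag` for the colour with `c`. -/
def flipped (s π : Option (ZMod (2 * H + 1)) → Bool) : Bool := !π (some (linkGroup H (s (some 0))))

/-- Whether the group `g` uses `zigzag` for the colour with `c`. -/
def outer (s π : Option (ZMod (2 * H + 1)) → Bool) (g : ZMod (2 * H + 1)) : Bool :=
  π (some g) == π (some (linkGroup H (s (some 0))))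

/-- Whether an arc is linked through the group `g`. -/
def linksAt (s π : Option (ZMod (2 * H + 1)) → Bool) (g : ZMod (2 * H + 1)) : Bool :=
  π none && decide (g = linkGroup H (s (some 0)))

/-- The strands of all colours. -/
def strands (s π : Option (ZMod (2 * H + 1)) → Bool) :
    Option (ZMod (2 * H + 1)) → Bool →
      List (Arm (ZMod (2 * H + 1))) × List (Arm (ZMod (2 * H + 1)))
  | some g, ε =>
    if ε = s (some g) then withC H (flipped s π) (outer s π g) (linksAt s π g) g
    else swapIf (flipped s π) (withoutC H (flipped s π) (outer s π g) g)
  | none, ε =>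
    if ε = s (some 0) then
      if π none = true then swapIf (flipped s π) (linkedArc H (flipped s π) ε (openAt ε))
      else wholeArc H ε [.c]
    else wholeArc H ε []

/-- The patterns of the active colours. In the group `none` the active colour is the one with `c`,
in the others the one without `c`. -/
def pat (s π : Option (ZMod (2 * H + 1)) → Bool) : Option (ZMod (2 * H + 1)) → Pattern
  | some g => if π (some g) = true then .cross else .turn
  | none =>
    if π none = true then if flipped s π = s (some 0) then .cross else .turn else .straight

/-- The indices that a colour passes through edges `a i`. -/
def typ : Option (ZMod (2 * H + 1)) → Bool → ZMod (2 * H + 1) → Bool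
  | some g, _ => inHalf H g
  | none, ε => inArc H ε

theorem openAt_bounds (e : Bool) : 1 ≤ openAt e ∧ openAt e ≤ 2 := by cases e <;> decide

theorem arcArm_before (e : Bool) :
    arcArm H e (openAt e - 1) = .a (some ((openAt e - 1 : ℕ) : ZMod (2 * H + 1))) := by
  cases e <;> simp [arcArm, openAt]

theorem arcArm_at (e : Bool) :
    arcArm H e (openAt e) = .b (some ((openAt e : ℕ) : ZMod (2 * H + 1))) := by
  cases e <;> simp [arcArm, openAt]

theorem linkGroup_add (e : Bool) :
    linkGroup H e + H = ((openAt e - 1 : ℕ) : ZMod (2 * H + 1)) := by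
  rw [Nat.cast_sub (openAt_bounds e).1, linkGroup]
  push_cast; ring

theorem linkGroup_sub (e : Bool) :
    linkGroup H e - H = ((openAt e : ℕ) : ZMod (2 * H + 1)) := by
  have h : ((2 * H + 1 : ℕ) : ZMod (2 * H + 1)) = 0 := ZMod.natCast_self _
  push_cast at h
  rw [linkGroup]
  linear_combination -h

variable (s π : Option (ZMod (2 * H + 1)) → Bool)

theorem goodList_strands (hH : 1 ≤ H) (g : Option (ZMod (2 * H + 1))) (ε : Bool) :
    GoodList (g.getD 0) (typ g ε) (ε = s (some (g.getD 0)))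
      ((strands s π g ε).1 ++ (strands s π g ε).2) := by
  cases g with
  | some g =>
    simp only [strands, typ, Option.getD_some]
    split_ifs with h
    · simpa only [h] using goodList_withC hH _ _ _ g
    · simpa only [h] using (goodList_withoutC hH _ _ g).perm (swapIf_perm _ _)
  | none =>
    simp only [strands, typ, Option.getD_none]
    split_ifs with h h'
    · refine GoodList.perm (goodList_arc (flipped s π) (C := [.c]) (Or.inl ⟨rfl, h⟩) ?_)
        (swapIf_perm _ _)
      have h1 : List.range (2 * H + 2) =
          List.range (openAt ε) ++ List.range' (openAt ε) (2 * H + 2 - openAt ε) := by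
        rw [List.range_eq_range', List.range_eq_range']
        conv_rhs => rw [show List.range' (openAt ε) (2 * H + 2 - openAt ε) =
          List.range' (0 + openAt ε) (2 * H + 2 - openAt ε) by rw [zero_add]]
        rw [List.range'_append_1]
        have := openAt_bounds ε
        congr 1; omega
      rw [h1, List.perm_iff_count]
      intro x
      simp only [linkedArc, List.count_append, List.count_cons, List.count_nil, List.map_append,
        List.count_reverse]
      ring
    · refine goodList_arc (C := [.c]) false (Or.inl ⟨rfl, h⟩) ?_
      rw [List.perm_iff_count]
      intro x
      simp only [wholeArc, jay, List.count_append, List.count_cons, List.count_nil]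
      simp
      ring
    · refine goodList_arc (C := []) false (Or.inr ⟨rfl, h⟩) ?_
      rw [List.perm_iff_count]
      intro x
      simp only [wholeArc, jay, List.count_append, List.count_cons, List.count_nil]
      simp
      ring

theorem ends_withC (τ o l : Bool) (g : ZMod (2 * H + 1)) :
    Pattern.straight.Ends (some g) (withC H τ o l g) := by
  refine ⟨?_, Or.inl ⟨rfl, rfl⟩⟩
  cases o
  · refine (atInfinity_jay τ).endPair (Or.inr ⟨?_, ?_⟩) <;> simp [withC, List.getLast?_cons]
  · refine (atInfinity_jay τ).endPair (Or.inl ⟨?_, ?_⟩) <;> cases l <;> simp [withC,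
      List.getLast?_cons]

theorem ends_withoutC (τ o : Bool) (g : ZMod (2 * H + 1)) :
    (if (o ^^ τ) = true then Pattern.cross else .turn).Ends (some g)
      (swapIf τ (withoutC H τ o g)) := by
  cases o <;> cases τ <;>
    simp [withoutC, swapIf, Pattern.Ends, EndPair, jay, List.getLast?_cons]

theorem ends_wholeArc (e : Bool) (C : List (Arm (ZMod (2 * H + 1)))) :
    Pattern.straight.Ends (some 0) (wholeArc H e C) := by
  refine ⟨Or.inl ⟨by simp [wholeArc], by simp [wholeArc, List.getLast?_cons]⟩, ?_⟩
  have h1 : ((wholeArc H e C).2).head? = some (arcArm H e 0) := by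
    simp [wholeArc, List.range_succ_eq_map]
  have h2 : ((wholeArc H e C).2).getLast? = some (arcArm H e (2 * H + 1)) := by
    simp [wholeArc, List.range_succ]
  rw [EndPair, h1, h2]
  cases e <;> simp [arcArm, show (2 * H + 1) % 2 = 1 by omega]

theorem ends_linkedArc (hH : 1 ≤ H) (τ e : Bool) :
    (if τ = e then Pattern.cross else .turn).Ends (some 0)
      (swapIf τ (linkedArc H τ e (openAt e))) := by
  have h3 : ((2 * H + 1 : ℕ) : ZMod (2 * H + 1)) = 0 := ZMod.natCast_self _
  push_cast at h3
  have h1 : EndPair (linkedArc H τ e (openAt e)).1 (jay τ) (arcArm H e 0) := by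
    refine Or.inl ⟨by simp [linkedArc], ?_⟩
    obtain ⟨k, hk⟩ : ∃ k, openAt e = k + 1 := ⟨openAt e - 1, by have := openAt_bounds e; omega⟩
    simp [linkedArc, hk, List.range_succ_eq_map, List.getLast?_cons]
  have h2 : EndPair (linkedArc H τ e (openAt e)).2 (jay !τ) (arcArm H e (2 * H + 1)) := by
    refine Or.inl ⟨by simp [linkedArc], ?_⟩
    have h5 := openAt_bounds e
    obtain ⟨k, h4⟩ : ∃ k, openAt e + k = 2 * H + 1 := ⟨2 * H + 1 - openAt e, by omega⟩
    have hk : 2 * H + 2 - openAt e = k + 1 := by omega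
    simp [linkedArc, hk, List.range'_concat, h4, List.getLast?_cons]
  generalize linkedArc H τ e (openAt e) = p at *
  cases e <;> cases τ <;>
    simpa [swapIf, Pattern.Ends, arcArm, h3, jay, show (2 * H + 1) % 2 = 1 by omega, and_comm]
      using And.intro h1 h2

end OddOrder

/-! ### An odd number of indices: the local design -/

namespace OddOrder

variable {H : ℕ} (s π : Option (ZMod (2 * H + 1)) → Bool)

theorem linked_of_inGroup {g : ZMod (2 * H + 1)} {x y : Arm (ZMod (2 * H + 1))}
    (h : InGroup (flipped s π) (outer s π g) (linksAt s π g) g x y) :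
    ∃ g ε, Linked (strands s π g ε) x y := by
  rcases h with h | h
  · exact ⟨some g, s (some g), by rwa [strands, if_pos rfl]⟩
  · exact ⟨some g, !s (some g), by rwa [strands, if_neg (by simp), linked_swapIf]⟩

theorem outer_linkGroup : outer s π (linkGroup H (s (some 0))) = true := by simp [outer]

theorem linksAt_linkGroup (h : π none = true) : linksAt s π (linkGroup H (s (some 0))) = true := by
  simp [linksAt, h]

/-- Consecutive members of an arc are covered. If the arc is opened between them, the group through
which it is linked covers this pair. -/
theorem linked_arc (hH : 1 ≤ H) (e : Bool) {t : ℕ} (ht : t < 2 * H + 1) :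
    ∃ g ε, Linked (strands s π g ε) (arcArm H e t) (arcArm H e (t + 1)) := by
  by_cases h : e = s (some 0) ∧ π none = true
  · by_cases hp : t + 1 = openAt e
    · apply linked_of_inGroup s π (g := linkGroup H (s (some 0)))
      rw [outer_linkGroup, linksAt_linkGroup s π h.2, ← h.1]
      have := (inGroup_linked (τ := flipped s π) (g := linkGroup H e) hH).1
      rw [arm_low le_rfl, show H + 1 = 2 * H + 1 - H by omega, arm_high le_rfl, linkGroup_add,
        linkGroup_sub, ← arcArm_before, ← arcArm_at] at this
      rwa [hp, show t = openAt e - 1 by omega]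
    · refine ⟨none, e, ?_⟩
      rw [strands, if_pos h.1, if_pos h.2, linked_swapIf]
      by_cases hlt : t < openAt e
      · right; left
        simp only [linkedArc, infix_pair_append, infix_pair_reverse]
        exact Or.inr (Or.inr (infix_map_range _ (by omega)))
      · left; right
        simp only [linkedArc, infix_pair_append]
        exact Or.inr (Or.inr (infix_map_range' _ (by omega) (by omega)))
  · refine ⟨none, e, ?_⟩
    have h1 : ∀ C, Linked (wholeArc H e C) (arcArm H e t) (arcArm H e (t + 1)) := fun C =>
      Linked.of_infix_right (infix_map_range _ (by omega))
    rw [strands]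
    split_ifs with h2 h3
    · exact absurd ⟨h2, h3⟩ h
    · exact h1 _
    · exact h1 _

theorem arcArm_of_eq {e : Bool} {t : ℕ} (h : decide (t % 2 = 0) = e) :
    arcArm H e t = .a (some (t : ZMod (2 * H + 1))) := if_pos h

theorem arcArm_of_ne {e : Bool} {t : ℕ} (h : decide (t % 2 = 0) ≠ e) :
    arcArm H e t = .b (some (t : ZMod (2 * H + 1))) := if_neg h

theorem rel_of_rel_add {R : Arm (ZMod (2 * H + 1)) → Arm (ZMod (2 * H + 1)) → Prop}
    {f : ZMod (2 * H + 1) → Arm (ZMod (2 * H + 1))} (hR : ∀ x y, R x y → R y x)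
    (h : ∀ (i : ZMod (2 * H + 1)) (d : ℕ), 1 ≤ d → d ≤ H → R (f i) (f (i + d)))
    (i j : ZMod (2 * H + 1)) (hij : i ≠ j) : R (f i) (f j) := by
  have hd : j = i + (((j - i).val : ℕ) : ZMod (2 * H + 1)) := by
    rw [ZMod.natCast_zmod_val]; ring
  have hlt := ZMod.val_lt (j - i)
  have h0 : (j - i).val ≠ 0 := by rwa [Ne, ZMod.val_eq_zero, sub_eq_zero, eq_comm]
  generalize (j - i).val = d at hd hlt h0
  rcases Nat.le_or_ge d H with hdH | hdH
  · rw [hd]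
    exact h i d (by omega) hdH
  · have hi : i = j + ((2 * H + 1 - d : ℕ) : ZMod (2 * H + 1)) := by
      rw [natCast_compl (by omega), hd]; ring
    by_cases hdH : d = H
    · rw [hd]
      exact h i d (by omega) hdH.le
    · refine hR _ _ ?_
      conv in f i => rw [hi]
      exact h j _ (by omega) (by omega)

/-- All pairs are covered. The pairs of `a i` and `b j` with `i - j = ±1` come from the arcs, and
the others from the groups. -/
theorem cover (hH : 1 ≤ H) (x y : Arm (ZMod (2 * H + 1))) (hxy : x ≠ y) :
    ∃ g ε, Linked (strands s π g ε) x y := by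
  have hends := fun g : ZMod (2 * H + 1) =>
    inGroup_ends (τ := flipped s π) (o := outer s π g) (l := linksAt s π g) (g := g) hH
  have hin := inner_mem (H := H) (t := H - 1) (by omega)
  have hJ := atInfinity_jay (I := ZMod (2 * H + 1)) (flipped s π)
  have hl : ∀ g, ¬ (π none = true ∧ g = linkGroup H (s (some 0))) →
      (outer s π g = true → linksAt s π g = false) := by
    intro g hg _
    simp only [linksAt, Bool.and_eq_false_iff, decide_eq_false_iff_not]
    by_cases h : π none = true
    · exact Or.inr fun h' => hg ⟨h, h'⟩
    · exact Or.inl (by simpa using h)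
  refine Arm.rel_of_ne (R := fun x y => ∃ g ε, Linked (strands s π g ε) x y)
    (fun x y ⟨g, ε, h⟩ => ⟨g, ε, h.symm⟩) hJ ?_ ?_ ?_ ?_ ?_ ?_ ?_ ?_ ?_ ?_ ?_ ?_ x y hxy
  · refine ⟨none, !s (some 0), ?_⟩
    rw [strands, if_neg (by simp)]
    have h1 : Linked (wholeArc H (!s (some 0)) []) (.a none) (.b none) :=
      Linked.of_infix_left (List.infix_refl _)
    cases flipped s π
    · exact h1
    · exact h1.symm
  · refine ⟨none, s (some 0), ?_⟩
    rw [strands, if_pos rfl]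
    split_ifs with h
    · rw [linked_swapIf]
      exact Or.inr (Or.inl ⟨[], _, rfl⟩)
    · cases flipped s π
      · exact Or.inr (Or.inl ⟨[], [.b none], rfl⟩)
      · exact Or.inl (Or.inl ⟨[.a none], [], rfl⟩)
  · by_cases h : π none = true
    · apply linked_of_inGroup s π (g := linkGroup H (s (some 0)))
      rw [outer_linkGroup, linksAt_linkGroup s π h]
      exact (inGroup_linked hH).2
    · refine ⟨none, s (some 0), ?_⟩
      rw [strands, if_pos rfl, if_neg h]
      cases flipped s π
      · exact Or.inl (Or.inl ⟨[.a none], [], rfl⟩)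
      · exact Or.inr (Or.inl ⟨[], [.b none], rfl⟩)
  · intro i
    have h := linked_of_inGroup s π (hends (i - 1)).1
    rwa [arm_low hH, Nat.cast_one, sub_add_cancel] at h
  · intro i
    have h := linked_of_inGroup s π (hends (i - inner H (H - 1))).2.2.1
    rwa [arm_low hin.2, sub_add_cancel] at h
  · intro i
    have h := linked_of_inGroup s π (hends (i + inner H (H - 1))).2.1
    rwa [arm_high hin.2, add_sub_cancel_right] at h
  · intro i
    by_cases h : π none = true ∧ i + H = linkGroup H (s (some 0))
    · refine ⟨none, s (some 0), ?_⟩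
      rw [strands, if_pos rfl, if_pos h.1, linked_swapIf]
      have hi : i = ((openAt (s (some 0)) : ℕ) : ZMod (2 * H + 1)) := by
        rw [← linkGroup_sub, ← h.2, add_sub_cancel_right]
      rw [hi, ← arcArm_at]
      right; right
      have hk : ∃ k, 2 * H + 2 - openAt (s (some 0)) = k + 1 := by
        have := openAt_bounds (s (some 0))
        exact ⟨2 * H + 1 - openAt (s (some 0)), by omega⟩
      obtain ⟨k, hk⟩ := hk
      rw [linkedArc, hk, List.range'_succ]
      exact ⟨[], _, rfl⟩
    · have h := linked_of_inGroup s π (inGroup_unlinked (τ := flipped s π) hH (hl (i + H) h)).2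
      rwa [show H + 1 = 2 * H + 1 - H by omega, arm_high le_rfl, add_sub_cancel_right] at h
  · intro i
    by_cases h : π none = true ∧ i - H = linkGroup H (s (some 0))
    · refine ⟨none, s (some 0), ?_⟩
      rw [strands, if_pos rfl, if_pos h.1, linked_swapIf]
      have hi : i = ((openAt (s (some 0)) - 1 : ℕ) : ZMod (2 * H + 1)) := by
        rw [← linkGroup_add, ← h.2, sub_add_cancel]
      rw [hi, ← arcArm_before]
      right; left
      have hk : ∃ k, openAt (s (some 0)) = k + 1 :=
        ⟨openAt (s (some 0)) - 1, by have := openAt_bounds (s (some 0)); omega⟩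
      obtain ⟨k, hk⟩ := hk
      rw [linkedArc, hk, List.range_succ, List.map_append, List.reverse_append]
      exact ⟨[_], _, rfl⟩
    · have h := linked_of_inGroup s π (inGroup_unlinked (τ := flipped s π) hH (hl (i - H) h)).1
      rwa [arm_low le_rfl, sub_add_cancel] at h
  · intro i
    have h := linked_of_inGroup s π (hends (i + H)).2.2.2.1
    rwa [show H + 1 = 2 * H + 1 - H by omega, arm_high le_rfl, add_sub_cancel_right] at h
  · have key : ∀ i : ZMod (2 * H + 1), ∀ d : ℕ, 1 ≤ d → d ≤ H →
        ∃ g ε, Linked (strands s π g ε) (.a (some i)) (.a (some (i + d))) := by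
      intro i d h1 h2
      obtain ⟨g, hg⟩ := exists_inGroup_a hH (outer s π) (linksAt s π) h1 h2 i
      exact linked_of_inGroup s π hg
    exact rel_of_rel_add (R := fun x y => ∃ g ε, Linked (strands s π g ε) x y)
      (f := fun i => .a (some i)) (fun x y ⟨g, ε, h⟩ => ⟨g, ε, h.symm⟩) key
  · refine rel_of_rel_add (R := fun x y => ∃ g ε, Linked (strands s π g ε) x y)
      (f := fun i => .b (some i)) (fun x y ⟨g, ε, h⟩ => ⟨g, ε, h.symm⟩) ?_
    intro i d h1 h2
    obtain ⟨g, hg⟩ := exists_inGroup_b hH (outer s π) (linksAt s π) h1 h2 i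
    exact linked_of_inGroup s π hg.symm
  · intro i j
    have hd : i = j + (((i - j).val : ℕ) : ZMod (2 * H + 1)) := by
      rw [ZMod.natCast_zmod_val]; ring
    have hlt := ZMod.val_lt (i - j)
    generalize (i - j).val = d at hd hlt
    rcases Nat.lt_or_ge d 2 with h1 | h1
    · interval_cases d
      · rw [hd, Nat.cast_zero, add_zero]
        exact linked_of_inGroup s π (hends j).2.2.2.2.2.2
      · obtain ⟨g, ε, h⟩ := linked_arc s π hH (!decide (j.val % 2 = 0)) (ZMod.val_lt j)
        refine ⟨g, ε, ?_⟩
        rw [arcArm_of_ne (by simp), arcArm_of_eq (by rcases Nat.mod_two_eq_zero_or_one j.val with h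
          | h <;> simp [h, Nat.add_mod])] at h
        rw [hd]
        simpa using h.symm
    · by_cases h2 : d + 1 ≤ 2 * H
      · obtain ⟨g, hg⟩ := exists_inGroup_ab (τ := flipped s π) (outer s π) (linksAt s π) h1 h2 j
        rw [hd]
        exact linked_of_inGroup s π hg
      · have hj : j = i + 1 := by
          have h3 : ((d + 1 : ℕ) : ZMod (2 * H + 1)) = 0 := by
            rw [show d + 1 = 2 * H + 1 by omega, ZMod.natCast_self]
          push_cast at h3
          linear_combination -hd - h3
        obtain ⟨g, ε, h⟩ := linked_arc s π hH (decide (i.val % 2 = 0)) (ZMod.val_lt i)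
        refine ⟨g, ε, ?_⟩
        rw [arcArm_of_eq rfl, arcArm_of_ne (by rcases Nat.mod_two_eq_zero_or_one i.val with h | h
          <;> simp [h, Nat.add_mod])] at h
        rw [hj]
        simpa using h

/-- The design for an odd number of indices other than infinity. -/
def design (hH : 1 ≤ H) : LocalDesign (ZMod (2 * H + 1)) where
  own g := some (g.getD 0)
  key g := some (g.getD 0)
  key_eq _ _ := rfl
  activeHasC g := g.isNone
  typ := typ
  strands := strands
  pat := pat
  nodup s π g ε := (goodList_strands s π hH g ε).nodup
  ends_pure _ _ _ _ h := by simp at h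
  ends_own s π g ε _ := by
    cases g with
    | some g =>
      simp only [Option.getD_some, Option.isNone_some, Bool.false_eq_true, iff_false, strands]
      by_cases h : ε = s (some g)
      · rw [if_neg (not_not.2 h), if_pos h]
        exact ends_withC _ _ _ _
      · rw [if_pos h, if_neg h]
        convert ends_withoutC (flipped s π) (outer s π g) g using 1
        simp only [pat, outer, flipped]
        have h2 : ∀ p q : Bool, p = (p == q ^^ !q) := by decide
        exact congrArg (fun b => if b = true then Pattern.cross else Pattern.turn) (h2 _ _)
    | none =>
      simp only [Option.getD_none, Option.isNone_none, iff_true, strands]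
      by_cases h : ε = s (some 0)
      · rw [if_pos h, if_pos h]
        by_cases hp : π none = true
        · simp only [pat, if_pos hp, ← h]
          exact ends_linkedArc hH _ _
        · simp only [pat, if_neg hp]
          exact ends_wholeArc _ _
      · rw [if_neg h, if_neg h]
        exact ends_wholeArc _ _
  mem_a s π g ε i h := (goodList_strands s π hH g ε).mem_a i fun h' => h (by rw [h'])
  mem_b s π g ε i h := (goodList_strands s π hH g ε).mem_b i fun h' => h (by rw [h'])
  mem_c s π g ε := (goodList_strands s π hH g ε).mem_c
  cover s π := cover s π hH
  pat_congr s π π' i h := by simp only [pat, h]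
  pat_ne s π g _ := by
    cases g with
    | some g => simp [pat]
    | none => simp only [pat, flipped]; simp; split_ifs <;> simp

end OddOrder

/-! ### Local designs given by tables -/

instance {α : Type*} [DecidableEq α] (l : List α) (x y : α) : Decidable (EndPair l x y) :=
  inferInstanceAs (Decidable (_ ∨ _))

instance {α : Type*} [DecidableEq α] (p : List α × List α) (x y : α) : Decidable (Linked p x y) :=
  inferInstanceAs (Decidable ((_ ∨ _) ∨ (_ ∨ _)))

instance {I : Type*} [DecidableEq I] (k : Option I) (p : List (Arm I) × List (Arm I))
    (P : Pattern) : Decidable (P.Ends k p) := by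
  cases P <;> exact inferInstanceAs (Decidable (_ ∧ _))

instance {I : Type*} [DecidableEq I] [Fintype I] (k : I) (t : I → Bool) (q : Prop) [Decidable q]
    (l : List (Arm I)) : Decidable (GoodList k t q l) :=
  decidable_of_iff (l.Nodup ∧ (∀ i, i ≠ k → (.a (some i) ∈ l ↔ t i = true)) ∧
    (∀ i, i ≠ k → (.b (some i) ∈ l ↔ t i = false)) ∧ (.c ∈ l ↔ q))
    ⟨fun h => ⟨h.1, h.2.1, h.2.2.1, h.2.2.2⟩, fun h => ⟨h.1, h.2, h.3, h.4⟩⟩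

/-- The edges at infinity are exchanged. -/
def Arm.exchange {I : Type*} : Arm I → Arm I
  | .a none => .b none
  | .b none => .a none
  | x => x

/-- The edges are numbered `c, a_∞, b_∞, a_0, b_0, a_1, b_1, …`. -/
def decodeArm (k : ℕ) : ℕ → Arm (Fin (k + 2))
  | 0 => .c
  | 1 => .a none
  | 2 => .b none
  | m + 3 => if m % 2 = 0 then .a (some (Fin.ofNat (k + 2) (m / 2)))
    else .b (some (Fin.ofNat (k + 2) (m / 2)))

section Table

variable {h : ℕ}

/-- The two strands with the edges at infinity exchanged, if `τ` holds. -/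
def exchangeIf (τ : Bool) (p : List (Arm (Fin h)) × List (Arm (Fin h))) :
    List (Arm (Fin h)) × List (Arm (Fin h)) :=
  if τ = true then
    let q := (p.1.map Arm.exchange, p.2.map Arm.exchange)
    if .a none ∈ q.1 then q else q.swap
  else p

/-- The pattern of two strands the first of which contains `a_∞`. -/
def patternOf (k : Fin h) (p : List (Arm (Fin h)) × List (Arm (Fin h))) : Pattern :=
  if .b none ∈ p.1 then .straight else if .b (some k) ∈ p.1 then .cross else .turn

/-- A local design given by tables. The colours of the groups `none`, `some 0` and, if `two` holds,
`some 1` depend on each other. By the symmetry that exchanges `a_∞` and `b_∞`, only the strands for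
`π (some i) = false` have to be listed, for the groups `none` and `some 1` those for
`π (some 0) = false`. The last argument of the tables decides between the colour with `c` and the
other one. -/
structure Table (k : ℕ) where
  two : Bool
  single : Fin (k + 2) → Bool → Bool → List (Arm (Fin (k + 2))) × List (Arm (Fin (k + 2)))
  joint : Bool → Bool → Bool → Bool → Option (Fin (k + 2)) → Bool →
    List (Arm (Fin (k + 2))) × List (Arm (Fin (k + 2)))

namespace Table

variable {k : ℕ} (T : Table k)

/-- The groups with a common table. -/
def special : Option (Fin (k + 2)) → Bool
  | none => true
  | some i => decide (i = 0) || (T.two && decide (i = 1))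

/-- The strands of the colour `(some i, ε)` if the group `some i` has a table of its own; `s` and
`π` are its role and its choice. -/
def singleStrands (i : Fin (k + 2)) (s π ε : Bool) :
    List (Arm (Fin (k + 2))) × List (Arm (Fin (k + 2))) :=
  exchangeIf π (T.single i s (ε == s))

/-- The role that belongs to the group `g` of the common table; the group `none` shares the one of
`some 0`. -/
def role (s₀ s₁ : Bool) (g : Option (Fin (k + 2))) : Bool := if g = some 1 then s₁ else s₀

/-- The strands of the colour `(g, ε)` of the common table. If `π₀` holds, `a_∞` and `b_∞` are
exchanged in all the groups of this table. -/
def jointStrands (s₀ s₁ π₀ π₁ πn : Bool) (g : Option (Fin (k + 2))) (ε : Bool) :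
    List (Arm (Fin (k + 2))) × List (Arm (Fin (k + 2))) :=
  exchangeIf π₀ (T.joint s₀ s₁ (π₀ ^^ π₁) πn g (ε == role s₀ s₁ g))

/-- The pattern of the active colour, the one without `c`, of a group with a table of its own. -/
def singlePattern (i : Fin (k + 2)) (s π : Bool) : Pattern :=
  patternOf i (T.singleStrands i s π !s)

/-- The pattern of the active colour of a group of the common table. The colour with `c` is the
active one in the group `none`, the colour without `c` in the others. -/
def jointPattern (s₀ s₁ π₀ π₁ πn : Bool) (g : Option (Fin (k + 2))) : Pattern :=
  patternOf (g.getD 0) (T.jointStrands s₀ s₁ π₀ π₁ πn g (role s₀ s₁ g ^^ g.isSome))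

/-- The indices that a colour passes through edges `a i`, read off from one of its states. -/
def types (g : Option (Fin (k + 2))) (ε : Bool) (i : Fin (k + 2)) : Bool :=
  let p := if T.special g = true then T.jointStrands false false false false false g ε else
    T.singleStrands (g.getD 0) false false ε
  decide (.a (some i) ∈ p.1 ++ p.2)

/-- In every state the pair is consecutive in a colour of one and the same group, or of the groups
with a common table. -/
def Covers (x y : Arm (Fin (k + 2))) : Prop :=
  (∃ i, T.special (some i) = false ∧ ∀ s π, ∃ ε, Linked (T.singleStrands i s π ε) x y) ∨
    ∀ s₀ s₁ π₀ π₁ πn, (s₁ = true → T.two = true) → (π₁ = true → T.two = true) →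
      ∃ g, T.special g = true ∧ ∃ ε, Linked (T.jointStrands s₀ s₁ π₀ π₁ πn g ε) x y

instance (x y : Arm (Fin (k + 2))) : Decidable (T.Covers x y) :=
  inferInstanceAs (Decidable (_ ∨ _))

/-- The finitely many conditions that make a table a local design. -/
structure Valid : Prop where
  single : ∀ i, T.special (some i) = false → ∀ s π ε,
    GoodList i (T.types (some i) ε) (ε = s)
      ((T.singleStrands i s π ε).1 ++ (T.singleStrands i s π ε).2) ∧
    (if ε = s then Pattern.straight else T.singlePattern i s π).Ends (some i)
      (T.singleStrands i s π ε)
  joint : ∀ g, T.special g = true → ∀ s₀ s₁ π₀ π₁ πn, (s₁ = true → T.two = true) →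
    (π₁ = true → T.two = true) → ∀ ε,
    GoodList (g.getD 0) (T.types g ε) (ε = role s₀ s₁ g)
      ((T.jointStrands s₀ s₁ π₀ π₁ πn g ε).1 ++ (T.jointStrands s₀ s₁ π₀ π₁ πn g ε).2) ∧
    (if ε = (role s₀ s₁ g ^^ g.isSome) then T.jointPattern s₀ s₁ π₀ π₁ πn g else .straight).Ends
      (some (g.getD 0)) (T.jointStrands s₀ s₁ π₀ π₁ πn g ε)
  cover : ∀ m < 2 * k + 7, ∀ m' < m, T.Covers (decodeArm k m) (decodeArm k m')
  single_ne : ∀ i, T.special (some i) = false → ∀ s,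
    T.singlePattern i s true ≠ T.singlePattern i s false
  joint_ne : ∀ s₀ s₁ π₀ π₁ πn, (s₁ = true → T.two = true) → (π₁ = true → T.two = true) →
    T.jointPattern s₀ s₁ π₀ π₁ true none ≠ T.jointPattern s₀ s₁ π₀ π₁ false none ∧
    T.jointPattern s₀ s₁ true π₁ πn (some 0) ≠ T.jointPattern s₀ s₁ false π₁ πn (some 0) ∧
    (T.two = true →
      T.jointPattern s₀ s₁ π₀ true πn (some 1) ≠ T.jointPattern s₀ s₁ π₀ false πn (some 1))
  joint_congr : ∀ s₀ s₁ π₀ π₁ πn, (s₁ = true → T.two = true) → (π₁ = true → T.two = true) →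
    T.jointPattern s₀ s₁ π₀ π₁ πn (some 0) = T.jointPattern s₀ s₁ π₀ false false (some 0) ∧
    (T.two = true →
      T.jointPattern s₀ s₁ π₀ π₁ πn (some 1) = T.jointPattern s₀ s₁ false π₁ false (some 1))

end Table

/-- The strands in row `m` of a table. -/
def decodeRow (k : ℕ) (t : List (List ℕ × List ℕ)) (m : ℕ) :
    List (Arm (Fin (k + 2))) × List (Arm (Fin (k + 2))) :=
  let p := t.getD m ([], [])
  (p.1.map (decodeArm k), p.2.map (decodeArm k))

/-- The table with the given rows. There are two rows for each group and each of its states, the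
first for the colour with `c`. The states of the common table are numbered in binary, with the role
of `some 0` as the last digit; the rows of a state list the groups in the order `some 0`, `some 1`,
`none`. -/
def Table.ofRows (k : ℕ) (two : Bool) (single joint : List (List ℕ × List ℕ)) : Table k where
  two := two
  single i s hasC := decodeRow k single
    (4 * (i.val - (1 + two.toNat)) + 2 * s.toNat + (!hasC).toNat)
  joint s₀ s₁ o p g hasC :=
    let n := if two = true then s₀.toNat + 2 * s₁.toNat + 4 * o.toNat + 8 * p.toNat else
      s₀.toNat + 2 * p.toNat
    let m := if g = none then 1 + two.toNat else if g = some 0 then 0 else 1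
    decodeRow k joint ((4 + 2 * two.toNat) * n + 2 * m + (!hasC).toNat)

/-- The table for two indices. -/
def tableTwo : Table 0 := .ofRows 0 true
  []
  [([1, 2], [3, 0, 5, 4]), ([1, 6, 4], [2, 3]), ([1, 4, 0, 2], [5, 6]), ([1, 3, 5], [2, 6]),
   ([1, 0, 6, 3], [2, 4]), ([1, 5, 2], [3, 4]), ([1, 2], [3, 0, 6, 4]), ([1, 3], [2, 5, 4]),
   ([1, 0, 4, 2], [5, 6]), ([1, 5], [2, 3, 6]), ([1, 4], [2, 0, 5, 3]), ([1, 6, 2], [3, 4]),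
   ([1, 2], [3, 5, 0, 4]), ([1, 6, 3], [2, 4]), ([1, 3, 0, 2], [5, 6]), ([1, 4, 5], [2, 6]),
   ([1, 0, 6, 4], [2, 3]), ([1, 5, 2], [3, 4]), ([1, 2], [3, 6, 0, 4]), ([1, 5, 3], [2, 4]),
   ([1, 3, 0, 2], [5, 6]), ([1, 4, 6], [2, 5]), ([1, 0, 5, 4], [2, 3]), ([1, 6, 2], [3, 4]),
   ([1, 2], [3, 0, 5, 4]), ([1, 4], [2, 6, 3]), ([1, 0, 4, 2], [5, 6]), ([1, 6], [2, 3, 5]),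
   ([1, 3], [2, 0, 6, 4]), ([1, 5, 2], [3, 4]), ([1, 2], [3, 0, 6, 4]), ([1, 5, 3], [2, 4]),
   ([1, 4, 0, 2], [5, 6]), ([1, 3, 6], [2, 5]), ([1, 0, 5, 4], [2, 3]), ([1, 6, 2], [3, 4]),
   ([1, 2], [3, 5, 0, 4]), ([1, 3], [2, 6, 4]), ([1, 0, 3, 2], [5, 6]), ([1, 6], [2, 4, 5]),
   ([1, 4], [2, 0, 6, 3]), ([1, 5, 2], [3, 4]), ([1, 2], [3, 6, 0, 4]), ([1, 3], [2, 5, 4]),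
   ([1, 0, 3, 2], [5, 6]), ([1, 5], [2, 4, 6]), ([1, 4], [2, 0, 5, 3]), ([1, 6, 2], [3, 4]),
   ([1, 2], [3, 0, 5, 4]), ([1, 6, 4], [2, 3]), ([1, 0, 4, 2], [5, 6]), ([1, 3, 5], [2, 6]),
   ([1, 4], [2, 0, 6, 3]), ([1, 5, 2], [3, 4]), ([1, 2], [3, 0, 6, 4]), ([1, 3], [2, 5, 4]),
   ([1, 4, 0, 2], [5, 6]), ([1, 5], [2, 3, 6]), ([1, 0, 5, 3], [2, 4]), ([1, 6, 2], [3, 4]),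
   ([1, 2], [3, 5, 0, 4]), ([1, 6, 3], [2, 4]), ([1, 0, 3, 2], [5, 6]), ([1, 4, 5], [2, 6]),
   ([1, 3], [2, 0, 6, 4]), ([1, 5, 2], [3, 4]), ([1, 2], [3, 6, 0, 4]), ([1, 5, 3], [2, 4]),
   ([1, 0, 3, 2], [5, 6]), ([1, 4, 6], [2, 5]), ([1, 3], [2, 0, 5, 4]), ([1, 6, 2], [3, 4]),
   ([1, 5, 0, 2], [3, 4]), ([1, 6, 4], [2, 3]), ([1, 0, 4, 2], [5, 6]), ([1, 3, 6], [2, 5]),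
   ([1, 4], [2, 6, 0, 3]), ([1, 2], [3, 5, 4]), ([1, 0, 6, 2], [3, 4]), ([1, 3], [2, 5, 4]),
   ([1, 4, 0, 2], [5, 6]), ([1, 6], [2, 3, 5]), ([1, 5, 0, 3], [2, 4]), ([1, 2], [3, 6, 4]),
   ([1, 5, 0, 2], [3, 4]), ([1, 6, 3], [2, 4]), ([1, 0, 3, 2], [5, 6]), ([1, 4, 6], [2, 5]),
   ([1, 3], [2, 6, 0, 4]), ([1, 2], [3, 5, 4]), ([1, 6, 0, 2], [3, 4]), ([1, 5, 3], [2, 4]),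
   ([1, 0, 3, 2], [5, 6]), ([1, 4, 5], [2, 6]), ([1, 3], [2, 5, 0, 4]), ([1, 2], [3, 6, 4])]

/-- The table for four indices. -/
def tableFour : Table 2 := .ofRows 2 true
  [([1, 10, 0, 3, 5, 2], [7, 8]), ([1, 5, 7], [2, 10, 3, 8]), ([1, 10, 0, 3, 5, 2], [7, 8]),
   ([1, 5, 7], [2, 10, 3, 8]), ([1, 4, 0, 5, 8, 2], [9, 10]), ([1, 8, 9], [2, 4, 5, 10]),
   ([1, 8, 5, 0, 4, 2], [9, 10]), ([1, 4, 5, 10], [2, 8, 9])]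
  [([1, 6, 0, 7, 9, 2], [3, 4]), ([1, 9, 6, 8, 4], [2, 3]), ([1, 0, 9, 3, 7, 2], [5, 6]),
   ([1, 7, 4, 9, 5], [2, 6]), ([1, 3], [2, 0, 8, 10, 6, 4]), ([1, 2], [3, 6, 7, 10, 4]),
   ([1, 9, 6, 8, 0, 2], [3, 4]), ([1, 6, 7, 9, 4], [2, 3]), ([1, 3, 9, 0, 7, 2], [5, 6]),
   ([1, 7, 4, 6], [2, 9, 5]), ([1, 0, 6, 2], [3, 7, 10, 4]), ([1, 2], [3, 6, 10, 8, 4]),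
   ([1, 7, 2], [3, 9, 0, 6, 4]), ([1, 3], [2, 9, 6, 8, 4]), ([1, 9, 4, 7, 0, 2], [5, 6]),
   ([1, 6], [2, 3, 7, 9, 5]), ([1, 0, 8, 10, 6, 2], [3, 4]), ([1, 2], [3, 6, 7, 10, 4]),
   ([1, 6, 2], [3, 9, 0, 8, 4]), ([1, 7, 9, 6, 4], [2, 3]), ([1, 9, 4, 7, 0, 2], [5, 6]),
   ([1, 3, 7, 6], [2, 9, 5]), ([1, 0, 6, 10, 7, 2], [3, 4]), ([1, 2], [3, 6, 8, 10, 4]),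
   ([1, 0, 2], [3, 9, 7, 6, 4]), ([1, 9, 6, 8, 4], [2, 3]), ([1, 3, 7, 0, 9, 2], [5, 6]),
   ([1, 6], [2, 7, 4, 9, 5]), ([1, 2], [3, 6, 0, 8, 10, 4]), ([1, 7, 10, 6, 2], [3, 4]),
   ([1, 6, 8, 0, 9, 2], [3, 4]), ([1, 9, 6, 4], [2, 7, 3]), ([1, 3, 9, 7, 0, 2], [5, 6]),
   ([1, 7, 4, 9, 5], [2, 6]), ([1, 0, 6, 7, 10, 4], [2, 3]), ([1, 2], [3, 6, 10, 8, 4]),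
   ([1, 2], [3, 9, 7, 0, 6, 4]), ([1, 3], [2, 9, 6, 8, 4]), ([1, 0, 9, 4, 7, 2], [5, 6]),
   ([1, 9, 5], [2, 3, 7, 6]), ([1, 6, 3], [2, 0, 8, 10, 4]), ([1, 7, 10, 6, 2], [3, 4]),
   ([1, 0, 8, 6, 9, 2], [3, 4]), ([1, 6, 4], [2, 7, 9, 3]), ([1, 7, 4, 9, 0, 2], [5, 6]),
   ([1, 9, 5], [2, 3, 7, 6]), ([1, 3], [2, 6, 0, 7, 10, 4]), ([1, 2], [3, 6, 10, 8, 4]),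
   ([1, 0, 9, 2], [3, 7, 6, 4]), ([1, 9, 6, 8, 4], [2, 3]), ([1, 3, 9, 7, 0, 2], [5, 6]),
   ([1, 7, 4, 9, 5], [2, 6]), ([1, 2], [3, 6, 0, 8, 10, 4]), ([1, 6, 10, 7, 2], [3, 4]),
   ([1, 9, 6, 8, 0, 2], [3, 4]), ([1, 6, 7, 9, 4], [2, 3]), ([1, 0, 9, 3, 7, 2], [5, 6]),
   ([1, 7, 4, 6], [2, 9, 5]), ([1, 3], [2, 6, 0, 7, 10, 4]), ([1, 2], [3, 6, 10, 8, 4]),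
   ([1, 7, 9, 0, 6, 2], [3, 4]), ([1, 3], [2, 9, 6, 8, 4]), ([1, 9, 4, 7, 0, 2], [5, 6]),
   ([1, 6], [2, 7, 3, 9, 5]), ([1, 0, 8, 10, 6, 4], [2, 3]), ([1, 2], [3, 6, 7, 10, 4]),
   ([1, 9, 0, 8, 6, 2], [3, 4]), ([1, 7, 9, 6, 4], [2, 3]), ([1, 0, 7, 4, 9, 2], [5, 6]),
   ([1, 6], [2, 7, 3, 9, 5]), ([1, 3], [2, 0, 6, 7, 10, 4]), ([1, 2], [3, 6, 10, 8, 4]),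
   ([1, 7, 9, 0, 6, 2], [3, 4]), ([1, 9, 6, 8, 4], [2, 3]), ([1, 0, 7, 3, 9, 2], [5, 6]),
   ([1, 6], [2, 7, 4, 9, 5]), ([1, 3], [2, 0, 8, 10, 6, 4]), ([1, 2], [3, 6, 7, 10, 4]),
   ([1, 0, 8, 6, 9, 2], [3, 4]), ([1, 6, 7, 9, 4], [2, 3]), ([1, 7, 3, 9, 0, 2], [5, 6]),
   ([1, 9, 5], [2, 7, 4, 6]), ([1, 3], [2, 6, 0, 7, 10, 4]), ([1, 2], [3, 6, 10, 8, 4]),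
   ([1, 6, 0, 9, 7, 2], [3, 4]), ([1, 3], [2, 9, 6, 8, 4]), ([1, 9, 4, 7, 0, 2], [5, 6]),
   ([1, 7, 3, 9, 5], [2, 6]), ([1, 0, 8, 10, 6, 4], [2, 3]), ([1, 2], [3, 6, 7, 10, 4]),
   ([1, 6, 8, 0, 9, 2], [3, 4]), ([1, 7, 9, 6, 4], [2, 3]), ([1, 9, 4, 7, 0, 2], [5, 6]),
   ([1, 3, 9, 5], [2, 7, 6]), ([1, 0, 6, 2], [3, 7, 10, 4]), ([1, 2], [3, 6, 10, 8, 4])]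

/-- The table for six indices. -/
def tableSix : Table 4 := .ofRows 4 false
  [([1, 13, 0, 8, 11, 10, 4, 2], [5, 6]), ([1, 4, 5], [2, 13, 10, 12, 8, 6]),
   ([1, 13, 0, 8, 12, 10, 4, 2], [5, 6]), ([1, 4, 5], [2, 13, 10, 11, 8, 6]),
   ([1, 9, 4, 0, 5, 11, 14, 2], [7, 8]), ([1, 14, 12, 4, 7], [2, 9, 5, 8]),
   ([1, 9, 5, 0, 4, 12, 14, 2], [7, 8]), ([1, 14, 11, 5, 8], [2, 9, 4, 7]),
   ([1, 5, 13, 3, 11, 0, 7, 2], [9, 10]), ([1, 7, 13, 4, 11, 9], [2, 5, 10]),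
   ([1, 7, 0, 11, 4, 13, 5, 2], [9, 10]), ([1, 5, 10], [2, 7, 13, 3, 11, 9]),
   ([1, 6, 0, 9, 13, 8, 3, 2], [11, 12]), ([1, 3, 7, 14, 9, 12], [2, 6, 11]),
   ([1, 3, 7, 14, 9, 0, 6, 2], [11, 12]), ([1, 6, 11], [2, 3, 8, 13, 9, 12]),
   ([1, 11, 7, 5, 3, 0, 10, 2], [13, 14]), ([1, 10, 7, 6, 3, 14], [2, 11, 13]),
   ([1, 10, 0, 3, 6, 7, 11, 2], [13, 14]), ([1, 11, 13], [2, 10, 7, 5, 3, 14])]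
  [([1, 12, 6, 10, 8, 14, 0, 2], [3, 4]), ([1, 8, 9, 3], [2, 12, 13, 6, 4]),
   ([1, 0, 12, 5, 14, 10, 3], [2, 8, 4]), ([1, 2], [3, 12, 7, 9, 6, 14, 4]),
   ([1, 0, 2], [3, 12, 13, 6, 9, 8, 4]), ([1, 8, 14, 4], [2, 12, 6, 10, 3]),
   ([1, 2], [3, 9, 7, 12, 0, 14, 6, 4]), ([1, 12, 5, 14, 10, 8, 2], [3, 4]),
   ([1, 0, 12, 6, 10, 14, 8, 2], [3, 4]), ([1, 8, 9, 3], [2, 12, 13, 6, 4]),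
   ([1, 12, 5, 14, 0, 2], [3, 10, 8, 4]), ([1, 2], [3, 12, 7, 9, 6, 14, 4]),
   ([1, 0, 12, 13, 6, 9, 8, 2], [3, 4]), ([1, 8, 14, 4], [2, 12, 6, 10, 3]),
   ([1, 12, 7, 9, 3], [2, 0, 14, 6, 4]), ([1, 2], [3, 12, 5, 14, 10, 8, 4])]

/-- The table for eight indices. -/
def tableEight : Table 6 := .ofRows 6 false
  [([1, 14, 10, 16, 12, 4, 8, 0, 17, 2], [5, 6]), ([1, 17, 12, 8, 10, 4, 16, 6], [2, 14, 5]),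
   ([1, 14, 10, 16, 12, 4, 8, 0, 17, 2], [5, 6]), ([1, 17, 12, 8, 10, 4, 16, 6], [2, 14, 5]),
   ([1, 16, 0, 4, 11, 14, 9, 5, 18, 2], [7, 8]), ([1, 18, 9, 4, 5, 13, 11, 8], [2, 16, 7]),
   ([1, 16, 0, 4, 11, 13, 5, 9, 18, 2], [7, 8]), ([1, 18, 5, 4, 9, 14, 11, 8], [2, 16, 7]),
   ([1, 8, 16, 5, 0, 14, 18, 12, 3, 2], [9, 10]), ([1, 3, 11, 17, 14, 16, 9], [2, 8, 5, 10]),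
   ([1, 8, 16, 5, 0, 14, 17, 11, 3, 2], [9, 10]), ([1, 3, 12, 18, 14, 16, 9], [2, 8, 5, 10]),
   ([1, 6, 10, 3, 16, 13, 18, 0, 7, 2], [11, 12]), ([1, 7, 18, 11], [2, 6, 15, 9, 3, 13, 12]),
   ([1, 7, 0, 18, 13, 3, 9, 15, 6, 2], [11, 12]), ([1, 6, 10, 3, 16, 13, 12], [2, 7, 18, 11]),
   ([1, 11, 7, 4, 6, 18, 15, 0, 9, 2], [13, 14]), ([1, 9, 13], [2, 11, 5, 17, 8, 3, 15, 14]),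
   ([1, 11, 5, 17, 8, 3, 15, 0, 9, 2], [13, 14]), ([1, 9, 13], [2, 11, 7, 4, 6, 18, 15, 14]),
   ([1, 4, 18, 8, 14, 6, 0, 12, 10, 2], [15, 16]), ([1, 10, 18, 16], [2, 4, 14, 12, 6, 8, 15]),
   ([1, 10, 12, 0, 6, 14, 8, 18, 4, 2], [15, 16]), ([1, 4, 14, 12, 6, 8, 15], [2, 10, 18, 16]),
   ([1, 12, 9, 7, 3, 0, 13, 15, 5, 2], [17, 18]), ([1, 5, 3, 18], [2, 12, 7, 15, 10, 13, 17]),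
   ([1, 5, 15, 10, 13, 0, 3, 7, 12, 2], [17, 18]), ([1, 12, 9, 7, 15, 13, 17], [2, 5, 3, 18])]
  [([1, 15, 17, 7, 13, 6, 11, 10, 0, 2], [3, 4]), ([1, 13, 4], [2, 15, 12, 5, 7, 10, 17, 3]),
   ([1, 0, 11, 16, 17, 4], [2, 13, 8, 9, 6, 3]), ([1, 2], [3, 14, 7, 6, 17, 9, 11, 15, 4]),
   ([1, 0, 10, 17, 15, 12, 5, 7, 13, 2], [3, 4]), ([1, 13, 4], [2, 15, 11, 10, 7, 6, 17, 3]),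
   ([1, 15, 4], [2, 0, 11, 6, 9, 17, 7, 14, 3]), ([1, 2], [3, 6, 13, 8, 9, 11, 16, 17, 4]),
   ([1, 15, 11, 10, 0, 2], [3, 6, 13, 7, 17, 4]), ([1, 13, 4], [2, 15, 12, 5, 7, 10, 17, 3]),
   ([1, 0, 11, 16, 17, 6, 9, 8, 13, 2], [3, 4]), ([1, 2], [3, 14, 7, 6, 11, 9, 17, 15, 4]),
   ([1, 13, 7, 5, 12, 15, 17, 10, 0, 2], [3, 4]), ([1, 15, 4], [2, 13, 6, 11, 10, 7, 17, 3]),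
   ([1, 0, 11, 15, 2], [3, 14, 7, 6, 9, 17, 4]), ([1, 2], [3, 6, 17, 16, 11, 9, 8, 13, 4])]

end Table

/-! ### The local designs for few indices -/

namespace Table

variable {k : ℕ} {T : Table k}

theorem exists_decodeArm (x : Arm (Fin (k + 2))) : ∃ m < 2 * k + 7, decodeArm k m = x := by
  rcases x with (_ | i) | (_ | i) | _
  · exact ⟨1, by omega, rfl⟩
  · refine ⟨2 * i.val + 3, by omega, ?_⟩
    simp [decodeArm]
  · exact ⟨2, by omega, rfl⟩
  · refine ⟨2 * i.val + 1 + 3, by omega, ?_⟩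
    have h : (2 * i.val + 1) / 2 = i.val := by omega
    simp [decodeArm, Nat.add_mod, h]
  · exact ⟨0, by omega, rfl⟩

theorem Covers.symm {x y : Arm (Fin (k + 2))} (h : T.Covers x y) : T.Covers y x := by
  rcases h with ⟨i, hi, h⟩ | h
  · exact Or.inl ⟨i, hi, fun s π => (h s π).imp fun ε h => h.symm⟩
  · refine Or.inr fun s₀ s₁ π₀ π₁ πn h₁ h₂ => ?_
    obtain ⟨g, hg, ε, h⟩ := h s₀ s₁ π₀ π₁ πn h₁ h₂
    exact ⟨g, hg, ε, h.symm⟩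

theorem Valid.covers (hT : T.Valid) {x y : Arm (Fin (k + 2))} (hxy : x ≠ y) : T.Covers x y := by
  obtain ⟨m, hm, rfl⟩ := exists_decodeArm x
  obtain ⟨m', hm', rfl⟩ := exists_decodeArm y
  rcases lt_trichotomy m m' with h | rfl | h
  · exact (hT.cover m' hm' m h).symm
  · exact absurd rfl hxy
  · exact hT.cover m hm m' h

variable (T)

/-- The strands of the colour `(g, ε)` in a state. -/
def strands (s π : Option (Fin (k + 2)) → Bool) (g : Option (Fin (k + 2))) (ε : Bool) :
    List (Arm (Fin (k + 2))) × List (Arm (Fin (k + 2))) :=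
  if T.special g = true then
    T.jointStrands (s (some 0)) (T.two && s (some 1)) (π (some 0)) (T.two && π (some 1))
      (π none) g ε
  else T.singleStrands (g.getD 0) (s g) (π g) ε

/-- The pattern of the active colour of the group `g` in a state. -/
def pat (s π : Option (Fin (k + 2)) → Bool) (g : Option (Fin (k + 2))) : Pattern :=
  if T.special g = true then
    T.jointPattern (s (some 0)) (T.two && s (some 1)) (π (some 0)) (T.two && π (some 1)) (π none) g
  else T.singlePattern (g.getD 0) (s g) (π g)

variable {T}

theorem special_cases {g : Option (Fin (k + 2))} (h : T.special g = true) :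
    g = none ∨ g = some 0 ∨ g = some 1 ∧ T.two = true := by
  cases g with
  | none => exact Or.inl rfl
  | some i => simpa [special, and_comm] using h

theorem role_eq {s : Option (Fin (k + 2)) → Bool} {g : Option (Fin (k + 2))}
    (h : T.special g = true) :
    role (s (some 0)) (T.two && s (some 1)) g = s (some (g.getD 0)) := by
  rcases special_cases h with rfl | rfl | ⟨rfl, h2⟩
  · simp [role]
  · simp [role]
  · simp [role, h2]

theorem Valid.strands (hT : T.Valid) (s π : Option (Fin (k + 2)) → Bool)
    (g : Option (Fin (k + 2))) (ε : Bool) :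
    GoodList (g.getD 0) (T.types g ε) (ε = s (some (g.getD 0)))
      ((T.strands s π g ε).1 ++ (T.strands s π g ε).2) ∧
    (if (ε = s (some (g.getD 0)) ↔ g.isNone = true) then T.pat s π g else .straight).Ends
      (some (g.getD 0)) (T.strands s π g ε) := by
  by_cases h : T.special g = true
  · have h1 := hT.joint g h (s (some 0)) (T.two && s (some 1)) (π (some 0)) (T.two && π (some 1))
      (π none) (by simp +contextual) (by simp +contextual) ε
    rw [role_eq h] at h1
    simp only [Table.strands, Table.pat, if_pos h]
    refine ⟨h1.1, ?_⟩
    convert h1.2 using 2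
    cases g <;> cases ε <;> cases s (some _) <;> simp
  · cases g with
    | none => exact absurd rfl h
    | some i =>
      have h1 := hT.single i (by simpa using h) (s (some i)) (π (some i)) ε
      simp only [Table.strands, Table.pat, if_neg h, Option.getD_some]
      refine ⟨h1.1, ?_⟩
      by_cases h2 : ε = s (some i)
      · simpa [h2] using h1.2
      · simpa [h2] using h1.2

/-- The local design given by a table. -/
def Valid.design (hT : T.Valid) : LocalDesign (Fin (k + 2)) where
  own g := some (g.getD 0)
  key g := some (g.getD 0)
  key_eq _ _ := rfl
  activeHasC g := g.isNone
  typ := T.types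
  strands := T.strands
  pat := T.pat
  nodup s π g ε := (hT.strands s π g ε).1.nodup
  ends_pure _ _ _ _ h := by simp at h
  ends_own s π g ε _ := (hT.strands s π g ε).2
  mem_a s π g ε i h := (hT.strands s π g ε).1.mem_a i fun h' => h (by rw [h'])
  mem_b s π g ε i h := (hT.strands s π g ε).1.mem_b i fun h' => h (by rw [h'])
  mem_c s π g ε := (hT.strands s π g ε).1.mem_c
  cover s π x y hxy := by
    rcases hT.covers hxy with ⟨i, hi, h⟩ | h
    · obtain ⟨ε, h⟩ := h (s (some i)) (π (some i))
      refine ⟨some i, ε, ?_⟩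
      rwa [Table.strands, if_neg (by simp [hi])]
    · obtain ⟨g, hg, ε, h⟩ := h (s (some 0)) (T.two && s (some 1)) (π (some 0))
        (T.two && π (some 1)) (π none) (by simp +contextual) (by simp +contextual)
      refine ⟨g, ε, ?_⟩
      rwa [Table.strands, if_pos hg]
  pat_congr s π π' i h := by
    by_cases hi : T.special (some i) = true
    · have h1 := fun p : Option (Fin (k + 2)) → Bool => hT.joint_congr (s (some 0))
        (T.two && s (some 1)) (p (some 0)) (T.two && p (some 1)) (p none) (by simp +contextual)
        (by simp +contextual)
      simp only [Table.pat, if_pos hi]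
      rcases special_cases hi with h2 | h2 | ⟨h2, h3⟩
      · simp at h2
      · rw [h2] at h ⊢
        rw [(h1 π).1, (h1 π').1, h]
      · rw [h2] at h ⊢
        rw [(h1 π).2 h3, (h1 π').2 h3, h]
    · simp only [Table.pat, if_neg hi, h]
  pat_ne s π g _ := by
    by_cases hg : T.special g = true
    · have h1 := hT.joint_ne (s (some 0)) (T.two && s (some 1)) (π (some 0)) (T.two && π (some 1))
        (π none) (by simp +contextual) (by simp +contextual)
      simp only [Table.pat, if_pos hg]
      rcases special_cases hg with rfl | rfl | ⟨rfl, h3⟩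
      · simpa using h1.1
      · simpa using h1.2.1
      · simpa [h3] using h1.2.2 h3
    · cases g with
      | none => exact absurd rfl hg
      | some i =>
        simp only [Table.pat, if_neg hg]
        simpa using hT.single_ne i (by simpa using hg) (s (some i))

theorem valid_tableTwo : tableTwo.Valid where
  single := by decide +kernel
  joint := by decide +kernel
  cover := by decide +kernel
  single_ne := by decide +kernel
  joint_ne := by decide +kernel
  joint_congr := by decide +kernel

theorem valid_tableFour : tableFour.Valid where
  single := by decide +kernel
  joint := by decide +kernel
  cover := by decide +kernel
  single_ne := by decide +kernel
  joint_ne := by decide +kernel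
  joint_congr := by decide +kernel

theorem valid_tableSix : tableSix.Valid where
  single := by decide +kernel
  joint := by decide +kernel
  cover := by decide +kernel
  single_ne := by decide +kernel
  joint_ne := by decide +kernel
  joint_congr := by decide +kernel

theorem valid_tableEight : tableEight.Valid where
  single := by decide +kernel
  joint := by decide +kernel
  cover := by decide +kernel
  single_ne := by decide +kernel
  joint_ne := by decide +kernel
  joint_congr := by decide +kernel

end Table

/-- The local design without any index other than infinity. -/
def designZero : LocalDesign (Fin 0) where
  own _ := none
  key _ := none
  key_eq _ h := absurd rfl h
  activeHasC _ := true
  typ _ _ _ := true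
  strands s _ _ ε := if ε = s none then ([.a none, .c, .b none], []) else ([.a none, .b none], [])
  pat _ _ _ := .straight
  nodup s _ _ ε := by split_ifs <;> decide
  ends_pure s _ _ ε _ := by split_ifs <;> decide
  ends_own _ _ _ _ h := absurd rfl h
  mem_a _ _ _ _ i := i.elim0
  mem_b _ _ _ _ i := i.elim0
  mem_c s _ _ ε := by split_ifs with h <;> simp [h]
  cover s π x y hxy := by
    refine ⟨none, ?_⟩
    generalize s none = e
    rcases x with (_ | i) | (_ | i) | _ <;> rcases y with (_ | j) | (_ | j) | _ <;>
      first
      | exact i.elim0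
      | exact j.elim0
      | exact absurd rfl hxy
      | (revert e; decide)
  pat_congr _ _ _ i := i.elim0
  pat_ne _ _ _ h := absurd rfl h

/-- The strands for a single index other than infinity, in dependence on the role and the choice of
the group `some 0`. -/
def strandsOne (e p : Bool) : Option (Fin 1) → Bool → List (Arm (Fin 1)) × List (Arm (Fin 1))
  | some _, true =>
    if e = false then ([.a none, .b none], [.a (some 0), .b (some 0)])
    else if p = true then ([.a none, .c, .b (some 0)], [.b none, .a (some 0)])
    else ([.a none, .a (some 0)], [.b none, .c, .b (some 0)])
  | some _, false =>
    if e = true then ([.a none, .b none], [.a (some 0), .b (some 0)])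
    else if p = true then ([.a none, .b (some 0)], [.b none, .c, .a (some 0)])
    else ([.a none, .c, .a (some 0)], [.b none, .b (some 0)])
  | none, true =>
    if e = false then ([.a none, .a (some 0), .b none], [])
    else if p = true then ([.a none, .a (some 0), .c, .b none], [])
    else ([.a none, .c, .a (some 0), .b none], [])
  | none, false =>
    if e = true then ([.a none, .b (some 0), .b none], [])
    else if p = true then ([.a none, .c, .b (some 0), .b none], [])
    else ([.a none, .b (some 0), .c, .b none], [])

/-- The local design with a single index other than infinity. -/
def designOne : LocalDesign (Fin 1) where
  own g := g
  key _ := some 0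
  key_eq g h := by revert h; revert g; decide
  activeHasC _ := true
  typ _ ε _ := ε
  strands s π := strandsOne (s (some 0)) (π (some 0))
  pat _ π _ := if π (some 0) = true then .cross else .turn
  nodup s π := by
    generalize s (some 0) = e; generalize π (some 0) = p; revert e p; decide
  ends_pure s π := by
    generalize s (some 0) = e; generalize π (some 0) = p; revert e p; decide
  ends_own s π := by
    generalize s (some 0) = e; generalize π (some 0) = p; revert e p; decide
  mem_a s π := by
    generalize s (some 0) = e; generalize π (some 0) = p; revert e p; decide
  mem_b s π := by
    generalize s (some 0) = e; generalize π (some 0) = p; revert e p; decide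
  mem_c s π := by
    generalize s (some 0) = e; generalize π (some 0) = p; revert e p; decide
  cover s π x y hxy := by
    generalize s (some 0) = e
    generalize π (some 0) = p
    rcases x with (_ | i) | (_ | i) | _ <;> rcases y with (_ | j) | (_ | j) | _ <;>
      revert hxy e p <;>
      first
      | decide
      | (revert i j; decide)
      | (revert i; decide)
      | (revert j; decide)
  pat_congr _ π π' i h := by rw [Subsingleton.elim i 0] at h; simp only [h]
  pat_ne _ π g h := by
    cases g with
    | none => exact absurd rfl h
    | some i => rw [Subsingleton.elim i 0]; simp

/-! ### Frames -/

/-- The part of a local design that is the same in all states. Both colours of the group `k` have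
the edges `a (p k)` and `b (s k)` and a path from `b (s k)` to `b (q k)`; the edge `c` goes between
`a (p k)` and `b (s k)` in the one colour, and both are joined to an edge with the index `k` in the
other colour, `a (p k)` to `b k` if `side k` holds. The colours of the group `none` have an arc from
`a z` to `b z` that is opened between `a (p k)` and `b (s k)`, where `k` is `link e`.

As in a local design, `typ g e` tells the indices that a colour passes through edges `a i`. In
`cover`, the pairs on the arcs include the one that joins their two parts, at which the arc is
opened. -/
structure Frame (I : Type*) [DecidableEq I] [Fintype I] where
  p : I → I
  s : I → I
  q : I → I
  p_surjective : Function.Surjective p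
  s_surjective : Function.Surjective s
  q_surjective : Function.Surjective q
  side : I → Bool
  path : I → Bool → List (Arm I)
  path_head : ∀ k e, (path k e).head? = some (.b (some (s k)))
  path_last : ∀ k e, (path k e).getLast? = some (.b (some (q k)))
  z : I
  link : Bool → I
  arcA : Bool → List (Arm I)
  arcB : Bool → List (Arm I)
  arcA_head : ∀ e, (arcA e).head? = some (.a (some (p (link e))))
  arcA_last : ∀ e, (arcA e).getLast? = some (.a (some z))
  arcB_head : ∀ e, (arcB e).head? = some (.b (some (s (link e))))
  arcB_last : ∀ e, (arcB e).getLast? = some (.b (some z))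
  typ : Option I → Bool → I → Bool
  path_good : ∀ k e, GoodList k (typ (some k) e) False
    (.a none :: .b none :: .a (some k) :: .b (some k) :: .a (some (p k)) :: path k e)
  arc_good : ∀ e, GoodList z (typ none e) False (.a none :: .b none :: (arcA e ++ arcB e))
  cover : ∀ x y : Arm I, (∃ i, x = .a (some i) ∨ x = .b (some i)) →
    (∃ i, y = .a (some i) ∨ y = .b (some i)) → x ≠ y →
    (∃ k e, [x, y] <:+: path k e ∨ [y, x] <:+: path k e) ∨
    (∃ e, [x, y] <:+: (arcA e).reverse ++ arcB e ∨ [y, x] <:+: (arcA e).reverse ++ arcB e) ∨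
    ∃ k, s(x, y) = s(.a (some k), .b (some k)) ∨
      s(x, y) = s(.a (some (p k)), if side k = true then .b (some k) else .a (some k)) ∨
      s(x, y) = s(.b (some (s k)), if side k = true then .a (some k) else .b (some k))

namespace Frame

variable {I : Type*} [DecidableEq I] [Fintype I] (F : Frame I)

/-- The strands of the colour of the group `k` that has `c`. The order of the edges at infinity is
given by `τ`. If `l` holds, then an arc is linked through this group: the places of `c` and
`a (p k)` are exchanged, so that the pair of `a (p k)` and `b (s k)` is taken over from the arc. -/
def withC (τ l : Bool) (k : I) (e : Bool) : List (Arm I) × List (Arm I) :=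
  ([jay τ] ++ (if l = true then [.c, .a (some (F.p k))] else [.a (some (F.p k)), .c]) ++
    F.path k e ++ [jay !τ], [.a (some k), .b (some k)])

/-- The strands of the colour of the group `k` that has not `c`. -/
def withoutC (τ : Bool) (k : I) (e : Bool) : List (Arm I) × List (Arm I) :=
  ((if F.side k = true then .a (some k) else .b (some k)) :: F.path k e ++ [jay τ],
    [jay !τ, .a (some (F.p k)), if F.side k = true then .b (some k) else .a (some k)])

/-- The strands of the colour `(none, e)` with the opened arc, whose parts are attached to the edges
at infinity, the second one by way of `c`. -/
def openArc (τ e : Bool) : List (Arm I) × List (Arm I) :=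
  (jay τ :: F.arcA e, jay (!τ) :: .c :: F.arcB e)

/-- The strands of the colour `(none, e)` if its arc is one of them; the other one goes from `a_∞`
to `b_∞`, with the list `C` between them. -/
def closedArc (e : Bool) (C : List (Arm I)) : List (Arm I) × List (Arm I) :=
  (.a none :: C ++ [.b none], (F.arcA e).reverse ++ F.arcB e)

/-- Whether an arc is linked through the group `k`. -/
def linksAt (s π : Option I → Bool) (k : I) : Bool :=
  π none && decide (k = F.link (s (some F.z)))

/-- The strands of all colours. -/
def strands (s π : Option I → Bool) : Option I → Bool → List (Arm I) × List (Arm I)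
  | some k, e =>
    if e = s (some k) then F.withC (!π (some k)) (F.linksAt s π k) k e
    else swapIf (!π (some k)) (F.withoutC (!π (some k)) k e)
  | none, e =>
    if e = s (some F.z) then
      if π none = true then swapIf (!π (some (F.link e))) (F.openArc (!π (some (F.link e))) e)
      else F.closedArc e [.c]
    else F.closedArc e []

/-- The patterns of the active colours. In the group `none` the active colour is the one with `c`,
in the others the one without `c`. -/
def pat (s π : Option I → Bool) : Option I → Pattern
  | some k => if π (some k) = F.side k then .turn else .cross
  | none =>
    if π none = true then if π (some (F.link (s (some F.z)))) = true then .turn else .cross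
    else .straight

variable {F}

omit [DecidableEq I] [Fintype I] in
theorem _root_.HamiltonFragments.GoodList.insert_c {k : I} {t : I → Bool} {l l' : List (Arm I)}
    (h : GoodList k t False l) (hl : l'.Perm (.c :: l)) : GoodList k t True l' where
  nodup := hl.nodup_iff.2 (List.nodup_cons.2 ⟨h.mem_c.1, h.nodup⟩)
  mem_a i hi := by rw [hl.mem_iff, ← h.mem_a i hi]; simp
  mem_b i hi := by rw [hl.mem_iff, ← h.mem_b i hi]; simp
  mem_c := by rw [hl.mem_iff]; simp

omit [Fintype I] in
theorem count_jay (τ : Bool) (x : Arm I) :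
    List.count x [jay τ] + List.count x [jay !τ] =
      List.count x [.a none] + List.count x [.b none] := by
  cases τ
  · rfl
  · exact add_comm _ _

theorem withC_good (τ l : Bool) (k : I) (e : Bool) :
    GoodList k (F.typ (some k) e) True ((F.withC τ l k e).1 ++ (F.withC τ l k e).2) := by
  refine (F.path_good k e).insert_c ?_
  rw [List.perm_iff_count]
  intro x
  have h := count_jay τ x
  simp only [List.count_cons, List.count_nil] at h
  cases l <;> simp only [withC, List.count_append, List.count_cons, List.count_nil, if_true,
    Bool.false_eq_true, if_false] <;> omega

theorem withoutC_good (τ : Bool) (k : I) (e : Bool) :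
    GoodList k (F.typ (some k) e) False ((F.withoutC τ k e).1 ++ (F.withoutC τ k e).2) := by
  refine (F.path_good k e).perm ?_
  rw [List.perm_iff_count]
  intro x
  have h := count_jay τ x
  simp only [List.count_cons, List.count_nil] at h
  cases hs : F.side k <;> simp only [withoutC, hs, List.count_append, List.count_cons,
    List.count_nil, if_true, Bool.false_eq_true, if_false] <;> omega

theorem openArc_good (τ e : Bool) :
    GoodList F.z (F.typ none e) True ((F.openArc τ e).1 ++ (F.openArc τ e).2) := by
  refine (F.arc_good e).insert_c ?_
  rw [List.perm_iff_count]
  intro x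
  have h := count_jay τ x
  simp only [List.count_cons, List.count_nil] at h
  simp only [openArc, List.count_append, List.count_cons]
  omega

theorem closedArc_good_c (e : Bool) : GoodList F.z (F.typ none e) True
    ((F.closedArc e [.c]).1 ++ (F.closedArc e [.c]).2) := by
  refine (F.arc_good e).insert_c ?_
  rw [List.perm_iff_count]
  intro x
  simp only [closedArc, List.count_append, List.count_cons, List.count_nil, List.count_reverse]
  omega

theorem closedArc_good (e : Bool) : GoodList F.z (F.typ none e) False
    ((F.closedArc e []).1 ++ (F.closedArc e []).2) := by
  refine (F.arc_good e).perm ?_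
  rw [List.perm_iff_count]
  intro x
  simp only [closedArc, List.count_append, List.count_cons, List.count_nil, List.count_reverse]
  omega

theorem strands_good (s π : Option I → Bool) (g : Option I) (e : Bool) :
    GoodList (g.getD F.z) (F.typ g e) (e = s (some (g.getD F.z)))
      ((F.strands s π g e).1 ++ (F.strands s π g e).2) := by
  cases g with
  | some k =>
    simp only [strands, Option.getD_some]
    split_ifs with h
    · simpa only [h] using withC_good _ _ k _
    · simpa only [h] using (withoutC_good _ k e).perm (swapIf_perm _ _)
  | none =>
    simp only [strands, Option.getD_none]
    split_ifs with h h'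
    · simpa only [h] using (openArc_good _ _).perm (swapIf_perm _ _)
    · simpa only [h] using closedArc_good_c _
    · simpa only [h] using closedArc_good e

theorem withC_ends (τ l : Bool) (k : I) (e : Bool) :
    Pattern.straight.Ends (some k) (F.withC τ l k e) := by
  refine ⟨(atInfinity_jay τ).endPair (Or.inl ⟨?_, ?_⟩), Or.inl ⟨rfl, rfl⟩⟩ <;>
    simp [withC, List.getLast?_cons]

theorem withoutC_ends (τ : Bool) (k : I) (e : Bool) :
    (if (!τ) = F.side k then Pattern.turn else .cross).Ends (some k)
      (swapIf τ (F.withoutC τ k e)) := by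
  cases hs : F.side k <;> cases τ <;>
    simp [withoutC, hs, swapIf, Pattern.Ends, EndPair, jay, List.getLast?_cons]

theorem closedArc_ends (e : Bool) (C : List (Arm I)) :
    Pattern.straight.Ends (some F.z) (F.closedArc e C) := by
  refine ⟨Or.inl ⟨rfl, by simp [closedArc, List.getLast?_cons]⟩, Or.inl ⟨?_, ?_⟩⟩
  · simp [closedArc, List.head?_append, List.head?_reverse, F.arcA_last]
  · simp [closedArc, List.getLast?_append, F.arcB_last]

theorem openArc_ends (τ e : Bool) :
    (if (!τ) = true then Pattern.turn else .cross).Ends (some F.z)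
      (swapIf τ (F.openArc τ e)) := by
  cases τ <;>
    simp [openArc, swapIf, Pattern.Ends, EndPair, jay, List.getLast?_cons, F.arcA_last, F.arcB_last]

/-- The pair is consecutive in a colour of the group `k`. -/
def InGroup (F : Frame I) (s π : Option I → Bool) (k : I) (x y : Arm I) : Prop :=
  Linked (F.withC (!π (some k)) (F.linksAt s π k) k (s (some k))) x y ∨
    Linked (F.withoutC (!π (some k)) k !s (some k)) x y

theorem linked_of_inGroup {s π : Option I → Bool} {k : I} {x y : Arm I}
    (h : F.InGroup s π k x y) : ∃ g e, Linked (F.strands s π g e) x y := by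
  rcases h with h | h
  · exact ⟨some k, s (some k), by rwa [strands, if_pos rfl]⟩
  · exact ⟨some k, !s (some k), by rwa [strands, if_neg (by simp), linked_swapIf]⟩

theorem inGroup_path {s π : Option I → Bool} {k : I} {e : Bool} {x y : Arm I}
    (h : [x, y] <:+: F.path k e) : F.InGroup s π k x y := by
  by_cases he : e = s (some k)
  · left; left; left
    rw [he] at h
    simp only [withC, infix_pair_append]
    tauto
  · right; left; left
    rw [show e = !s (some k) by cases e <;> cases h : s (some k) <;> simp_all] at h
    simp only [withoutC, infix_pair_append, List.cons_append, infix_pair_cons]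
    tauto

theorem inGroup_basic (s π : Option I → Bool) (k : I) :
    F.InGroup s π k (.a (some k)) (.b (some k)) ∧
    F.InGroup s π k (.a (some (F.p k))) (if F.side k = true then .b (some k) else .a (some k)) ∧
    F.InGroup s π k (.b (some (F.s k))) (if F.side k = true then .a (some k) else .b (some k)) ∧
    F.InGroup s π k (.a (some (F.p k))) (jay (π (some k))) ∧
    F.InGroup s π k (.b (some (F.q k))) (jay (π (some k))) ∧
    F.InGroup s π k (.b (some (F.q k))) (jay (!π (some k))) ∧
    F.InGroup s π k (.a (some (F.p k))) .c := by
  cases hl : F.linksAt s π k <;>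
  simp [InGroup, hl, withC, withoutC, Linked, Follows, infix_pair_append, infix_pair_cons,
    F.path_head, F.path_last]

theorem inGroup_unlinked {s π : Option I → Bool} {k : I} (h : F.linksAt s π k = false) :
    F.InGroup s π k (.a (some (F.p k))) (jay (!π (some k))) ∧
    F.InGroup s π k (.b (some (F.s k))) .c := by
  simp [InGroup, h, withC, withoutC, Linked, Follows, infix_pair_append, infix_pair_cons,
    F.path_head, F.path_last]

/-- The pairs that the group gets for those of `inGroup_unlinked` if an arc is linked through it. -/
theorem inGroup_linked {s π : Option I → Bool} {k : I} (h : F.linksAt s π k = true) :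
    F.InGroup s π k .c (jay (!π (some k))) ∧
    F.InGroup s π k (.a (some (F.p k))) (.b (some (F.s k))) := by
  simp [InGroup, h, withC, withoutC, Linked, Follows, infix_pair_append, infix_pair_cons,
    F.path_head, F.path_last]

variable (s π : Option I → Bool)

theorem linksAt_link (h : π none = true) : F.linksAt s π (F.link (s (some F.z))) = true := by
  simp [linksAt, h]

theorem eq_link {k : I} (h : F.linksAt s π k ≠ false) :
    π none = true ∧ k = F.link (s (some F.z)) := by
  simpa [linksAt] using h

theorem linked_arc {e : Bool} {x y : Arm I} (h : [x, y] <:+: (F.arcA e).reverse ++ F.arcB e) :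
    ∃ g ε, Linked (F.strands s π g ε) x y := by
  by_cases he : e = s (some F.z) ∧ π none = true
  · rw [infix_pair_append] at h
    rcases h with h | h | h
    · refine ⟨none, e, ?_⟩
      rw [strands, if_pos he.1, if_pos he.2, linked_swapIf]
      rw [infix_pair_reverse] at h
      right; left
      rw [openArc, infix_pair_cons]
      exact Or.inr h
    · rw [List.getLast?_reverse, F.arcA_head, F.arcB_head, he.1] at h
      have h1 := linked_of_inGroup (inGroup_linked (linksAt_link (F := F) s π he.2)).2
      rwa [Option.some.inj h.1, Option.some.inj h.2] at h1
    · refine ⟨none, e, ?_⟩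
      rw [strands, if_pos he.1, if_pos he.2, linked_swapIf]
      left; right
      rw [openArc, infix_pair_cons, infix_pair_cons]
      exact Or.inr (Or.inr h)
  · refine ⟨none, e, ?_⟩
    have h1 : ∀ C, Linked (F.closedArc e C) x y := fun C => Linked.of_infix_right h
    rw [strands]
    split_ifs with h2 h3
    · exact absurd ⟨h2, h3⟩ he
    · exact h1 _
    · exact h1 _

/-- The pairs that the group through which an arc is linked has given away are found in the opened
arc. -/
theorem linked_openArc (h : π none = true) {x y : Arm I}
    (hxy : Linked (F.openArc (!π (some (F.link (s (some F.z))))) (s (some F.z))) x y) :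
    ∃ g ε, Linked (F.strands s π g ε) x y :=
  ⟨none, s (some F.z), by rwa [strands, if_pos rfl, if_pos h, linked_swapIf]⟩

theorem linked_a_jay (i : I) (τ : Bool) :
    ∃ g ε, Linked (F.strands s π g ε) (.a (some i)) (jay τ) := by
  obtain ⟨k, rfl⟩ := F.p_surjective i
  rcases Bool.eq_or_eq_not τ (π (some k)) with rfl | rfl
  · exact linked_of_inGroup (inGroup_basic s π k).2.2.2.1
  · by_cases h : F.linksAt s π k = false
    · exact linked_of_inGroup (inGroup_unlinked h).1
    · obtain ⟨h1, rfl⟩ := eq_link s π h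
      refine linked_openArc s π h1 (Linked.symm (Linked.of_infix_left ?_))
      rw [openArc, infix_pair_cons]
      exact Or.inl ⟨rfl, F.arcA_head _⟩

theorem linked_c_jay (τ : Bool) : ∃ g ε, Linked (F.strands s π g ε) .c (jay τ) := by
  by_cases h : π none = true
  · rcases Bool.eq_or_eq_not τ (π (some (F.link (s (some F.z))))) with rfl | rfl
    · refine linked_openArc s π h (Linked.symm (Linked.of_infix_right ?_))
      rw [openArc, infix_pair_cons, Bool.not_not]
      exact Or.inl ⟨rfl, rfl⟩
    · exact linked_of_inGroup (inGroup_linked (linksAt_link s π h)).1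
  · refine ⟨none, s (some F.z), ?_⟩
    rw [strands, if_pos rfl, if_neg h]
    cases τ
    · exact Or.inr (Or.inl ⟨[], [.b none], rfl⟩)
    · exact Or.inl (Or.inl ⟨[.a none], [], rfl⟩)

theorem linked_finite {x y : Arm I} (hx : ∃ i, x = .a (some i) ∨ x = .b (some i))
    (hy : ∃ i, y = .a (some i) ∨ y = .b (some i)) (hxy : x ≠ y) :
    ∃ g ε, Linked (F.strands s π g ε) x y := by
  have hsymm : ∀ {x y : Arm I}, (∃ g ε, Linked (F.strands s π g ε) x y) →
      ∃ g ε, Linked (F.strands s π g ε) y x := fun ⟨g, ε, h⟩ => ⟨g, ε, h.symm⟩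
  have key : ∀ {x' y' : Arm I}, s(x, y) = s(x', y') →
      (∃ g ε, Linked (F.strands s π g ε) x' y') → ∃ g ε, Linked (F.strands s π g ε) x y := by
    intro x' y' h h'
    rcases Sym2.eq_iff.1 h with ⟨rfl, rfl⟩ | ⟨rfl, rfl⟩
    · exact h'
    · exact hsymm h'
  rcases F.cover x y hx hy hxy with ⟨k, e, h | h⟩ | ⟨e, h | h⟩ | ⟨k, h | h | h⟩
  · exact linked_of_inGroup (inGroup_path h)
  · exact hsymm (linked_of_inGroup (inGroup_path h))
  · exact linked_arc s π h
  · exact hsymm (linked_arc s π h)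
  · exact key h (linked_of_inGroup (inGroup_basic s π k).1)
  · exact key h (linked_of_inGroup (inGroup_basic s π k).2.1)
  · exact key h (linked_of_inGroup (inGroup_basic s π k).2.2.1)

theorem strands_cover (x y : Arm I) (hxy : x ≠ y) :
    ∃ g ε, Linked (F.strands s π g ε) x y := by
  refine Arm.rel_of_ne (R := fun x y => ∃ g ε, Linked (F.strands s π g ε) x y)
    (fun x y ⟨g, ε, h⟩ => ⟨g, ε, h.symm⟩) (atInfinity_jay false) ?_ (linked_c_jay s π _)
    (linked_c_jay s π _) (fun i => linked_a_jay s π i _) (fun i => linked_a_jay s π i _) ?_ ?_ ?_ ?_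
    (fun i j h => linked_finite s π ⟨i, Or.inl rfl⟩ ⟨j, Or.inl rfl⟩ (by simpa using h))
    (fun i j h => linked_finite s π ⟨i, Or.inr rfl⟩ ⟨j, Or.inr rfl⟩ (by simpa using h))
    (fun i j => linked_finite s π ⟨i, Or.inl rfl⟩ ⟨j, Or.inr rfl⟩ (by simp)) x y hxy
  · refine ⟨none, !s (some F.z), ?_⟩
    rw [strands, if_neg (by simp)]
    exact Linked.of_infix_left (List.infix_refl _)
  · intro i
    obtain ⟨k, rfl⟩ := F.q_surjective i
    rcases Bool.eq_or_eq_not false (π (some k)) with h | h <;> rw [h]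
    · exact linked_of_inGroup (inGroup_basic s π k).2.2.2.2.1
    · exact linked_of_inGroup (inGroup_basic s π k).2.2.2.2.2.1
  · intro i
    obtain ⟨k, rfl⟩ := F.q_surjective i
    rcases Bool.eq_or_eq_not (!false) (π (some k)) with h | h <;> rw [h]
    · exact linked_of_inGroup (inGroup_basic s π k).2.2.2.2.1
    · exact linked_of_inGroup (inGroup_basic s π k).2.2.2.2.2.1
  · intro i
    obtain ⟨k, rfl⟩ := F.p_surjective i
    exact linked_of_inGroup (inGroup_basic s π k).2.2.2.2.2.2
  · intro i
    obtain ⟨k, rfl⟩ := F.s_surjective i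
    by_cases h : F.linksAt s π k = false
    · exact linked_of_inGroup (inGroup_unlinked h).2
    · obtain ⟨h1, rfl⟩ := eq_link s π h
      refine linked_openArc s π h1 (Linked.symm (Linked.of_infix_right ?_))
      rw [openArc, infix_pair_cons, infix_pair_cons]
      exact Or.inr (Or.inl ⟨rfl, F.arcB_head _⟩)

/-- The local design given by a frame. -/
def design (F : Frame I) : LocalDesign I where
  own g := some (g.getD F.z)
  key g := some (g.getD F.z)
  key_eq _ _ := rfl
  activeHasC g := g.isNone
  typ := F.typ
  strands := F.strands
  pat := F.pat
  nodup s π g e := (strands_good s π g e).nodup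
  ends_pure _ _ _ _ h := by simp at h
  ends_own s π g e _ := by
    cases g with
    | some k =>
      simp only [Option.getD_some, Option.isNone_some, Bool.false_eq_true, iff_false, strands]
      by_cases h : e = s (some k)
      · rw [if_neg (not_not.2 h), if_pos h]
        exact withC_ends _ _ _ _
      · rw [if_pos h, if_neg h]
        simpa only [pat, Bool.not_not] using withoutC_ends (F := F) (!π (some k)) k e
    | none =>
      simp only [Option.getD_none, Option.isNone_none, iff_true, strands]
      by_cases h : e = s (some F.z)
      · rw [if_pos h, if_pos h]
        by_cases hp : π none = true
        · simp only [pat, if_pos hp, ← h]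
          simpa only [Bool.not_not] using openArc_ends (F := F) (!π (some (F.link e))) e
        · simp only [pat, if_neg hp]
          exact closedArc_ends _ _
      · rw [if_neg h, if_neg h]
        exact closedArc_ends _ _
  mem_a s π g e i h := (strands_good s π g e).mem_a i fun h' => h (by rw [h'])
  mem_b s π g e i h := (strands_good s π g e).mem_b i fun h' => h (by rw [h'])
  mem_c s π g e := (strands_good s π g e).mem_c
  cover := strands_cover
  pat_congr s π π' i h := by simp only [pat, h]
  pat_ne s π g _ := by
    cases g with
    | some k => simp only [pat]; cases F.side k <;> simp
    | none => simp only [pat]; simp; split_ifs <;> simp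

end Frame

/-! ### An even number of indices: the paths -/

namespace EvenOrder

variable {w : ℕ}

/-- The index in layer `l` of the zigzag `k - 1, k, k - 2, k + 1, …` through all indices. -/
def pos (k : ZMod (2 * w + 10)) (l : ℕ) : ZMod (2 * w + 10) :=
  if l % 2 = 0 then k - 1 - (l / 2 : ℕ) else k - 1 + ((l + 1) / 2 : ℕ)

/-- The layer of the index `i` in the zigzag of `k`. -/
def layer (k i : ZMod (2 * w + 10)) : ℕ :=
  if (i - (k - 1)).val = 0 then 0
  else if (i - (k - 1)).val ≤ w + 5 then 2 * (i - (k - 1)).val - 1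
  else 2 * (2 * w + 10 - (i - (k - 1)).val)

theorem natCast_order : ((2 * w + 10 : ℕ) : ZMod (2 * w + 10)) = 0 := ZMod.natCast_self _

theorem pos_even (k : ZMod (2 * w + 10)) (t : ℕ) : pos k (2 * t) = k - 1 - t := by
  rw [pos, if_pos (by omega), Nat.mul_div_cancel_left t (by norm_num)]

theorem pos_odd (k : ZMod (2 * w + 10)) (t : ℕ) : pos k (2 * t + 1) = k + t := by
  rw [pos, if_neg (by omega), show (2 * t + 1 + 1) / 2 = t + 1 by omega]
  push_cast; ring

theorem layer_pos (k : ZMod (2 * w + 10)) {l : ℕ} (hl : l < 2 * w + 10) :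
    layer k (pos k l) = l := by
  rcases Nat.even_or_odd' l with ⟨t, rfl | rfl⟩
  · rw [layer, pos_even]
    rcases Nat.eq_zero_or_pos t with rfl | ht
    · simp
    · have h : k - 1 - (t : ZMod (2 * w + 10)) - (k - 1) = ((2 * w + 10 - t : ℕ) : ZMod
        (2 * w + 10)) := by
        rw [Nat.cast_sub (by omega), natCast_order]; ring
      rw [h, ZMod.val_natCast_of_lt (by omega), if_neg (by omega), if_neg (by omega)]
      omega
  · rw [layer, pos_odd]
    have h : k + (t : ZMod (2 * w + 10)) - (k - 1) = ((t + 1 : ℕ) : ZMod (2 * w + 10)) := by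
      push_cast; ring
    rw [h, ZMod.val_natCast_of_lt (by omega), if_neg (by omega), if_pos (by omega)]
    omega

theorem pos_injOn {k : ZMod (2 * w + 10)} {l l' : ℕ} (hl : l < 2 * w + 10) (hl' : l' < 2 * w + 10)
    (h : pos k l = pos k l') : l = l' := by
  rw [← layer_pos k hl, h, layer_pos k hl']

/-- The zigzags of `k` and of the opposite index are the same, with the layers in the opposite
order. -/
theorem pos_opposite (k : ZMod (2 * w + 10)) {l : ℕ} (hl : l < 2 * w + 10) :
    pos (k + ((w + 5 : ℕ) : ZMod (2 * w + 10))) (2 * w + 9 - l) = pos k l := by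
  have h := natCast_order (w := w)
  rcases Nat.even_or_odd' l with ⟨t, rfl | rfl⟩
  · rw [show 2 * w + 9 - 2 * t = 2 * (w + 4 - t) + 1 by omega, pos_odd, pos_even,
      Nat.cast_sub (by omega)]
    push_cast at h ⊢
    linear_combination h
  · rw [show 2 * w + 9 - (2 * t + 1) = 2 * (w + 4 - t) by omega, pos_odd, pos_even,
      Nat.cast_sub (by omega)]
    push_cast; ring

/-- Any two indices are in consecutive layers of a zigzag. -/
theorem exists_pos {i j : ZMod (2 * w + 10)} (hij : i ≠ j) : ∃ t m : ℕ, t < w + 5 ∧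
    m + 1 < 2 * w + 10 ∧ ((i = pos (t : ZMod (2 * w + 10)) m ∧ j = pos (t : ZMod (2 * w + 10))
      (m + 1)) ∨
      (j = pos (t : ZMod (2 * w + 10)) m ∧ i = pos (t : ZMod (2 * w + 10)) (m + 1))) := by
  have key : ∃ k : ZMod (2 * w + 10), ∃ m : ℕ, m + 1 < 2 * w + 10 ∧
      ((i = pos k m ∧ j = pos k (m + 1)) ∨ (j = pos k m ∧ i = pos k (m + 1))) := by
    have hd : j = i + (((j - i).val : ℕ) : ZMod (2 * w + 10)) := by
      rw [ZMod.natCast_zmod_val]; ring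
    have hlt := ZMod.val_lt (j - i)
    have h0 : (j - i).val ≠ 0 := by rwa [Ne, ZMod.val_eq_zero, sub_eq_zero, eq_comm]
    generalize (j - i).val = d at hd hlt h0
    subst hd
    rcases Nat.even_or_odd' d with ⟨t, rfl | rfl⟩
    · obtain ⟨t, rfl⟩ : ∃ u, t = u + 1 := ⟨t - 1, by omega⟩
      refine ⟨i + ((t + 2 : ℕ) : ZMod (2 * w + 10)), 2 * t + 1, by omega, Or.inr ?_⟩
      rw [show 2 * t + 1 + 1 = 2 * (t + 1) by ring, pos_odd, pos_even]
      push_cast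
      exact ⟨by ring, by ring⟩
    · refine ⟨i + ((t + 1 : ℕ) : ZMod (2 * w + 10)), 2 * t, by omega, Or.inl ?_⟩
      rw [pos_odd, pos_even]
      push_cast
      exact ⟨by ring, by ring⟩
  obtain ⟨k, m, hm, h⟩ := key
  by_cases hk : k.val < w + 5
  · refine ⟨k.val, m, hk, hm, ?_⟩
    rwa [ZMod.natCast_zmod_val]
  · have hlt := ZMod.val_lt k
    refine ⟨k.val - (w + 5), 2 * w + 8 - m, by omega, by omega, ?_⟩
    have hk' : ((k.val - (w + 5) : ℕ) : ZMod (2 * w + 10)) =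
        k + ((w + 5 : ℕ) : ZMod (2 * w + 10)) := by
      rw [Nat.cast_sub (by omega), ZMod.natCast_zmod_val]
      have := natCast_order (w := w)
      push_cast at this ⊢
      linear_combination -this
    rw [hk', show 2 * w + 8 - m + 1 = 2 * w + 9 - m by omega,
      show 2 * w + 8 - m = 2 * w + 9 - (m + 1) by omega,
      pos_opposite k (l := m) (by omega), pos_opposite k hm]
    tauto

/-- The edge `a i` or `b i`. -/
def arm (l : Bool) (i : ZMod (2 * w + 10)) : Arm (ZMod (2 * w + 10)) :=
  if l = true then .a (some i) else .b (some i)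

/-- The kind of the edges in the layers of an alternating colour: `true` stands for edges `a i`.
Away from the ends the two kinds alternate. -/
def altLetter (w : ℕ) (e : Bool) (m : ℕ) : Bool :=
  if m = 0 ∨ m = 2 * w + 7 then true else if m = 2 ∨ m = 2 * w + 9 then false
  else decide (m % 2 = 1) == !e

/-- The kind of the edges in the layers of a constant colour on the zigzag of `t`. Away from the
ends all edges are of the same kind. -/
def constLetter (w t : ℕ) (e : Bool) (m : ℕ) : Bool :=
  if m = 0 ∨ m = 2 * w + 7 then false else if m = 2 ∨ m = 2 * w + 9 then true
  else if m = 1 ∧ t = 0 then e else !e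

/-- The first layer and the number of layers of the segment that a constant colour on the zigzag
of `t` traverses in the opposite direction; there is no such segment if the number is `0`. Turning
a segment replaces two pairs of consecutive edges by two others, and these five segments make single
arcs of the cycles that would otherwise be left over. -/
def segment : ℕ → Bool → ℕ × ℕ
  | 0, true => (1, 4)
  | 1, false => (1, 2)
  | 1, true => (4, 3)
  | 2, true => (2, 4)
  | 3, false => (3, 2)
  | _, _ => (0, 0)

/-- The layer in the place `m` of the path if the segment `s` is traversed in the opposite
direction. -/
def turned (s : ℕ × ℕ) (m : ℕ) : ℕ := if s.1 ≤ m ∧ m < s.1 + s.2 then 2 * s.1 + s.2 - 1 - m else m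

/-- The path of an alternating colour of the group `k`, in the order of the layers. -/
def altPath (k : ZMod (2 * w + 10)) (e : Bool) : List (Arm (ZMod (2 * w + 10))) :=
  (List.range' 2 (2 * w + 8)).map fun m => arm (altLetter w e m) (pos k m)

/-- The path of a constant colour, in the order of the layers of the zigzag of `t`. It belongs to
the group `t + (w + 5)`, for which the layers have the opposite order. -/
def constPath (t : ℕ) (e : Bool) : List (Arm (ZMod (2 * w + 10))) :=
  (List.range (2 * w + 8)).map fun n => arm (constLetter w t e (turned (segment t e) n))
    (pos (t : ZMod (2 * w + 10)) (turned (segment t e) n))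

/-- The path of a colour of the group `k`: the colours of the first half of the groups are
alternating, those of the second half are constant. -/
def path (k : ZMod (2 * w + 10)) (e : Bool) : List (Arm (ZMod (2 * w + 10))) :=
  if k.val < w + 5 then altPath k e else (constPath (k.val - (w + 5)) e).reverse

/-- The indices that a colour passes through edges `a i`. -/
def types : Option (ZMod (2 * w + 10)) → Bool → ZMod (2 * w + 10) → Bool
  | some k, e, i => if k.val < w + 5 then altLetter w e (layer k i) else
    constLetter w (k.val - (w + 5)) e (layer ((k.val - (w + 5) : ℕ) : ZMod (2 * w + 10)) i)
  | none, e, _ => !e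

theorem segment_bound (t : ℕ) (e : Bool) : (segment t e).1 + (segment t e).2 ≤ 7 ∧
    ((segment t e).2 = 0 ∨ 1 ≤ (segment t e).1) := by
  unfold segment
  split <;> simp

theorem turned_lt {s : ℕ × ℕ} (hs : s.1 + s.2 ≤ 7) {n : ℕ} (hn : n < 2 * w + 8) :
    turned s n < 2 * w + 8 := by
  unfold turned; split_ifs <;> omega

theorem turned_inj {s : ℕ × ℕ} {n n' : ℕ} (h : turned s n = turned s n') : n = n' := by
  unfold turned at h; split_ifs at h <;> omega

theorem eq_cast_add {k : ZMod (2 * w + 10)} (hk : ¬ k.val < w + 5) :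
    k = ((k.val - (w + 5) : ℕ) : ZMod (2 * w + 10)) + ((w + 5 : ℕ) : ZMod (2 * w + 10)) := by
  rw [← Nat.cast_add, Nat.sub_add_cancel (by omega), ZMod.natCast_zmod_val]

theorem arm_eq_letter (t : ZMod (2 * w + 10) → Bool) (i : ZMod (2 * w + 10)) :
    arm (t i) i = letter t i := rfl

theorem path_good (k : ZMod (2 * w + 10)) (e : Bool) :
    GoodList k (types (some k) e) False
      (.a none :: .b none :: .a (some k) :: .b (some k) :: .a (some (k - 1)) :: path k e) := by
  by_cases hk : k.val < w + 5
  · have hmem : ∀ m ∈ 0 :: List.range' 2 (2 * w + 8), m < 2 * w + 10 ∧ m ≠ 1 := by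
      intro m hm
      rw [List.mem_cons, List.mem_range'_1] at hm
      omega
    refine GoodList.of_perm (Or.inl ⟨rfl, rfl⟩)
      (js := (0 :: List.range' 2 (2 * w + 8)).map (pos k)) (C := []) ?_ ?_ ?_ (Or.inr ⟨rfl, id⟩) ?_
    · refine List.Nodup.map_on (fun x hx y hy h => pos_injOn (hmem x hx).1 (hmem y hy).1 h) ?_
      refine List.nodup_cons.2 ⟨?_, List.nodup_range'⟩
      rw [List.mem_range'_1]; omega
    · intro h
      obtain ⟨m, hm, h⟩ := List.mem_map.1 h
      refine (hmem m hm).2 (pos_injOn (k := k) (hmem m hm).1 (by omega) ?_)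
      rw [h, show 1 = 2 * 0 + 1 by rfl, pos_odd, Nat.cast_zero, add_zero]
    · rw [List.length_map, List.length_cons, List.length_range', ZMod.card]
    · rw [List.nil_append, List.map_map, List.map_cons, path, if_pos hk]
      have h : ∀ m, m < 2 * w + 10 →
          (letter (types (some k) e) ∘ pos k) m = arm (altLetter w e m) (pos k m) := by
        intro m hm
        rw [Function.comp_apply, ← arm_eq_letter]
        simp only [types]
        rw [if_pos hk, layer_pos k hm]
      rw [h 0 (by omega), List.map_congr_left (fun m hm =>
        h m (hmem m (List.mem_cons_of_mem _ hm)).1)]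
      refine List.Perm.of_eq ?_
      rw [show pos k 0 = k - 1 from by rw [show 0 = 2 * 0 by rfl, pos_even]; simp]
      rfl
  · set t := k.val - (w + 5) with ht
    have hkt : k = (t : ZMod (2 * w + 10)) + ((w + 5 : ℕ) : ZMod (2 * w + 10)) := eq_cast_add hk
    have hmem : ∀ m ∈ (2 * w + 9) :: ((List.range (2 * w + 8)).map (turned (segment t e))).reverse,
        m < 2 * w + 10 ∧ m ≠ 2 * w + 8 := by
      intro m hm
      rw [List.mem_cons, List.mem_reverse, List.mem_map] at hm
      rcases hm with rfl | ⟨n, hn, rfl⟩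
      · omega
      · have := turned_lt (w := w) (segment_bound t e).1 (List.mem_range.1 hn)
        omega
    refine GoodList.of_perm (Or.inl ⟨rfl, rfl⟩)
      (js := ((2 * w + 9) :: ((List.range (2 * w + 8)).map (turned (segment t e))).reverse).map
        (pos (t : ZMod (2 * w + 10)))) (C := []) ?_ ?_ ?_ (Or.inr ⟨rfl, id⟩) ?_
    · refine List.Nodup.map_on (fun x hx y hy h => pos_injOn (hmem x hx).1 (hmem y hy).1 h) ?_
      refine List.nodup_cons.2 ⟨?_, List.nodup_reverse.2
        (List.nodup_range.map fun _ _ => turned_inj)⟩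
      rw [List.mem_reverse, List.mem_map]
      rintro ⟨n, hn, h⟩
      have := turned_lt (w := w) (segment_bound t e).1 (List.mem_range.1 hn)
      omega
    · intro h
      obtain ⟨m, hm, h⟩ := List.mem_map.1 h
      refine (hmem m hm).2 (pos_injOn (k := (t : ZMod (2 * w + 10))) (hmem m hm).1 (by omega) ?_)
      rw [h, ← pos_opposite _ (by omega), ← hkt, show 2 * w + 9 - (2 * w + 8) = 2 * 0 + 1 by omega,
        pos_odd, Nat.cast_zero, add_zero]
    · rw [List.length_map, List.length_cons, List.length_reverse, List.length_map,
        List.length_range, ZMod.card]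
    · rw [List.nil_append, List.map_map, List.map_cons, path, if_neg hk, ← ht]
      have h : ∀ m, m < 2 * w + 10 → (letter (types (some k) e) ∘ pos (t : ZMod (2 * w + 10))) m =
          arm (constLetter w t e m) (pos (t : ZMod (2 * w + 10)) m) := by
        intro m hm
        rw [Function.comp_apply, ← arm_eq_letter]
        simp only [types]
        rw [if_neg hk, ← ht, layer_pos _ hm]
      rw [h _ (by omega), List.map_congr_left (fun m hm =>
        h m (hmem m (List.mem_cons_of_mem _ hm)).1)]
      refine List.Perm.of_eq ?_
      have h1 : pos (t : ZMod (2 * w + 10)) (2 * w + 9) = k - 1 := by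
        rw [← pos_opposite _ (by omega), ← hkt, show 2 * w + 9 - (2 * w + 9) = 2 * 0 by omega,
          pos_even]
        simp
      rw [h1, List.map_reverse, List.map_map]
      have h2 : constLetter w t e (2 * w + 9) = true := by simp [constLetter]
      rw [h2]
      rfl

end EvenOrder

/-! ### An even number of indices: the arcs -/

namespace EvenOrder

variable {w : ℕ}

/-- The indices in the arc through the edges `a i`, without its last member `0`. -/
def arcIndexA (w : ℕ) : List ℕ := [1, 4, 3, 2] ++ (List.range' 5 (2 * w + 5)).reverse

/-- The indices in the arc through the edges `b i`, without its last member `0`. -/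
def arcIndexB (w : ℕ) : List ℕ :=
  [2 * w + 9] ++ (List.range (w + 4)).map (fun n => 2 * n + 1) ++
    (List.range (w + 3)).map (fun n => 2 * n + 4) ++ [2]

/-- The part of the arc of `(none, e)` that ends in `a 0`. -/
def arcA (w : ℕ) (e : Bool) : List (Arm (ZMod (2 * w + 10))) :=
  if e = true then [.a (some 0)] else (arcIndexA w).map (fun m : ℕ => .a (some m)) ++ [.a (some 0)]

/-- The part of the arc of `(none, e)` that ends in `b 0`. -/
def arcB (w : ℕ) (e : Bool) : List (Arm (ZMod (2 * w + 10))) :=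
  if e = true then (arcIndexB w).map (fun m : ℕ => .b (some m)) ++ [.b (some 0)] else [.b (some 0)]

/-- The pairs that the frame covers. -/
def Covered (x y : Arm (ZMod (2 * w + 10))) : Prop :=
  (∃ k e, [x, y] <:+: path k e ∨ [y, x] <:+: path k e) ∨
  (∃ e, [x, y] <:+: (arcA w e).reverse ++ arcB w e ∨ [y, x] <:+: (arcA w e).reverse ++ arcB w e) ∨
  ∃ k : ZMod (2 * w + 10), s(x, y) = s(.a (some k), .b (some k)) ∨
    s(x, y) = s(.a (some (k - 1)), if decide (k ≠ 0) = true then .b (some k) else .a (some k)) ∨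
    s(x, y) = s(.b (some (k - 2)), if decide (k ≠ 0) = true then .a (some k) else .b (some k))

theorem Covered.symm {x y : Arm (ZMod (2 * w + 10))} (h : Covered x y) : Covered y x := by
  rcases h with ⟨k, e, h⟩ | ⟨e, h⟩ | ⟨k, h⟩
  · exact Or.inl ⟨k, e, h.symm⟩
  · exact Or.inr (Or.inl ⟨e, h.symm⟩)
  · rw [Sym2.eq_swap] at h
    exact Or.inr (Or.inr ⟨k, h⟩)

theorem covered_alt {t : ℕ} (ht : t < w + 5) (e : Bool) {m : ℕ} (h2 : 2 ≤ m)
    (hm : m + 1 < 2 * w + 10) :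
    Covered (arm (altLetter w e m) (pos (t : ZMod (2 * w + 10)) m))
      (arm (altLetter w e (m + 1)) (pos (t : ZMod (2 * w + 10)) (m + 1))) := by
  refine Or.inl ⟨t, e, Or.inl ?_⟩
  rw [path, if_pos (by rwa [ZMod.val_natCast_of_lt (by omega)])]
  exact infix_map_range' (fun m => arm (altLetter w e m) (pos (t : ZMod (2 * w + 10)) m)) h2
    (by omega)

/-- The edge in layer `m` of a constant colour. -/
def constArm (w t : ℕ) (e : Bool) (m : ℕ) : Arm (ZMod (2 * w + 10)) :=
  arm (constLetter w t e m) (pos (t : ZMod (2 * w + 10)) m)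

theorem covered_turned {t : ℕ} (ht : t < w + 5) (e : Bool) {n : ℕ} (hn : n + 1 < 2 * w + 8) :
    Covered (constArm w t e (turned (segment t e) n))
      (constArm w t e (turned (segment t e) (n + 1))) := by
  refine Or.inl ⟨((t + (w + 5) : ℕ) : ZMod (2 * w + 10)), e, Or.inr ?_⟩
  rw [path, ZMod.val_natCast_of_lt (by omega), if_neg (by omega), Nat.add_sub_cancel,
    infix_pair_reverse]
  exact infix_map_range (fun n => constArm w t e (turned (segment t e) n)) hn

/-- The two pairs that a constant colour gains at its turned segment. -/
theorem covered_gain {t : ℕ} (ht : t < w + 5) (e : Bool) {q r : ℕ} (h : segment t e = (q, r))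
    (hr : r ≠ 0) : Covered (constArm w t e (q - 1)) (constArm w t e (q + r - 1)) ∧
      Covered (constArm w t e q) (constArm w t e (q + r)) := by
  have hs := segment_bound t e
  rw [h] at hs
  dsimp only at hs
  have h1 := covered_turned ht e (n := q - 1) (by omega)
  have h2 := covered_turned ht e (n := q + r - 1) (by omega)
  rw [h, turned, turned, if_neg (by dsimp only; omega), if_pos (by dsimp only; omega)] at h1
  rw [h, turned, turned, if_pos (by dsimp only; omega), if_neg (by dsimp only; omega)] at h2
  dsimp only at h1 h2
  rw [show 2 * q + r - 1 - (q - 1 + 1) = q + r - 1 by omega] at h1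
  rw [show 2 * q + r - 1 - (q + r - 1) = q by omega, show q + r - 1 + 1 = q + r by omega] at h2
  exact ⟨h1, h2⟩

/-- A constant colour keeps the consecutive pairs that are not at an end of its turned segment. -/
theorem covered_kept {t : ℕ} (ht : t < w + 5) (e : Bool) {m : ℕ} (hm : m + 1 < 2 * w + 8)
    {q r : ℕ} (h : segment t e = (q, r)) (hne : r = 0 ∨ (m + 1 ≠ q ∧ m + 1 ≠ q + r)) :
    Covered (constArm w t e m) (constArm w t e (m + 1)) := by
  have hs := segment_bound t e
  rw [h] at hs
  dsimp only at hs
  by_cases hin : q ≤ m ∧ m + 1 < q + r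
  · have h1 := covered_turned ht e (n := 2 * q + r - 1 - (m + 1)) (by omega)
    rw [h, turned, turned, if_pos (by dsimp only; omega), if_pos (by dsimp only; omega)] at h1
    dsimp only at h1
    rw [show 2 * q + r - 1 - (2 * q + r - 1 - (m + 1)) = m + 1 by omega,
      show 2 * q + r - 1 - (2 * q + r - 1 - (m + 1) + 1) = m by omega] at h1
    exact h1.symm
  · have h1 := covered_turned ht e hm
    rwa [h, turned, turned, if_neg (by dsimp only; omega), if_neg (by dsimp only; omega)] at h1

theorem infix_arcA {m m' : ℕ} (h : [m, m'] <:+: arcIndexA w ++ [0]) :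
    Covered (w := w) (.a (some m)) (.a (some m')) := by
  refine Or.inr (Or.inl ⟨false, Or.inr ?_⟩)
  rw [infix_pair_append]
  left
  rw [infix_pair_reverse, arcA, if_neg (by simp)]
  have h1 := List.IsInfix.map (fun m : ℕ => (Arm.a (some m) : Arm (ZMod (2 * w + 10)))) h
  simpa using h1

theorem infix_arcB {m m' : ℕ} (h : [m, m'] <:+: arcIndexB w ++ [0]) :
    Covered (w := w) (.b (some m)) (.b (some m')) := by
  refine Or.inr (Or.inl ⟨true, Or.inl ?_⟩)
  rw [infix_pair_append]
  right; right
  rw [arcB, if_pos rfl]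
  have h1 := List.IsInfix.map (fun m : ℕ => (Arm.b (some m) : Arm (ZMod (2 * w + 10)))) h
  simpa using h1

theorem covered_arcA {m : ℕ} (h5 : 5 ≤ m) (hm : m + 1 < 2 * w + 10) :
    Covered (w := w) (.a (some m)) (.a (some (m + 1 : ℕ))) := by
  refine (infix_arcA ?_).symm
  rw [arcIndexA, infix_pair_append, infix_pair_append, infix_pair_reverse]
  have := infix_map_range' (a := 5) (m := 2 * w + 5) id h5 (by omega)
  rw [List.map_id] at this
  exact Or.inl (Or.inr (Or.inr this))

theorem covered_arcB_odd {n : ℕ} (hn : n + 1 < w + 4) :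
    Covered (w := w) (.b (some (2 * n + 1 : ℕ))) (.b (some (2 * (n + 1) + 1 : ℕ))) := by
  refine infix_arcB ?_
  simp only [arcIndexB, infix_pair_append]
  have := infix_map_range (m := w + 4) (fun n => 2 * n + 1) hn
  tauto

theorem covered_arcB_even {n : ℕ} (hn : n + 1 < w + 3) :
    Covered (w := w) (.b (some (2 * n + 4 : ℕ))) (.b (some (2 * (n + 1) + 4 : ℕ))) := by
  refine infix_arcB ?_
  simp only [arcIndexB, infix_pair_append]
  have := infix_map_range (m := w + 3) (fun n => 2 * n + 4) hn
  tauto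

theorem covered_arcA_special :
    Covered (w := w) (.a (some (1 : ℕ))) (.a (some (4 : ℕ))) ∧
    Covered (w := w) (.a (some (4 : ℕ))) (.a (some (3 : ℕ))) ∧
    Covered (w := w) (.a (some (3 : ℕ))) (.a (some (2 : ℕ))) ∧
    Covered (w := w) (.a (some (2 : ℕ))) (.a (some (2 * w + 9 : ℕ))) ∧
    Covered (w := w) (.a (some (5 : ℕ))) (.a (some (0 : ℕ))) := by
  have h1 : (List.range' 5 (2 * w + 5)).head? = some 5 := rfl
  have h2 : (List.range' 5 (2 * w + 5)).getLast? = some (2 * w + 9) := by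
    rw [List.range'_concat, List.getLast?_append]
    simp
    omega
  refine ⟨infix_arcA ?_, infix_arcA ?_, infix_arcA ?_, infix_arcA ?_, infix_arcA ?_⟩ <;>
  simp [arcIndexA, infix_pair_append, infix_pair_cons, h1, h2]

theorem covered_arcB_special :
    Covered (w := w) (.b (some (2 * w + 9 : ℕ))) (.b (some (1 : ℕ))) ∧
    Covered (w := w) (.b (some (2 * w + 7 : ℕ))) (.b (some (4 : ℕ))) ∧
    Covered (w := w) (.b (some (2 * w + 8 : ℕ))) (.b (some (2 : ℕ))) ∧
    Covered (w := w) (.b (some (2 : ℕ))) (.b (some (0 : ℕ))) := by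
  have h1 : ((List.range (w + 4)).map fun n => 2 * n + 1).head? = some 1 := by
    simp [List.range_succ_eq_map]
  have h2 : ((List.range (w + 4)).map fun n => 2 * n + 1).getLast? = some (2 * w + 7) := by
    simp [List.range_succ]; omega
  have h3 : ((List.range (w + 3)).map fun n => 2 * n + 4).head? = some 4 := by
    simp [List.range_succ_eq_map]
  have h4 : ((List.range (w + 3)).map fun n => 2 * n + 4).getLast? = some (2 * w + 8) := by
    simp [List.range_succ]; omega
  refine ⟨infix_arcB ?_, infix_arcB ?_, infix_arcB ?_, infix_arcB ?_⟩ <;>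
  simp only [arcIndexB, infix_pair_append, List.getLast?_append, h1, h2, h3,
    h4] <;>
  simp

theorem covered_junction :
    Covered (w := w) (.b (some (2 * w + 9 : ℕ))) (.a (some (0 : ℕ))) ∧
    Covered (w := w) (.b (some (0 : ℕ))) (.a (some (1 : ℕ))) := by
  constructor
  · refine Or.inr (Or.inl ⟨true, Or.inr ?_⟩)
    simp [arcA, arcB, arcIndexB, infix_pair_cons]
  · refine Or.inr (Or.inl ⟨false, Or.inr ?_⟩)
    simp [arcA, arcB, arcIndexA, infix_pair_cons, infix_pair_append]

end EvenOrder

/-! ### An even number of indices: the exceptional pairs -/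

namespace EvenOrder

variable {w : ℕ}

theorem cast_top :
    ((2 * w + 9 : ℕ) : ZMod (2 * w + 10)) = -1 ∧ ((2 * w + 8 : ℕ) : ZMod (2 * w + 10)) = -2 ∧
    ((2 * w + 7 : ℕ) : ZMod (2 * w + 10)) = -3 := by
  have h := natCast_order (w := w)
  push_cast at h ⊢
  exact ⟨by linear_combination h, by linear_combination h, by linear_combination h⟩

/-- The pairs on the arcs that are not among those of `covered_arcA`, `covered_arcB_odd` and
`covered_arcB_even`. -/
theorem covered_arcs :
    Covered (w := w) (.a (some 1)) (.a (some 4)) ∧ Covered (w := w) (.a (some 4)) (.a (some 3)) ∧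
    Covered (w := w) (.a (some 3)) (.a (some 2)) ∧ Covered (w := w) (.a (some 2)) (.a (some (-1))) ∧
    Covered (w := w) (.a (some 5)) (.a (some 0)) ∧ Covered (w := w) (.b (some (-1))) (.b (some 1)) ∧
    Covered (w := w) (.b (some (-3))) (.b (some 4)) ∧
    Covered (w := w) (.b (some (-2))) (.b (some 2)) ∧ Covered (w := w) (.b (some 2)) (.b (some 0)) ∧
    Covered (w := w) (.b (some (-1))) (.a (some 0)) ∧ Covered (w := w) (.b (some 0))
      (.a (some 1)) := by
  have h := covered_arcA_special (w := w)
  have h' := covered_arcB_special (w := w)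
  have h'' := covered_junction (w := w)
  rw [cast_top.1] at h h' h''
  rw [cast_top.2.1, cast_top.2.2] at h'
  simp only [Nat.cast_ofNat, Nat.cast_one, Nat.cast_zero] at h h' h''
  exact ⟨h.1, h.2.1, h.2.2.1, h.2.2.2.1, h.2.2.2.2, h'.1, h'.2.1, h'.2.2.1, h'.2.2.2, h''⟩

/-- The pairs that the constant colours gain at their turned segments. -/
theorem covered_gains :
    Covered (w := w) (.b (some 0)) (.a (some (-1))) ∧ Covered (w := w) (.a (some 1)) (.a (some 2)) ∧
    Covered (w := w) (.b (some (-1))) (.b (some (-3))) ∧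
    Covered (w := w) (.a (some 0)) (.b (some 2)) ∧ Covered (w := w) (.b (some 2)) (.b (some (-3))) ∧
    Covered (w := w) (.b (some (-2))) (.b (some 4)) ∧ Covered (w := w) (.b (some 2)) (.b (some 4)) ∧
    Covered (w := w) (.a (some 0)) (.b (some (-2))) ∧ Covered (w := w) (.a (some 1)) (.a (some 0)) ∧
    Covered (w := w) (.a (some 4)) (.a (some 5)) := by
  have h1 := covered_gain (w := w) (t := 1) (by omega) false rfl (by norm_num)
  have h2 := covered_gain (w := w) (t := 0) (by omega) true rfl (by norm_num)
  have h3 := covered_gain (w := w) (t := 1) (by omega) true rfl (by norm_num)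
  have h4 := covered_gain (w := w) (t := 2) (by omega) true rfl (by norm_num)
  have h5 := covered_gain (w := w) (t := 3) (by omega) false rfl (by norm_num)
  simp [constArm, constLetter, pos, arm] at h1 h2 h3 h4 h5
  norm_num at h1 h2 h3 h4 h5
  exact ⟨h1.1, h1.2, h2.1, h2.2, h3.1, h3.2, h4.1, h4.2, h5.1, h5.2⟩

/-- The pairs of consecutive layers of a constant colour are covered, although some of them are lost
at the ends of the turned segment: these are on the arcs or among those gained at another segment.
-/
theorem covered_const {t : ℕ} (ht : t < w + 5) (e : Bool) {m : ℕ} (hm : m + 1 < 2 * w + 8) :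
    Covered (constArm w t e m) (constArm w t e (m + 1)) := by
  obtain ⟨⟨q, r⟩, hs⟩ : ∃ s, segment t e = s := ⟨_, rfl⟩
  by_cases h : r = 0 ∨ (m + 1 ≠ q ∧ m + 1 ≠ q + r)
  · exact covered_kept ht e hm hs h
  · have hA := covered_arcs (w := w)
    have hG := covered_gains (w := w)
    unfold segment at hs
    split at hs <;> obtain ⟨rfl, rfl⟩ := Prod.mk.inj hs
    · have h' : m = 0 ∨ m = 4 := by omega
      rcases h' with rfl | rfl
      · have := hA.2.2.2.2.2.2.2.2.2.1
        simp [constArm, constLetter, pos, arm]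
        exact this
      · have := hG.2.2.2.2.1.symm
        simp [constArm, constLetter, pos, arm]
        norm_num
        exact this
    · have h' : m = 0 ∨ m = 2 := by omega
      rcases h' with rfl | rfl
      · have := hA.2.2.2.2.2.2.2.2.2.2
        simp [constArm, constLetter, pos, arm]
        exact this
      · have := hA.2.2.2.1.symm
        simp [constArm, constLetter, pos, arm]
        exact this
    · have h' : m = 3 ∨ m = 6 := by omega
      rcases h' with rfl | rfl
      · have := hA.2.2.2.2.2.2.2.1.symm
        simp [constArm, constLetter, pos, arm]
        exact this
      · have := hA.2.2.2.2.2.2.1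
        simp [constArm, constLetter, pos, arm]
        exact this
    · have h' : m = 1 ∨ m = 5 := by omega
      rcases h' with rfl | rfl
      · have := hG.2.2.2.1.symm
        simp [constArm, constLetter, pos, arm]
        norm_num
        exact this
      · have := hG.2.2.2.2.2.1.symm
        simp [constArm, constLetter, pos, arm]
        norm_num
        exact this
    · have h' : m = 2 ∨ m = 4 := by omega
      rcases h' with rfl | rfl
      · have := hA.1
        simp [constArm, constLetter, pos, arm]
        norm_num
        exact this
      · have := hA.2.2.2.2.1.symm
        simp [constArm, constLetter, pos, arm]
        norm_num
        exact this
    · omega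

theorem exists_natCast (k : ZMod (2 * w + 10)) :
    ∃ n : ℕ, n < 2 * w + 10 ∧ (n : ZMod (2 * w + 10)) = k :=
  ⟨k.val, ZMod.val_lt k, ZMod.natCast_zmod_val k⟩

/-- Pairs of both kinds in the first layers of the zigzags. If `k` is not `0`, they are covered in
the group `k`, where they contain an edge with the own index. -/
theorem covered_ab (k : ZMod (2 * w + 10)) :
    Covered (.a (some (k - 1))) (.b (some k)) ∧ Covered (.b (some (k - 2))) (.a (some k)) := by
  by_cases hk : k = 0
  · have hG := covered_gains (w := w)
    subst hk
    simp only [zero_sub]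
    exact ⟨hG.1.symm, hG.2.2.2.2.2.2.2.1.symm⟩
  · exact ⟨Or.inr (Or.inr ⟨k, Or.inr (Or.inl (by simp [hk]))⟩),
      Or.inr (Or.inr ⟨k, Or.inr (Or.inr (by simp [hk]))⟩)⟩

/-- The edges `a i` in the first two layers of the zigzags. Most of these pairs are consecutive on
the arc through the edges `a i`. -/
theorem covered_aa (k : ZMod (2 * w + 10)) : Covered (.a (some (k - 1))) (.a (some k)) := by
  have hA := covered_arcs (w := w)
  have hG := covered_gains (w := w)
  obtain ⟨n, hn, rfl⟩ := exists_natCast k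
  rcases Nat.lt_or_ge n 6 with h | h
  · interval_cases n
    · exact Or.inr (Or.inr ⟨0, Or.inr (Or.inl (by simp))⟩)
    · convert hG.2.2.2.2.2.2.2.2.1.symm using 3 <;> norm_num
    · convert hG.2.1 using 3 <;> norm_num
    · convert hA.2.2.1.symm using 3 <;> norm_num
    · convert hA.2.1.symm using 3 <;> norm_num
    · convert hG.2.2.2.2.2.2.2.2.2 using 3 <;> norm_num
  · have h1 := covered_arcA (w := w) (m := n - 1) (by omega) (by omega)
    rw [Nat.sub_add_cancel (by omega)] at h1
    convert h1 using 3
    rw [Nat.cast_sub (by omega), Nat.cast_one]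

/-- The edges `b i` in the second and third layers of the zigzags. Most of these pairs are
consecutive on the arc through the edges `b i`. -/
theorem covered_bb (k : ZMod (2 * w + 10)) : Covered (.b (some (k - 2))) (.b (some k)) := by
  have hA := covered_arcs (w := w)
  have hG := covered_gains (w := w)
  obtain ⟨n, hn, rfl⟩ := exists_natCast k
  rcases Nat.lt_or_ge n 3 with h | h
  · interval_cases n
    · exact Or.inr (Or.inr ⟨0, Or.inr (Or.inr (by simp))⟩)
    · convert hA.2.2.2.2.2.1 using 3 <;> norm_num
    · convert hA.2.2.2.2.2.2.2.2.1.symm using 3 <;> norm_num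
  · rcases Nat.even_or_odd' n with ⟨t, rfl | rfl⟩
    · by_cases ht : t = 2
      · subst ht
        convert hG.2.2.2.2.2.2.1 using 3 <;> norm_num
      · have h1 := covered_arcB_even (w := w) (n := t - 3) (by omega)
        rw [show 2 * (t - 3 + 1) + 4 = 2 * t by omega, show 2 * (t - 3) + 4 = 2 * t - 2 by
          omega] at h1
        convert h1 using 3
        rw [Nat.cast_sub (by omega), Nat.cast_ofNat]
    · by_cases ht : t = w + 4
      · subst ht
        have h1 := hG.2.2.1.symm
        rw [show 2 * (w + 4) + 1 = 2 * w + 9 by ring, cast_top.1]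
        convert h1 using 3
        norm_num
      · have h1 := covered_arcB_odd (w := w) (n := t - 1) (by omega)
        rw [show 2 * (t - 1 + 1) + 1 = 2 * t + 1 by omega,
          show 2 * (t - 1) + 1 = 2 * t + 1 - 2 by omega] at h1
        convert h1 using 3
        rw [Nat.cast_sub (by omega), Nat.cast_ofNat]

end EvenOrder

/-! ### An even number of indices: the frame -/

namespace EvenOrder

variable {w : ℕ}

theorem covered_const_arm {t : ℕ} (ht : t < w + 5) (e : Bool) {m : ℕ} (hm : m + 1 < 2 * w + 8)
    {l l' : Bool} (h : constLetter w t e m = l) (h' : constLetter w t e (m + 1) = l') :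
    Covered (arm l (pos (t : ZMod (2 * w + 10)) m))
      (arm l' (pos (t : ZMod (2 * w + 10)) (m + 1))) := by
  rw [← h, ← h']
  exact covered_const ht e hm

theorem covered_alt_arm {t : ℕ} (ht : t < w + 5) (e : Bool) {m : ℕ} (h2 : 2 ≤ m)
    (hm : m + 1 < 2 * w + 10) {l l' : Bool} (h : altLetter w e m = l)
    (h' : altLetter w e (m + 1) = l') :
    Covered (arm l (pos (t : ZMod (2 * w + 10)) m))
      (arm l' (pos (t : ZMod (2 * w + 10)) (m + 1))) := by
  rw [← h, ← h']
  exact covered_alt ht e h2 hm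

theorem constLetter_eq (t : ℕ) (e : Bool) {m : ℕ} (h : 3 ≤ m) (h' : m < 2 * w + 7) :
    constLetter w t e m = !e := by
  rw [constLetter, if_neg (by omega), if_neg (by omega), if_neg (by omega)]

theorem altLetter_eq (e : Bool) {m : ℕ} (h : 3 ≤ m) (h' : m ≠ 2 * w + 7) (h'' : m ≠ 2 * w + 9) :
    altLetter w e m = (decide (m % 2 = 1) == !e) := by
  rw [altLetter, if_neg (by omega), if_neg (by omega)]

/-- Any two edges in consecutive layers of a zigzag are covered. Away from the ends, the four
combinations of kinds occur in the two alternating and the two constant colours on this zigzag. -/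
theorem covered_arm (l l' : Bool) {t m : ℕ} (ht : t < w + 5) (hm : m + 1 < 2 * w + 10) :
    Covered (arm l (pos (t : ZMod (2 * w + 10)) m))
      (arm l' (pos (t : ZMod (2 * w + 10)) (m + 1))) := by
  -- The last layers are the first layers of the zigzag of the opposite index.
  have far : ∀ m, m < 2 * w + 10 → pos (t : ZMod (2 * w + 10)) m =
      pos ((t : ZMod (2 * w + 10)) + ((w + 5 : ℕ) : ZMod (2 * w + 10))) (2 * w + 9 - m) :=
    fun m hm => (pos_opposite _ hm).symm
  have pos0 : ∀ k : ZMod (2 * w + 10), pos k 0 = k - 1 := fun k => by simp [pos]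
  have pos1 : ∀ k : ZMod (2 * w + 10), pos k 1 = k := fun k => by simp [pos]
  have pos2 : ∀ k : ZMod (2 * w + 10), pos k 2 = k - 2 := fun k => by simp [pos]; ring
  rcases Nat.lt_or_ge m 3 with h3 | h3
  · interval_cases m
    · cases l
      · by_cases h0 : t = 0
        · exact covered_const_arm ht l' (by omega) (by simp [constLetter])
            (by simp [constLetter, h0])
        · exact covered_const_arm ht (!l') (by omega) (by simp [constLetter])
            (by simp [constLetter, h0])
      · rw [pos0, pos1]
        cases l'
        · exact (covered_ab _).1
        · exact covered_aa _
    · cases l'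
      · rw [pos1, pos2]
        cases l
        · exact (covered_bb _).symm
        · exact (covered_ab _).2.symm
      · by_cases h0 : t = 0
        · exact covered_const_arm ht l (by omega) (by simp [constLetter, h0])
            (by simp [constLetter])
        · exact covered_const_arm ht (!l) (by omega) (by simp [constLetter, h0])
            (by simp [constLetter])
    · cases l
      · refine covered_alt_arm ht (!l') le_rfl (by omega) (by simp [altLetter]) ?_
        rw [altLetter_eq _ (by omega) (by omega) (by omega)]
        simp
      · refine covered_const_arm ht (!l') (by omega) (by simp [constLetter]) ?_
        rw [constLetter_eq _ _ (by omega) (by omega), Bool.not_not]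
  rcases Nat.lt_or_ge m (2 * w + 6) with h6 | h6
  · by_cases hl : l = l'
    · subst hl
      refine covered_const_arm ht (!l) (by omega) ?_ ?_ <;>
      rw [constLetter_eq _ _ (by omega) (by omega), Bool.not_not]
    · have hl' : l' = !l := by cases l <;> cases l' <;> simp_all
      subst hl'
      rcases Nat.mod_two_eq_zero_or_one m with h | h
      · refine covered_alt_arm ht l (by omega) hm ?_ ?_ <;>
        rw [altLetter_eq _ (by omega) (by omega) (by omega)]
        · rw [h]; cases l <;> rfl
        · rw [show (m + 1) % 2 = 1 by omega]; cases l <;> rfl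
      · refine covered_alt_arm ht (!l) (by omega) hm ?_ ?_ <;>
        rw [altLetter_eq _ (by omega) (by omega) (by omega)]
        · rw [h]; cases l <;> rfl
        · rw [show (m + 1) % 2 = 0 by omega]; cases l <;> rfl
  have hfar : pos (t : ZMod (2 * w + 10)) (2 * w + 8) =
      (t : ZMod (2 * w + 10)) + ((w + 5 : ℕ) : ZMod (2 * w + 10)) := by
    rw [far _ (by omega), show 2 * w + 9 - (2 * w + 8) = 1 by omega, pos1]
  have heven : ∀ e, altLetter w e (2 * w + 6) = e ∧ altLetter w e (2 * w + 8) = e := by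
    intro e
    rw [altLetter_eq _ (by omega) (by omega) (by omega),
      altLetter_eq _ (by omega) (by omega) (by omega), show (2 * w + 6) % 2 = 0 by omega,
      show (2 * w + 8) % 2 = 0 by omega]
    cases e <;> exact ⟨rfl, rfl⟩
  obtain rfl | rfl | rfl : m = 2 * w + 6 ∨ m = 2 * w + 7 ∨ m = 2 * w + 8 := by omega
  · cases l'
    · refine covered_const_arm ht (!l) (by omega) ?_ (by simp [constLetter])
      rw [constLetter_eq _ _ (by omega) (by omega), Bool.not_not]
    · exact covered_alt_arm ht l (by omega) hm (heven l).1 (by simp [altLetter])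
  · cases l
    · rw [show 2 * w + 7 + 1 = 2 * w + 8 by rfl, hfar, far (2 * w + 7) (by omega),
        show 2 * w + 9 - (2 * w + 7) = 2 by omega, pos2]
      cases l'
      · exact covered_bb _
      · exact (covered_ab _).2
    · exact covered_alt_arm ht l' (by omega) hm (by simp [altLetter]) (heven l').2
  · cases l'
    · exact covered_alt_arm ht l (by omega) hm (heven l).2 (by simp [altLetter])
    · rw [show 2 * w + 8 + 1 = 2 * w + 9 by rfl, hfar, far (2 * w + 9) (by omega),
        show 2 * w + 9 - (2 * w + 9) = 0 by omega, pos0]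
      cases l
      · exact (covered_ab _).1.symm
      · exact (covered_aa _).symm

theorem covered_of_ne {x y : Arm (ZMod (2 * w + 10))} (hx : ∃ i, x = .a (some i) ∨ x = .b (some i))
    (hy : ∃ i, y = .a (some i) ∨ y = .b (some i)) (hxy : x ≠ y) : Covered x y := by
  have harm : ∀ z : Arm (ZMod (2 * w + 10)), (∃ i, z = .a (some i) ∨ z = .b (some i)) →
      ∃ l i, z = arm l i := by
    rintro z ⟨i, rfl | rfl⟩
    · exact ⟨true, i, rfl⟩
    · exact ⟨false, i, rfl⟩
  obtain ⟨l, i, rfl⟩ := harm x hx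
  obtain ⟨l', j, rfl⟩ := harm y hy
  by_cases hij : i = j
  · subst hij
    refine Or.inr (Or.inr ⟨i, Or.inl ?_⟩)
    cases l <;> cases l'
    · exact absurd rfl hxy
    · exact Sym2.eq_swap
    · rfl
    · exact absurd rfl hxy
  · obtain ⟨t, m, ht, hm, ⟨rfl, rfl⟩ | ⟨rfl, rfl⟩⟩ := exists_pos hij
    · exact covered_arm l l' ht hm
    · exact (covered_arm l' l ht hm).symm

theorem nodup_arcIndexA (w : ℕ) : (arcIndexA w).Nodup := by
  rw [arcIndexA, List.nodup_append]
  refine ⟨by decide, List.nodup_reverse.2 List.nodup_range', fun x hx y hy => ?_⟩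
  rw [List.mem_reverse, List.mem_range'_1] at hy
  simp only [List.mem_cons, List.not_mem_nil, or_false] at hx
  omega

theorem nodup_arcIndexB (w : ℕ) : (arcIndexB w).Nodup := by
  simp only [arcIndexB, List.nodup_append, List.mem_append, List.mem_map, List.mem_range,
    List.mem_singleton]
  refine ⟨⟨⟨by simp, List.nodup_range.map fun _ _ h => by simpa using h, ?_⟩,
    List.nodup_range.map fun _ _ h => by simpa using h, ?_⟩, by simp, ?_⟩
  · rintro x rfl y ⟨n, hn, rfl⟩; omega
  · rintro x (rfl | ⟨n, hn, rfl⟩) y ⟨n', hn', rfl⟩ <;> omega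
  · rintro x ((rfl | ⟨n, hn, rfl⟩) | ⟨n, hn, rfl⟩) y rfl <;> omega

theorem mem_arcIndexA {m : ℕ} (h : m ∈ arcIndexA w) : 0 < m ∧ m < 2 * w + 10 := by
  simp only [arcIndexA, List.mem_append, List.mem_reverse, List.mem_range'_1, List.mem_cons,
    List.not_mem_nil, or_false] at h
  omega

theorem mem_arcIndexB {m : ℕ} (h : m ∈ arcIndexB w) : 0 < m ∧ m < 2 * w + 10 := by
  simp only [arcIndexB, List.mem_append, List.mem_map, List.mem_range, List.mem_singleton] at h
  obtain ((rfl | ⟨n, hn, rfl⟩) | ⟨n, hn, rfl⟩) | rfl := h <;> omega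

/-- An arc whose indices are all the nonzero ones has the prescribed edges. -/
theorem good_of_indices {js : List ℕ} (hjs : js.Nodup) (hmem : ∀ m ∈ js, 0 < m ∧ m < 2 * w + 10)
    (hlen : js.length = 2 * w + 9) (e : Bool) {l : List (Arm (ZMod (2 * w + 10)))}
    (hl : l.Perm (.a none :: .b none :: .a (some 0) :: .b (some 0) ::
      js.map fun m : ℕ => arm (!e) (m : ZMod (2 * w + 10)))) :
    GoodList 0 (types (w := w) none e) False l := by
  have hinj : ∀ m < 2 * w + 10, ∀ m' < 2 * w + 10,
      (m : ZMod (2 * w + 10)) = m' → m = m' := by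
    intro m hm m' hm' h
    rw [← ZMod.val_natCast_of_lt hm, h, ZMod.val_natCast_of_lt hm']
  refine GoodList.of_perm (Or.inl ⟨rfl, rfl⟩) (js := js.map fun m : ℕ => (m : ZMod (2 * w + 10)))
    (C := []) ?_ ?_ ?_ (Or.inr ⟨rfl, id⟩) ?_
  · exact hjs.map_on fun x hx y hy h => hinj x (hmem x hx).2 y (hmem y hy).2 h
  · intro h
    obtain ⟨m, hm, h⟩ := List.mem_map.1 h
    have := hinj m (hmem m hm).2 0 (by omega) (by rw [h, Nat.cast_zero])
    have := (hmem m hm).1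
    omega
  · rw [List.length_map, hlen, ZMod.card]
  · rw [List.nil_append, List.map_map]
    exact hl

theorem arc_good (e : Bool) : GoodList 0 (types (w := w) none e) False
    (.a none :: .b none :: (arcA w e ++ arcB w e)) := by
  cases e
  · refine good_of_indices (nodup_arcIndexA w) (fun m => mem_arcIndexA) ?_ _ ?_
    · simp [arcIndexA]
    refine List.Perm.cons _ (List.Perm.cons _ ?_)
    rw [arcA, arcB, if_neg (by simp), if_neg (by simp), List.append_assoc]
    exact List.perm_append_comm
  · refine good_of_indices (nodup_arcIndexB w) (fun m => mem_arcIndexB) ?_ _ ?_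
    · simp [arcIndexB]; omega
    refine List.Perm.cons _ (List.Perm.cons _ ?_)
    rw [arcA, arcB, if_pos rfl, if_pos rfl, List.singleton_append]
    exact List.Perm.cons _ List.perm_append_comm

theorem head?_map_range' {α : Type*} (f : ℕ → α) (a m : ℕ) :
    ((List.range' a (m + 1)).map f).head? = some (f a) ∧
      ((List.range' a (m + 1)).map f).getLast? = some (f (a + m)) := by
  refine ⟨rfl, ?_⟩
  rw [List.range'_concat, List.map_append, List.getLast?_append]
  simp

theorem turned_zero (t : ℕ) (e : Bool) : turned (segment t e) 0 = 0 := by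
  have := segment_bound t e
  rw [turned, if_neg (by omega)]

theorem turned_last (t : ℕ) (e : Bool) : turned (segment t e) (2 * w + 7) = 2 * w + 7 := by
  have := segment_bound t e
  rw [turned, if_neg (by omega)]

theorem path_head (k : ZMod (2 * w + 10)) (e : Bool) :
    (path k e).head? = some (.b (some (k - 2))) := by
  by_cases hk : k.val < w + 5
  · rw [path, if_pos hk, altPath, (head?_map_range' _ _ _).1]
    simp [altLetter, arm, pos]
    ring
  · rw [path, if_neg hk, List.head?_reverse, constPath, List.range_eq_range',
      (head?_map_range' _ _ _).2, zero_add, turned_last]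
    have h := eq_cast_add hk
    generalize k.val - (w + 5) = t at h
    rw [show pos (t : ZMod (2 * w + 10)) (2 * w + 7) = (t : ZMod (2 * w + 10)) + (w + 3 : ℕ) by
      rw [show 2 * w + 7 = 2 * (w + 3) + 1 by ring, pos_odd], h]
    simp [constLetter, arm]
    ring

theorem path_last (k : ZMod (2 * w + 10)) (e : Bool) :
    (path k e).getLast? = some (.b (some (k - 1 + ((w + 5 : ℕ) : ZMod (2 * w + 10))))) := by
  by_cases hk : k.val < w + 5
  · rw [path, if_pos hk, altPath, (head?_map_range' _ _ _).2,
      show 2 + (2 * w + 7) = 2 * (w + 4) + 1 by ring, pos_odd]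
    simp [altLetter, arm, show 2 * (w + 4) + 1 = 2 * w + 9 by ring]
    ring
  · rw [path, if_neg hk, List.getLast?_reverse, constPath, List.range_eq_range',
      (head?_map_range' _ _ _).1, turned_zero]
    have h := eq_cast_add hk
    generalize k.val - (w + 5) = t at h
    have h0 := natCast_order (w := w)
    rw [show pos (t : ZMod (2 * w + 10)) 0 = t - 1 by simp [pos], h]
    simp only [constLetter, arm]
    simp
    push_cast at h0
    linear_combination -h0

/-- The frame for an even number of groups, at least ten. -/
def frame (w : ℕ) : Frame (ZMod (2 * w + 10)) where
  p k := k - 1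
  s k := k - 2
  q k := k - 1 + ((w + 5 : ℕ) : ZMod (2 * w + 10))
  p_surjective k := ⟨k + 1, by ring⟩
  s_surjective k := ⟨k + 2, by ring⟩
  q_surjective k := ⟨k + 1 - ((w + 5 : ℕ) : ZMod (2 * w + 10)), by ring⟩
  side k := decide (k ≠ 0)
  path := path
  path_head := path_head
  path_last := path_last
  z := 0
  link e := if e = true then 1 else 2
  arcA := arcA w
  arcB := arcB w
  arcA_head e := by
    cases e
    · simp [arcA, arcIndexA]; norm_num
    · simp [arcA]
  arcA_last e := by cases e <;> simp [arcA]
  arcB_head e := by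
    cases e
    · simp [arcB]
    · rw [arcB, if_pos rfl, arcIndexB]
      simp only [List.cons_append, List.map_cons, List.head?_cons,
        cast_top.1, if_pos]
      norm_num
  arcB_last e := by cases e <;> simp [arcB]
  typ := types
  path_good := path_good
  arc_good := arc_good
  cover _ _ := covered_of_ne

end EvenOrder

/-! ### The complete graph is a Hamilton fragment -/

/-- The construction of the local design depends on the number `n - 1` of indices: it is odd and at
least three, even and at least ten, or one of the remaining six numbers. -/
theorem isHamiltonFragment_top (n : ℕ) (hn : 0 < n) :
    IsHamiltonFragment.{u} (⊤ : SimpleGraph (FragmentVertex n)) := by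
  by_cases h1 : n = 1
  · exact isHamiltonFragment_top_of_localDesign (by simp [h1]) designZero
  by_cases h2 : n = 2
  · exact isHamiltonFragment_top_of_localDesign (by simp [h2]) designOne
  rcases Nat.even_or_odd' n with ⟨H, rfl | rfl⟩
  · exact isHamiltonFragment_top_of_localDesign (I := ZMod (2 * (H - 1) + 1))
      (by rw [ZMod.card]; omega) (OddOrder.design (by omega))
  · by_cases h10 : 5 ≤ H
    · obtain ⟨w, rfl⟩ := Nat.exists_eq_add_of_le h10
      exact isHamiltonFragment_top_of_localDesign (I := ZMod (2 * w + 10))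
        (by rw [ZMod.card]; omega) (EvenOrder.frame w).design
    · obtain rfl | rfl | rfl | rfl : H = 1 ∨ H = 2 ∨ H = 3 ∨ H = 4 := by omega
      · exact isHamiltonFragment_top_of_localDesign (by simp) Table.valid_tableTwo.design
      · exact isHamiltonFragment_top_of_localDesign (by simp) Table.valid_tableFour.design
      · exact isHamiltonFragment_top_of_localDesign (by simp) Table.valid_tableSix.design
      · exact isHamiltonFragment_top_of_localDesign (by simp) Table.valid_tableEight.design

end HamiltonFragments

theorem mainTheorem3 (n : ℕ) (hn : 0 < n) :
    ∃ 𝒟 : Set (SimpleGraph (HamiltonFragments.FragmentVertex n)),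
      HamiltonFragments.IsDecomposition (⊤ : SimpleGraph (HamiltonFragments.FragmentVertex n)) 𝒟 ∧
        ∀ H ∈ 𝒟, HamiltonFragments.IsHamiltonFragment.{u} H := by
  refine ⟨{⊤}, HamiltonFragments.isDecomposition_singleton
    (HamiltonFragments.fragmentVertex_top_ne_bot n), ?_⟩
  rintro _ rfl
  exact HamiltonFragments.isHamiltonFragment_top n hn
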